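/- Fix the signature $\{\cdot,{}^{-1},1\}$ of groups. A structure is \emph{computable} if its universe is a subset of $\mathbb N$ and its atomic diagram is computable. Let $W_0,W_1,\dots$ be the standard enumeration of the computably enumerable (c.e.) sets. A \emph{computable} $\Sigma_0$ or $\Pi_0$ formula is a finitary quantifier-free formula. For $n>0$, a computable $\Sigma_n$ formula is the disjunction of a c.e. family of formulas $\exists\bar x\,\psi$ with $\psi$ a computable $\Pi_m$ formula, $m<n$. Dually, a computable $\Pi_n$ formula is the conjunction of a c.e. family of formulas $\forall\bar x\,\psi$ with $\psi$ a computable $\Sigma_m$ formula, $m<n$. (The family is c.e. in the sense that the indices of its members form a c.e. set.) A computable d-$\Sigma_n$ formula is the conjunction of a computable $\Sigma_n$ formula and a computable $\Pi_n$ formula. A \emph{pseudo-Scott sentence} for a structure $\mathcal A$ is a sentence of $\mathcal L_{\omega_1,\omega}$ whose computable models are exactly the computable structures isomorphic to $\mathcal A$. For a subgroup $G\le\mathbb Q$ with $1\in G$, let $P^{\infty}(G)$ be the set of primes $p$ such that $p^k\mid 1$ in $G$ for all $k$. Let $P^{\mathrm{fin}}(G)$ be the set of primes $p$ such that $p\mid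 1$ in $G$ but $p^k\nmid 1$ in $G$ for some $k$. Let $p_i$ denote the $i$-th prime, starting with $p_0=2$. \textbf{Theorem.} (1) There is a c.e. set $X\subseteq\mathbb N$ with the following properties. \begin{itemize} \item $X\equiv_T 0'$, and there is a uniformly c.e. sequence $(S_n)_{n\in\mathbb N}$ such that $S_n$ is an infinite subset of $W_n\setminus X$ for every $n$ with $W_n\supseteq X$ and $W_n\setminus X$ infinite. \item There is a subgroup $G\le\mathbb Q$ with $1\in G$, $P^{\mathrm{fin}}(G)=\emptyset$ and $P^\infty(G)=\{p_i : i\in X\}$ that is isomorphic to a computable structure and has both a computable $\Sigma_3$ and a computable $\Pi_3$ pseudo-Scott sentence, but has no computable d-$\Sigma_2$ pseudo-Scott sentence. \end{itemize} (2) Every structure in this signature that has a computable d-$\Sigma_2$ pseudo-Scott sentence has both a computable $\Sigma_3$ and a computable $\Pi_3$ pseudo-Scott sentence. Hence, by (1), for pseudo-Scott sentences d-$\Sigma_2$ is strictly contained in $\Delta_3$. -/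

import Mathlib

open FirstOrder

/-! ### The signature of groups -/

/-- Function symbols of the signature `{·, ⁻¹, 1}` of groups. -/
inductive GroupFunc : ℕ → Type
  | one : GroupFunc 0
  | inv : GroupFunc 1
  | mul : GroupFunc 2

/-- The signature `{·, ⁻¹, 1}` of groups; there are no relation symbols besides equality. -/
def groupLang : FirstOrder.Language := ⟨GroupFunc, fun _ => Empty⟩

/-- Every group is a structure in the signature of groups. -/
instance groupStructure (G : Type*) [Group G] : groupLang.Structure G where
  funMap f x :=
    match f with
    | .one => 1
    | .inv => (x 0)⁻¹
    | .mul => x 0 * x 1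
  RelMap r _ := r.elim

/-! ### The logic `L_{ω₁,ω}` -/

/-- Formulas of `L_{ω₁,ω}`, with variables named by natural numbers: finitary first-order formulas,
closed under negation, countable disjunctions `⋁_{i ∈ S} φ i` and conjunctions `⋀_{i ∈ S} φ i`
(`S` any set of natural numbers, possibly empty or finite), and quantification over one variable. -/
inductive InfFormula (L : FirstOrder.Language.{0, 0}) : Type
  | fo (φ : L.Formula ℕ) : InfFormula L
  | neg (φ : InfFormula L) : InfFormula L
  | disj (S : Set ℕ) (φ : ℕ → InfFormula L) : InfFormula L
  | conj (S : Set ℕ) (φ : ℕ → InfFormula L) : InfFormula L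
  | ex (x : ℕ) (φ : InfFormula L) : InfFormula L
  | all (x : ℕ) (φ : InfFormula L) : InfFormula L

namespace InfFormula

variable {L : FirstOrder.Language.{0, 0}}

/-- Satisfaction of a formula under an assignment `ρ` of the variables. -/
def Realize {M : Type*} [L.Structure M] : InfFormula L → (ℕ → M) → Prop
  | fo φ, ρ => φ.Realize ρ
  | neg φ, ρ => ¬ φ.Realize ρ
  | disj S φ, ρ => ∃ i ∈ S, (φ i).Realize ρ
  | conj S φ, ρ => ∀ i ∈ S, (φ i).Realize ρ
  | ex x φ, ρ => ∃ a : M, φ.Realize (Function.update ρ x a)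
  | all x φ, ρ => ∀ a : M, φ.Realize (Function.update ρ x a)

/-- The free variables of a formula. -/
def freeVars : InfFormula L → Set ℕ
  | fo φ => {x | x ∈ φ.freeVarFinset}
  | neg φ => φ.freeVars
  | disj S φ => {x | ∃ i ∈ S, x ∈ (φ i).freeVars}
  | conj S φ => {x | ∃ i ∈ S, x ∈ (φ i).freeVars}
  | ex y φ => φ.freeVars \ {y}
  | all y φ => φ.freeVars \ {y}

/-- A sentence is a formula without free variables. -/
def IsSentence (φ : InfFormula L) : Prop := φ.freeVars = ∅

/-- `M ⊨ φ`, for a sentence `φ` (whose truth does not depend on the assignment). -/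
def HoldsIn (φ : InfFormula L) (M : Type*) [L.Structure M] : Prop :=
  ∀ ρ : ℕ → M, φ.Realize ρ

/-- The conjunction of two formulas. -/
def and (φ ψ : InfFormula L) : InfFormula L :=
  conj {0, 1} fun i => if i = 0 then φ else ψ

/-- The block of quantifiers `∃ x₁ ⋯ ∃ xₙ` for a list of variables. -/
def exs (xs : List ℕ) (φ : InfFormula L) : InfFormula L := xs.foldr ex φ

/-- The block of quantifiers `∀ x₁ ⋯ ∀ xₙ` for a list of variables. -/
def alls (xs : List ℕ) (φ : InfFormula L) : InfFormula L := xs.foldr all φ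

end InfFormula

/-! ### Gödel numbers, and computable infinitary formulas -/

/-- The term with Gödel number `n`, over variables named by natural numbers.
This is a bijection between `ℕ` and the terms. -/
def termOfCode : ℕ → groupLang.Term ℕ
  | 0 => Language.Term.func (L := groupLang) GroupFunc.one ![]
  | n + 1 =>
    have h₀ : n / 3 < n + 1 := by omega
    have h₁ : (n / 3).unpair.1 < n + 1 := (Nat.unpair_left_le _).trans_lt h₀
    have h₂ : (n / 3).unpair.2 < n + 1 := (Nat.unpair_right_le _).trans_lt h₀
    match n % 3 with
    | 0 => Language.Term.var (n / 3)
    | 1 => Language.Term.func (L := groupLang) GroupFunc.inv ![termOfCode (n / 3)]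
    | _ => Language.Term.func (L := groupLang) GroupFunc.mul
        ![termOfCode (n / 3).unpair.1, termOfCode (n / 3).unpair.2]

/-- The finitary quantifier-free formula with Gödel number `n`: `⊥`, an equation between two terms,
or an implication. Every quantifier-free formula is obtained. -/
def qfOfCode : ℕ → groupLang.Formula ℕ
  | 0 => ⊥
  | n + 1 =>
    have h₀ : n / 2 < n + 1 := by omega
    have h₁ : (n / 2).unpair.1 < n + 1 := (Nat.unpair_left_le _).trans_lt h₀
    have h₂ : (n / 2).unpair.2 < n + 1 := (Nat.unpair_right_le _).trans_lt h₀
    match n % 2 with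
    | 0 => (termOfCode (n / 2).unpair.1).equal (termOfCode (n / 2).unpair.2)
    | _ => (qfOfCode (n / 2).unpair.1).imp (qfOfCode (n / 2).unpair.2)

/-- The `e`-th computably enumerable set `W_e`. -/
def ceSet (e : ℕ) : Set ℕ :=
  {x | ((Denumerable.ofNat Nat.Partrec.Code e).eval x).Dom}

mutual

/-- The computable `Σ_n` formula with index `e`. For `n = 0` it is the finitary quantifier-free
formula with Gödel number `e`. For `n > 0` it is the disjunction, over all numbers of triples
`(m, xs, j)` in `W_e` with `m < n`, of the formulas `∃ xs, ψ`, where `ψ` is the computable `Π_m`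
formula with index `j`. -/
noncomputable def sigmaFormula : ℕ → ℕ → InfFormula groupLang
  | 0, e => .fo (qfOfCode e)
  | n + 1, e =>
    .disj {i | i ∈ ceSet e ∧ (Denumerable.ofNat (ℕ × List ℕ × ℕ) i).1 < n + 1} fun i =>
      let t := Denumerable.ofNat (ℕ × List ℕ × ℕ) i
      if _h : t.1 < n + 1 then .exs t.2.1 (piFormula t.1 t.2.2) else .fo ⊥
termination_by n => n
decreasing_by exact _h

/-- The computable `Π_n` formula with index `e`. For `n = 0` it is the finitary quantifier-free
formula with Gödel number `e`. For `n > 0` it is the conjunction, over all numbers of triples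
`(m, xs, j)` in `W_e` with `m < n`, of the formulas `∀ xs, ψ`, where `ψ` is the computable `Σ_m`
formula with index `j`. -/
noncomputable def piFormula : ℕ → ℕ → InfFormula groupLang
  | 0, e => .fo (qfOfCode e)
  | n + 1, e =>
    .conj {i | i ∈ ceSet e ∧ (Denumerable.ofNat (ℕ × List ℕ × ℕ) i).1 < n + 1} fun i =>
      let t := Denumerable.ofNat (ℕ × List ℕ × ℕ) i
      if _h : t.1 < n + 1 then .alls t.2.1 (sigmaFormula t.1 t.2.2) else .fo ⊥
termination_by n => n
decreasing_by exact _h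

end

/-- `φ` is a computable `Σ_n` formula. -/
def IsComputableSigma (n : ℕ) (φ : InfFormula groupLang) : Prop := ∃ e, φ = sigmaFormula n e

/-- `φ` is a computable `Π_n` formula. -/
def IsComputablePi (n : ℕ) (φ : InfFormula groupLang) : Prop := ∃ e, φ = piFormula n e

/-- `φ` is a computable d-`Σ_n` formula: the conjunction of a computable `Σ_n` formula and a
computable `Π_n` formula. -/
def IsComputableDSigma (n : ℕ) (φ : InfFormula groupLang) : Prop :=
  ∃ σ π, IsComputableSigma n σ ∧ IsComputablePi n π ∧ φ = σ.and π

/-! ### Computable structures and pseudo-Scott sentences -/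

/-- The (positive) atomic diagram of a structure with universe `D ⊆ ℕ`, as a set of pairs of Gödel
numbers: all true equations `t = s` between terms with parameters from `D`, where the variable named
`d` stands for the element `d ∈ D`. -/
def atomicDiagram (D : Set ℕ) [groupLang.Structure D] : Set (ℕ × ℕ) :=
  {p | ∃ t s : groupLang.Term D,
    termOfCode p.1 = t.relabel Subtype.val ∧ termOfCode p.2 = s.relabel Subtype.val ∧
      t.realize id = s.realize id}

/-- A structure with universe `D ⊆ ℕ` is computable if its atomic diagram is. (Then `D` is
computable as well, since `d ∈ D` if and only if the equation `d = d` is in the diagram; so the true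
negated equations form a computable set, too.) -/
def IsComputableStructure (D : Set ℕ) [groupLang.Structure D] : Prop :=
  ComputablePred fun p : ℕ × ℕ => p ∈ atomicDiagram D

/-- `A` is isomorphic to a computable structure. -/
def HasComputableCopy (A : Type*) [groupLang.Structure A] : Prop :=
  ∃ (D : Set ℕ) (_ : groupLang.Structure D), IsComputableStructure D ∧ Nonempty (D ≃[groupLang] A)

/-- `φ` is a pseudo-Scott sentence for `A`: its computable models are exactly the computable
isomorphic copies of `A`. -/
def IsPseudoScott (φ : InfFormula groupLang) (A : Type*) [groupLang.Structure A] : Prop :=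
  φ.IsSentence ∧ ∀ (D : Set ℕ) [groupLang.Structure D], IsComputableStructure D →
    (φ.HoldsIn D ↔ Nonempty (D ≃[groupLang] A))

/-- `A` has a computable `Σ_n` pseudo-Scott sentence. -/
def HasSigmaPseudoScott (n : ℕ) (A : Type*) [groupLang.Structure A] : Prop :=
  ∃ φ, IsComputableSigma n φ ∧ IsPseudoScott φ A

/-- `A` has a computable `Π_n` pseudo-Scott sentence. -/
def HasPiPseudoScott (n : ℕ) (A : Type*) [groupLang.Structure A] : Prop :=
  ∃ φ, IsComputablePi n φ ∧ IsPseudoScott φ A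

/-- `A` has a computable d-`Σ_n` pseudo-Scott sentence. -/
def HasDSigmaPseudoScott (n : ℕ) (A : Type*) [groupLang.Structure A] : Prop :=
  ∃ φ, IsComputableDSigma n φ ∧ IsPseudoScott φ A

/-! ### Subgroups of the rationals, and Turing equivalence of sets -/

/-- `n ∣ 1` holds in the subgroup `G` of `ℚ`. -/
def DividesOneIn (G : AddSubgroup ℚ) (n : ℕ) : Prop := ∃ g ∈ G, n • g = 1

/-- The primes `p` with `p ∣ 1` in `G`, but `p ^ k ∤ 1` in `G` for some `k`. -/
def PFin (G : AddSubgroup ℚ) : Set ℕ :=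
  {p | p.Prime ∧ DividesOneIn G p ∧ ∃ k : ℕ, ¬ DividesOneIn G (p ^ k)}

/-- The primes `p` with `p ^ k ∣ 1` in `G` for all `k`. -/
def PInf (G : AddSubgroup ℚ) : Set ℕ :=
  {p | p.Prime ∧ ∀ k : ℕ, DividesOneIn G (p ^ k)}

open Classical in
/-- The characteristic function of a set of natural numbers. -/
noncomputable def charFun (X : Set ℕ) : ℕ →. ℕ := fun n => Part.some (if n ∈ X then 1 else 0)

/-- The halting set `0' = {e | e ∈ W_e}`. -/
def haltingSet : Set ℕ := {e | e ∈ ceSet e}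

/-!
The set `X` codes the halting set into blocks `{⟨e, i⟩ | i ≤ e + 1}`: when `e` enters the halting
set, the elements of the `e`-th block are put into `X`, except for those frozen before; numbers in
no block belong to `X` anyway. For each `n ≤ e`, the first element of the block that is found in
`W_n` is frozen, if it is found before `e` enters the halting set. A block has more elements than
there are such `n`, so it meets `X` if and only if `e` is in the halting set
(`exists_mem_codingSet_iff`), and `X` is Turing complete. If `e` is in the halting set, then all
elements of the block outside `X` are frozen; otherwise, the block has a frozen element in `W_n` for
each `n ≤ e` such that it meets `W_n`. So the c.e. set `S n` of the frozen elements of `W_n` is an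
infinite subset of `W_n \ X` if `W_n \ X` is infinite (`frozenPart_infinite`).

The group is `ratSubgroup X`, the rationals whose denominators only have prime factors `p_i` with
`i ∈ X`. Up to isomorphism it is the torsion-free abelian group of rank one that is divisible by all
these primes and has a nontrivial element divisible by no other prime
(`IsRankOneDivisible.nonempty_equiv`), which is `Σ_3`. Instead of an element not divisible by other
primes it suffices that one nontrivial element `g` has finite height at the other primes and is
divisible by only finitely many of them (`IsRankOneDivisible.nonempty_equiv_of_finite`). To express
the latter condition by a `Π_3` sentence, observe that in a computable structure the `i` with
`p_i ∣ g` form a c.e. set `W_n ⊇ X`. If `W_n \ X` were infinite, then `S n` would be an infinite set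
of such `i`; so it is enough to say that no infinite `S n` consists of indices of primes dividing
`g` (`hasPiPseudoScott_ratSubgroup`). Here the uniform enumerability of `S` is used.

There is no d-`Σ_2` sentence, because `X` is not computable
(`not_hasDSigmaPseudoScott_ratSubgroup`). Making one more prime `p_i` invertible preserves `Π_2`
sentences, since finitely generated parts of the larger group lie in copies of the smaller one. So
for `i ∉ X` the `Π_1` formula and the tuple that witness the `Σ_2` conjunct in `ratSubgroup X` must
fail in `ratSubgroup (insert i X)`. Since failure of a `Π_1` formula is a c.e. event, uniformly in
`i`, the complement of `X` would be c.e.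

For the second assertion, the `Π_2` sentence is moved into the quantifiers of the `Σ_2` sentence,
and dually (`HasDSigmaPseudoScott.sigma_and_pi`). The work here is to do this on indices of
computable infinitary formulas: `IsSig` and `IsPi` say that a family of relations is uniformly
defined by such formulas, and they are closed under the logical operations.
-/

/-! ### Computably enumerable predicates -/

section ComputablyEnumerable

variable {α β : Type*} [Primcodable α] [Primcodable β]

/-- A c.e. predicate is approximated by an increasing primitive recursive sequence of stages. -/
theorem REPred.exists_stages {p : α → Prop} (hp : REPred p) :
    ∃ q : α → ℕ → Bool, Primrec₂ q ∧ (∀ a s t, s ≤ t → q a s = true → q a t = true) ∧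
      ∀ a, p a ↔ ∃ s, q a s = true := by
  obtain ⟨c, hc⟩ := Nat.Partrec.Code.exists_code.1 hp
  refine ⟨fun a s => (Nat.Partrec.Code.evaln s c (Encodable.encode a)).isSome, ?_, ?_, ?_⟩
  · exact Primrec.option_isSome.comp (Nat.Partrec.Code.primrec_evaln.comp
      ((Primrec.snd.pair (Primrec.const c)).pair (Primrec.encode.comp Primrec.fst)))
  · intro a s t hst h
    obtain ⟨x, hx⟩ := Option.isSome_iff_exists.1 h
    exact Option.isSome_iff_exists.2 ⟨x, Nat.Partrec.Code.evaln_mono hst hx⟩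
  · intro a
    have h1 : p a ↔ (c.eval (Encodable.encode a)).Dom := by
      rw [hc]; simp [Part.assert]
    rw [h1, Part.dom_iff_mem]
    simp only [Nat.Partrec.Code.evaln_complete, Option.isSome_iff_exists, Option.mem_def]
    exact exists_comm

theorem REPred.of_stages {q : α → ℕ → Bool} (hq : Computable₂ q) :
    REPred fun a => ∃ s, q a s = true := by
  have h : Partrec fun a => Nat.rfind fun s => Part.some (q a s) := Partrec.rfind hq.partrec₂
  refine h.dom_re.of_eq fun a => ?_
  refine Nat.rfind_dom'.trans ?_
  exact ⟨fun ⟨s, hs, _⟩ => ⟨s, (Part.mem_some_iff.1 hs).symm⟩,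
    fun ⟨s, hs⟩ => ⟨s, Part.mem_some_iff.2 hs.symm, fun _ => trivial⟩⟩

theorem REPred.comp {p : β → Prop} (hp : REPred p) {f : α → β} (hf : Computable f) :
    REPred fun a => p (f a) :=
  Partrec.comp hp hf

theorem REPred.and {p q : α → Prop} (hp : REPred p) (hq : REPred q) :
    REPred fun a => p a ∧ q a := by
  obtain ⟨f, hf, hf', hfp⟩ := hp.exists_stages
  obtain ⟨g, hg, hg', hgq⟩ := hq.exists_stages
  refine (REPred.of_stages (q := fun a s => f a s && g a s) ?_).of_eq fun a => ?_
  · exact (Primrec.and.comp hf hg).to_comp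
  · rw [hfp, hgq]
    constructor
    · rintro ⟨s, hs⟩
      rw [Bool.and_eq_true] at hs
      exact ⟨⟨s, hs.1⟩, ⟨s, hs.2⟩⟩
    · rintro ⟨⟨s, hs⟩, ⟨t, ht⟩⟩
      exact ⟨max s t, by simp [hf' a s _ (le_max_left s t) hs, hg' a t _ (le_max_right s t) ht]⟩

theorem REPred.or {p q : α → Prop} (hp : REPred p) (hq : REPred q) :
    REPred fun a => p a ∨ q a := by
  obtain ⟨f, hf, hf', hfp⟩ := hp.exists_stages
  obtain ⟨g, hg, hg', hgq⟩ := hq.exists_stages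
  refine (REPred.of_stages (q := fun a s => f a s || g a s) ?_).of_eq fun a => ?_
  · exact (Primrec.or.comp hf hg).to_comp
  · rw [hfp, hgq]
    simp [exists_or]

theorem REPred.exists {p : α → β → Prop} (hp : REPred fun x : α × β => p x.1 x.2) :
    REPred fun a => ∃ b, p a b := by
  obtain ⟨f, hf, -, hfp⟩ := hp.exists_stages
  refine (REPred.of_stages (q := fun a s =>
    Option.casesOn (Encodable.decode (α := β) s.unpair.1) false
      fun b => f (a, b) s.unpair.2) ?_).of_eq fun a => ?_
  · refine Primrec.to_comp (Primrec.option_casesOn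
      (Primrec.decode.comp (Primrec.fst.comp (Primrec.unpair.comp Primrec.snd)))
      (Primrec.const false) ?_)
    exact hf.comp ((Primrec.fst.comp Primrec.fst).pair Primrec.snd)
      (Primrec.snd.comp (Primrec.unpair.comp (Primrec.snd.comp Primrec.fst)))
  · constructor
    · rintro ⟨s, hs⟩
      cases hd : Encodable.decode (α := β) s.unpair.1 with
      | none => simp [hd] at hs
      | some b =>
        rw [hd] at hs
        exact ⟨b, (hfp (a, b)).2 ⟨_, hs⟩⟩
    · rintro ⟨b, hb⟩
      obtain ⟨s, hs⟩ := (hfp (a, b)).1 hb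
      refine ⟨Nat.pair (Encodable.encode b) s, ?_⟩
      simp [hs]

theorem ComputablePred.comp {p : β → Prop} (hp : ComputablePred p) {f : α → β}
    (hf : Computable f) : ComputablePred fun a => p (f a) := by
  obtain ⟨g, hg, rfl⟩ := ComputablePred.computable_iff.1 hp
  exact ComputablePred.computable_iff.2 ⟨_, hg.comp hf, rfl⟩

theorem ComputablePred.and {p q : α → Prop} (hp : ComputablePred p) (hq : ComputablePred q) :
    ComputablePred fun a => p a ∧ q a := by
  obtain ⟨f, hf, rfl⟩ := ComputablePred.computable_iff.1 hp
  obtain ⟨g, hg, rfl⟩ := ComputablePred.computable_iff.1 hq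
  refine ComputablePred.computable_iff.2
    ⟨fun a => f a && g a, Primrec.and.to_comp.comp hf hg, ?_⟩
  funext a
  simp

theorem rePred_mem_ceSet : REPred fun x : ℕ × ℕ => x.2 ∈ ceSet x.1 :=
  Partrec.dom_re (Nat.Partrec.Code.eval_part.comp
    ((Computable.ofNat Nat.Partrec.Code).comp Computable.fst) Computable.snd)

/-- The parametrization theorem: indices for the sections of a c.e. relation can be computed from
the parameter. -/
theorem REPred.exists_ceSet_index {p : α → ℕ → Prop} (hp : REPred fun x : α × ℕ => p x.1 x.2) :
    ∃ f : α → ℕ, Computable f ∧ ∀ a n, n ∈ ceSet (f a) ↔ p a n := by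
  obtain ⟨c, hc⟩ := Nat.Partrec.Code.exists_code.1 hp
  refine ⟨fun a => Encodable.encode (c.curry (Encodable.encode a)), ?_, fun a n => ?_⟩
  · exact Computable.encode.comp (Nat.Partrec.Code.primrec₂_curry.to_comp.comp
      (Computable.const c) Computable.encode)
  · have : (c.eval (Encodable.encode (a, n))).Dom ↔ p a n := by
      rw [hc]; simp [Part.assert]
    rw [← this]
    simp [ceSet, Nat.Partrec.Code.eval_curry]

theorem REPred.exists_ceSet_eq {p : ℕ → Prop} (hp : REPred p) :
    ∃ e, ∀ n, n ∈ ceSet e ↔ p n := by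
  obtain ⟨f, -, hf⟩ := REPred.exists_ceSet_index (α := Unit) (p := fun _ n => p n)
    (hp.comp Computable.snd)
  exact ⟨f (), hf ()⟩

/-- The halting set is not computable, by diagonalization. -/
theorem not_computablePred_haltingSet : ¬ ComputablePred fun e => e ∈ haltingSet := by
  intro h
  obtain ⟨e, he⟩ := h.not.to_re.exists_ceSet_eq
  have := he e
  simp only [haltingSet, Set.mem_ofPred_eq] at this
  tauto

end ComputablyEnumerable

/-! ### A Turing complete c.e. set -/

section CodingSet

/-- At step `z = ⟨i, s⟩` of the search, the element `⟨e, i⟩` of the block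
`{⟨e, 0⟩, …, ⟨e, e + 1⟩}` is seen in `W_n` at stage `s`. Here `w` is the approximation to
`{(n, x) | x ∈ W_n}` by stages. -/
def BlockHit (w : ℕ × ℕ → ℕ → Bool) (n e z : ℕ) : Prop :=
  z.unpair.1 ≤ e + 1 ∧ w (n, Nat.pair e z.unpair.1) z.unpair.2 = true

/-- The first element of the `e`-th block found in `W_n` is found at step `z`. -/
def Commits (w : ℕ × ℕ → ℕ → Bool) (n e z : ℕ) : Prop :=
  BlockHit w n e z ∧ ∀ y < z, ¬ BlockHit w n e y

/-- The element `⟨e, i⟩` is the first element of the `e`-th block found in `W_n`, for some `n ≤ e`,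
and it was found before `e` was seen to be in the halting set. -/
def Frozen (w : ℕ × ℕ → ℕ → Bool) (e i : ℕ) : Prop :=
  ∃ n z, n ≤ e ∧ Commits w n e z ∧ z.unpair.1 = i ∧ ¬ w (e, e) z = true

/-- The halting set, coded into blocks: when `e` enters the halting set, all elements of the `e`-th
block that have not been frozen enter the coding set. Numbers in no block belong to it from the
start. -/
def codingSet (w : ℕ × ℕ → ℕ → Bool) : Set ℕ :=
  {x | x.unpair.1 + 1 < x.unpair.2 ∨
    (∃ t, w (x.unpair.1, x.unpair.1) t = true) ∧ ¬ Frozen w x.unpair.1 x.unpair.2}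

variable {w : ℕ × ℕ → ℕ → Bool}

/-- Bounded universal quantifiers are primitive recursive, with parameters of any type. -/
theorem PrimrecRel.forall_lt_nat {α : Type*} [Primcodable α] {R : ℕ → α → Prop}
    (hR : PrimrecRel R) : PrimrecRel fun (n : ℕ) y => ∀ x < n, R x y :=
  (hR.forall_mem_list.comp (Primrec.list_range.comp Primrec.fst) Primrec.snd).of_eq (by simp)

theorem primrecPred_blockHit (hw : Primrec₂ w) :
    PrimrecPred fun x : ℕ × ℕ × ℕ => BlockHit w x.2.1 x.2.2 x.1 := by
  have h1 : Primrec fun x : ℕ × ℕ × ℕ => x.1.unpair.1 :=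
    Primrec.fst.comp (Primrec.unpair.comp Primrec.fst)
  have he : Primrec fun x : ℕ × ℕ × ℕ => x.2.2 := Primrec.snd.comp Primrec.snd
  refine PrimrecPred.and (Primrec.nat_le.comp h1 (Primrec.succ.comp he)) ?_
  refine Primrec.eq.comp (hw.comp ?_ ?_) (Primrec.const true)
  · exact (Primrec.fst.comp Primrec.snd).pair (Primrec₂.natPair.comp he h1)
  · exact Primrec.snd.comp (Primrec.unpair.comp Primrec.fst)

theorem primrecPred_commits (hw : Primrec₂ w) :
    PrimrecPred fun x : ℕ × ℕ × ℕ => Commits w x.2.1 x.2.2 x.1 := by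
  have h := primrecPred_blockHit hw
  have h2 : PrimrecRel fun (z : ℕ) (y : ℕ × ℕ) => ∀ x < z, ¬ BlockHit w y.1 y.2 x :=
    PrimrecRel.forall_lt_nat (R := fun (x : ℕ) (y : ℕ × ℕ) => ¬ BlockHit w y.1 y.2 x) h.not
  exact h.and h2

theorem rePred_frozen (hw : Primrec₂ w) : REPred fun x : ℕ × ℕ => Frozen w x.1 x.2 := by
  refine REPred.exists (p := fun (x : ℕ × ℕ) n => ∃ z, n ≤ x.1 ∧ Commits w n x.1 z ∧
    z.unpair.1 = x.2 ∧ ¬ w (x.1, x.1) z = true) ?_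
  refine REPred.exists (p := fun (y : (ℕ × ℕ) × ℕ) z => y.2 ≤ y.1.1 ∧ Commits w y.2 y.1.1 z ∧
    z.unpair.1 = y.1.2 ∧ ¬ w (y.1.1, y.1.1) z = true) ?_
  have he : Primrec fun x : ((ℕ × ℕ) × ℕ) × ℕ => x.1.1.1 :=
    Primrec.fst.comp (Primrec.fst.comp Primrec.fst)
  have hi : Primrec fun x : ((ℕ × ℕ) × ℕ) × ℕ => x.1.1.2 :=
    Primrec.snd.comp (Primrec.fst.comp Primrec.fst)
  have hn : Primrec fun x : ((ℕ × ℕ) × ℕ) × ℕ => x.1.2 := Primrec.snd.comp Primrec.fst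
  refine (PrimrecPred.computablePred ?_).to_re
  refine (Primrec.nat_le.comp hn he).and (((primrecPred_commits hw).comp
    (Primrec.snd.pair (hn.pair he))).and (PrimrecPred.and ?_ (PrimrecPred.not ?_)))
  · exact Primrec.eq.comp (Primrec.fst.comp (Primrec.unpair.comp Primrec.snd)) hi
  · exact Primrec.eq.comp (hw.comp (he.pair he) Primrec.snd) (Primrec.const true)

theorem rePred_codingSet (hw : Primrec₂ w)
    (hmono : ∀ a s t, s ≤ t → w a s = true → w a t = true) :
    REPred fun x => x ∈ codingSet w := by
  have h1 : Primrec fun x : ℕ => x.unpair.1 := Primrec.fst.comp Primrec.unpair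
  have h2 : Primrec fun x : ℕ => x.unpair.2 := Primrec.snd.comp Primrec.unpair
  refine REPred.or (PrimrecPred.computablePred
    (Primrec.nat_lt.comp (Primrec.succ.comp h1) h2)).to_re ?_
  -- `⟨e, i⟩` is not frozen if it has not been frozen by a stage at which `e` is in the halting set
  have key : REPred fun x : ℕ => ∃ t, w (x.unpair.1, x.unpair.1) t = true ∧
      ∀ z < t, ∀ n < x.unpair.1 + 1, ¬ (Commits w n x.unpair.1 z ∧ z.unpair.1 = x.unpair.2 ∧
        ¬ w (x.unpair.1, x.unpair.1) z = true) := by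
    refine REPred.exists (p := fun (x : ℕ) t => w (x.unpair.1, x.unpair.1) t = true ∧
      ∀ z < t, ∀ n < x.unpair.1 + 1, ¬ (Commits w n x.unpair.1 z ∧ z.unpair.1 = x.unpair.2 ∧
        ¬ w (x.unpair.1, x.unpair.1) z = true)) ?_
    refine (PrimrecPred.computablePred ?_).to_re
    refine PrimrecPred.and (Primrec.eq.comp (hw.comp ((h1.pair h1).comp Primrec.fst) Primrec.snd)
      (Primrec.const true)) ?_
    have hb : PrimrecRel fun (n : ℕ) (y : ℕ × ℕ) => ¬ (Commits w n y.2.unpair.1 y.1 ∧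
        y.1.unpair.1 = y.2.unpair.2 ∧ ¬ w (y.2.unpair.1, y.2.unpair.1) y.1 = true) := by
      have hx : Primrec fun p : ℕ × ℕ × ℕ => p.2.2 := Primrec.snd.comp Primrec.snd
      have hz : Primrec fun p : ℕ × ℕ × ℕ => p.2.1 := Primrec.fst.comp Primrec.snd
      refine PrimrecPred.not (PrimrecPred.and ((primrecPred_commits hw).comp
        (hz.pair (Primrec.fst.pair (h1.comp hx)))) (PrimrecPred.and ?_ (PrimrecPred.not ?_)))
      · exact Primrec.eq.comp (h1.comp hz) (h2.comp hx)
      · exact Primrec.eq.comp (hw.comp ((h1.comp hx).pair (h1.comp hx)) hz) (Primrec.const true)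
    have hb' : PrimrecRel fun (z : ℕ) (x : ℕ) => ∀ n < x.unpair.1 + 1,
        ¬ (Commits w n x.unpair.1 z ∧
        z.unpair.1 = x.unpair.2 ∧ ¬ w (x.unpair.1, x.unpair.1) z = true) :=
      hb.forall_lt_nat.comp (f := fun y : ℕ × ℕ => y.2.unpair.1 + 1) (g := fun y : ℕ × ℕ => y)
        (Primrec.succ.comp (h1.comp Primrec.snd)) Primrec.id
    exact hb'.forall_lt_nat.comp Primrec.snd Primrec.fst
  refine key.of_eq fun x => ?_
  constructor
  · rintro ⟨t, ht, h⟩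
    refine ⟨⟨t, ht⟩, ?_⟩
    rintro ⟨n, z, hn, hc, hz, hzw⟩
    refine h z ?_ n (by omega) ⟨hc, hz, hzw⟩
    by_contra hlt
    exact hzw (hmono _ t z (not_lt.1 hlt) ht)
  · rintro ⟨⟨t, ht⟩, h⟩
    refine ⟨t, ht, fun z _ n hn hc => h ⟨n, z, by omega, hc.1, hc.2.1, hc.2.2⟩⟩

theorem Commits.unique {n e y z : ℕ} (hy : Commits w n e y) (hz : Commits w n e z) : y = z := by
  rcases lt_trichotomy y z with h | h | h
  · exact absurd hy.1 (hz.2 y h)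
  · exact h
  · exact absurd hz.1 (hy.2 z h)

/-- A block has `e + 2` elements, of which at most `e + 1` are frozen. -/
theorem exists_not_frozen (w : ℕ × ℕ → ℕ → Bool) (e : ℕ) : ∃ i ≤ e + 1, ¬ Frozen w e i := by
  classical
  by_contra! h
  choose f g hf using fun i : Fin (e + 2) => h i (by omega)
  -- the pigeonhole principle for the map sending a frozen element to the set freezing it
  obtain ⟨i, j, hij, hfij⟩ := Fintype.exists_ne_map_eq_of_card_lt
    (fun i : Fin (e + 2) => (⟨f i, by have := (hf i).1; omega⟩ : Fin (e + 1))) (by simp)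
  have hfij' : f i = f j := by simpa using hfij
  have hi := hf i
  have hj := hf j
  rw [← hfij'] at hj
  have := hi.2.1.unique hj.2.1
  apply hij
  ext
  rw [← hi.2.2.1, ← hj.2.2.1, this]

/-- `e` is in the halting set if and only if the `e`-th block meets the coding set. -/
theorem exists_mem_codingSet_iff (e : ℕ) :
    (∃ i ≤ e + 1, Nat.pair e i ∈ codingSet w) ↔ ∃ t, w (e, e) t = true := by
  constructor
  · rintro ⟨i, hi, h⟩
    simp only [codingSet, Set.mem_ofPred_eq, Nat.unpair_pair] at h
    rcases h with h | h
    · omega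
    · exact h.1
  · intro h
    obtain ⟨i, hi, hi'⟩ := exists_not_frozen w e
    refine ⟨i, hi, ?_⟩
    simp only [codingSet, Set.mem_ofPred_eq, Nat.unpair_pair]
    exact Or.inr ⟨h, hi'⟩

/-- The frozen elements of `W_n`. -/
def frozenPart (w : ℕ × ℕ → ℕ → Bool) (n : ℕ) : Set ℕ :=
  {x | x ∈ ceSet n ∧ x.unpair.2 ≤ x.unpair.1 + 1 ∧ Frozen w x.unpair.1 x.unpair.2}

theorem rePred_frozenPart (hw : Primrec₂ w) :
    REPred fun p : ℕ × ℕ => p.2 ∈ frozenPart w p.1 := by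
  have h1 : Primrec fun x : ℕ × ℕ => x.2.unpair.1 :=
    Primrec.fst.comp (Primrec.unpair.comp Primrec.snd)
  have h2 : Primrec fun x : ℕ × ℕ => x.2.unpair.2 :=
    Primrec.snd.comp (Primrec.unpair.comp Primrec.snd)
  exact rePred_mem_ceSet.and ((PrimrecPred.computablePred
    (Primrec.nat_le.comp h2 (Primrec.succ.comp h1))).to_re.and
    ((rePred_frozen hw).comp (h1.pair h2).to_comp))

theorem frozenPart_subset (n : ℕ) : frozenPart w n ⊆ ceSet n \ codingSet w := by
  rintro x ⟨hx, hle, hf⟩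
  refine ⟨hx, ?_⟩
  rintro (h | h)
  · omega
  · exact h.2 hf

/-- Each block `e ≥ n` that meets `W_n` outside the coding set has a frozen element in `W_n`. -/
theorem frozenPart_infinite (hwW : ∀ x : ℕ × ℕ, x.2 ∈ ceSet x.1 ↔ ∃ s, w x s = true) {n : ℕ}
    (h : (ceSet n \ codingSet w).Infinite) : (frozenPart w n).Infinite := by
  have hblock : ∀ x ∈ ceSet n \ codingSet w, n ≤ x.unpair.1 →
      ∃ y ∈ frozenPart w n, y.unpair.1 = x.unpair.1 := by
    rintro x ⟨hx, hxX⟩ hn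
    simp only [codingSet, Set.mem_ofPred_eq, not_or, not_and, not_not, not_lt] at hxX
    by_cases hK : ∃ t, w (x.unpair.1, x.unpair.1) t = true
    · exact ⟨x, ⟨hx, hxX.1, hxX.2 hK⟩, rfl⟩
    · classical
      obtain ⟨s, hs⟩ := (hwW (n, x)).1 hx
      have hex : ∃ z, BlockHit w n x.unpair.1 z :=
        ⟨Nat.pair x.unpair.2 s, by simpa [BlockHit] using ⟨hxX.1, hs⟩⟩
      have hz := Nat.find_spec hex
      refine ⟨Nat.pair x.unpair.1 (Nat.find hex).unpair.1, ⟨?_, ?_, ?_⟩, by simp⟩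
      · exact (hwW (n, _)).2 ⟨_, hz.2⟩
      · simpa using hz.1
      · simp only [Nat.unpair_pair]
        exact ⟨n, Nat.find hex, hn, ⟨hz, fun y hy => Nat.find_min hex hy⟩, rfl,
          fun hc => hK ⟨_, hc⟩⟩
  -- finitely many blocks contain only finitely many elements outside the coding set
  intro hfin
  apply h
  obtain ⟨b, hb⟩ := (hfin.image fun y => y.unpair.1).bddAbove
  refine Set.Finite.subset (Set.finite_Iic (Nat.pair (max b n + 1) (max b n + 2))) fun x hx => ?_
  have hle : x.unpair.1 ≤ max b n := by
    rcases le_total n x.unpair.1 with hn | hn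
    · obtain ⟨y, hy, hyx⟩ := hblock x hx hn
      exact le_max_of_le_left (hyx ▸ hb ⟨y, hy, rfl⟩)
    · exact le_max_of_le_right hn
  have hle2 : x.unpair.2 ≤ x.unpair.1 + 1 := by
    by_contra hlt
    exact hx.2 (Or.inl (by omega))
  rw [Set.mem_Iic, ← Nat.pair_unpair x]
  exact (Nat.pair_lt_pair_left _ (by omega)).le.trans (Nat.pair_lt_pair_right _ (by omega)).le

/-- Many-one reducibility to the halting set. -/
theorem REPred.exists_reduction {p : ℕ → Prop} (hp : REPred p) :
    ∃ f : ℕ → ℕ, Computable f ∧ ∀ n, p n ↔ f n ∈ haltingSet := by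
  obtain ⟨f, hf, hfp⟩ := REPred.exists_ceSet_index (p := fun a (_ : ℕ) => p a)
    (hp.comp Computable.fst)
  exact ⟨f, hf, fun n => (hfp n (f n)).symm⟩

theorem REPred.turingReducible_haltingSet {X : Set ℕ} (hX : REPred fun n => n ∈ X) :
    TuringReducible (charFun X) (charFun haltingSet) := by
  obtain ⟨f, hf, hfX⟩ := hX.exists_reduction
  rw [TuringReducible, RecursiveIn.iff_nat]
  refine (Nat.RecursiveIn.comp (Nat.RecursiveIn.oracle _ (Set.mem_singleton _))
    (Nat.Partrec.recursiveIn (Partrec.nat_iff.1 hf.partrec))).of_eq fun n => ?_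
  have := hfX n
  refine (Part.bind_some _ _).trans (congrArg Part.some ?_)
  by_cases h : n ∈ X
  · rw [if_pos h, if_pos (this.1 h)]
  · rw [if_neg h, if_neg fun h' => h (this.2 h')]

/-- The halting set is decided from the coding set by searching for the least `i` such that
`⟨e, i⟩` is in the coding set; this search stops, since `⟨e, e + 2⟩` is in no block. -/
theorem haltingSet_turingReducible
    (hwW : ∀ x : ℕ × ℕ, x.2 ∈ ceSet x.1 ↔ ∃ s, w x s = true) :
    TuringReducible (charFun haltingSet) (charFun (codingSet w)) := by
  classical
  have hex : ∀ e, ∃ i, Nat.pair e i ∈ codingSet w := fun e =>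
    ⟨e + 2, Or.inl (by simp)⟩
  -- the search looks for a zero of `1 - χ`
  have hflip : Nat.RecursiveIn {charFun (codingSet w)} fun x =>
      Part.some (if x ∈ codingSet w then 0 else 1) := by
    refine (Nat.RecursiveIn.comp (Nat.Partrec.recursiveIn (Partrec.nat_iff.1
      (Computable.partrec (f := fun n : ℕ => 1 - n)
        (Primrec.nat_sub.comp (Primrec.const 1) Primrec.id).to_comp)))
      (Nat.RecursiveIn.oracle _ (Set.mem_singleton _))).of_eq fun n => ?_
    refine (Part.bind_some _ _).trans (congrArg Part.some ?_)
    split_ifs <;> rfl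
  have hsearch : Nat.RecursiveIn {charFun (codingSet w)} fun e => Part.some (Nat.find (hex e)) := by
    refine (Nat.RecursiveIn.rfind hflip).of_eq fun e => ?_
    refine Part.eq_some_iff.2 (Nat.mem_rfind.2 ⟨?_, fun {m} hm => ?_⟩)
    · simp [Nat.find_spec (hex e)]
    · simp [Nat.find_min (hex e) hm]
  have htest : Primrec fun x : ℕ => if x.unpair.2 ≤ x.unpair.1 + 1 then 1 else 0 :=
    Primrec.ite (Primrec.nat_le.comp (Primrec.snd.comp Primrec.unpair)
      (Primrec.succ.comp (Primrec.fst.comp Primrec.unpair))) (Primrec.const 1) (Primrec.const 0)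
  rw [TuringReducible, RecursiveIn.iff_nat]
  refine (Nat.RecursiveIn.comp (Nat.Partrec.recursiveIn (Partrec.nat_iff.1 htest.to_comp.partrec))
    (Nat.RecursiveIn.pair (Nat.Partrec.recursiveIn (Partrec.nat_iff.1 Computable.id.partrec))
      hsearch)).of_eq fun e => ?_
  have hiff : Nat.find (hex e) ≤ e + 1 ↔ e ∈ haltingSet := by
    rw [haltingSet, Set.mem_ofPred_eq, hwW (e, e), ← exists_mem_codingSet_iff]
    constructor
    · exact fun h => ⟨_, h, Nat.find_spec (hex e)⟩
    · rintro ⟨i, hi, hiX⟩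
      exact (Nat.find_min' (hex e) hiX).trans hi
  have hpair : (Nat.pair <$> (fun a => a : ℕ →. ℕ) e <*> Part.some (Nat.find (hex e)) : Part ℕ) =
      Part.some (Nat.pair e (Nat.find (hex e))) := by
    simp [Seq.seq]
  refine (congrArg (Part.bind · _) hpair).trans ((Part.bind_some _ _).trans (congrArg Part.some ?_))
  simp [hiff]

end CodingSet

/-! ### Semantics of infinitary formulas -/

namespace InfFormula

variable {L : FirstOrder.Language.{0, 0}}

theorem realize_congr {M : Type*} [L.Structure M] (φ : InfFormula L) {ρ ρ' : ℕ → M}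
    (h : ∀ x ∈ φ.freeVars, ρ x = ρ' x) : φ.Realize ρ ↔ φ.Realize ρ' := by
  induction φ generalizing ρ ρ' with
  | fo φ =>
    have key : ∀ v : ℕ → M, (∀ a : φ.freeVarFinset, ρ a = v a) →
        (Language.BoundedFormula.Realize (φ.restrictFreeVar id) (fun a => ρ a) (default : Fin 0 → M)
          ↔ φ.Realize v) := fun v hv =>
      Language.BoundedFormula.realize_restrictFreeVar (φ := φ) (f := id) v hv
    exact (key ρ fun _ => rfl).symm.trans (key ρ' fun a => h a a.2)
  | neg φ ih => exact not_congr (ih h)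
  | disj S φ ih =>
    exact exists_congr fun i => and_congr_right fun hi => ih i fun x hx => h x ⟨i, hi, hx⟩
  | conj S φ ih =>
    exact forall_congr' fun i => forall_congr' fun hi => ih i fun x hx => h x ⟨i, hi, hx⟩
  | ex y φ ih =>
    refine exists_congr fun a => ih fun x hx => ?_
    by_cases hxy : x = y
    · subst hxy; simp
    · simp [hxy, h x ⟨hx, hxy⟩]
  | all y φ ih =>
    refine forall_congr' fun a => ih fun x hx => ?_
    by_cases hxy : x = y
    · subst hxy; simp
    · simp [hxy, h x ⟨hx, hxy⟩]

theorem realize_equiv {M N : Type*} [L.Structure M] [L.Structure N] (e : M ≃[L] N)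
    (φ : InfFormula L) (ρ : ℕ → M) : φ.Realize (e ∘ ρ) ↔ φ.Realize ρ := by
  have hupd : ∀ (ρ : ℕ → M) (y : ℕ) (a : M),
      Function.update (e ∘ ρ) y (e a) = e ∘ Function.update ρ y a := fun ρ y a =>
    (Function.comp_update e ρ y a).symm
  induction φ generalizing ρ with
  | fo φ => exact Language.StrongHomClass.realize_formula e φ
  | neg φ ih => exact not_congr (ih ρ)
  | disj S φ ih => exact exists_congr fun i => and_congr_right fun _ => ih i ρ
  | conj S φ ih => exact forall_congr' fun i => forall_congr' fun _ => ih i ρ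
  | ex y φ ih =>
    constructor
    · rintro ⟨b, hb⟩
      refine ⟨e.symm b, (ih _).1 ?_⟩
      rwa [← hupd, e.apply_symm_apply]
    · rintro ⟨a, ha⟩
      refine ⟨e a, ?_⟩
      rw [hupd]
      exact (ih _).2 ha
  | all y φ ih =>
    constructor
    · intro h a
      have := h (e a)
      rw [hupd] at this
      exact (ih _).1 this
    · intro h b
      have := (ih _).2 (h (e.symm b))
      rwa [← hupd, e.apply_symm_apply] at this

theorem HoldsIn.of_equiv {M N : Type*} [L.Structure M] [L.Structure N] (e : M ≃[L] N)
    {φ : InfFormula L} (h : φ.HoldsIn M) : φ.HoldsIn N := by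
  intro ρ
  have := (realize_equiv e φ (e.symm ∘ ρ)).2 (h _)
  rwa [← Function.comp_assoc, show (e ∘ e.symm : N → N) = id from funext fun x => by simp] at this

theorem realize_exs {M : Type*} [L.Structure M] (xs : List ℕ) (φ : InfFormula L) (ρ : ℕ → M) :
    (exs xs φ).Realize ρ ↔ ∃ ρ' : ℕ → M, (∀ x ∉ xs, ρ' x = ρ x) ∧ φ.Realize ρ' := by
  induction xs generalizing ρ with
  | nil =>
    constructor
    · exact fun h => ⟨ρ, fun _ _ => rfl, h⟩
    · rintro ⟨ρ', h, h'⟩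
      rwa [show ρ = ρ' from funext fun x => (h x (by simp)).symm]
  | cons y xs ih =>
    change (∃ a, (exs xs φ).Realize (Function.update ρ y a)) ↔ _
    simp only [ih]
    constructor
    · rintro ⟨a, ρ', h, h'⟩
      refine ⟨ρ', fun x hx => ?_, h'⟩
      simp only [List.mem_cons, not_or] at hx
      rw [h x hx.2, Function.update_of_ne hx.1]
    · rintro ⟨ρ', h, h'⟩
      refine ⟨ρ' y, ρ', fun x hx => ?_, h'⟩
      by_cases hxy : x = y
      · subst hxy; simp
      · rw [Function.update_of_ne hxy, h x (by simp [hxy, hx])]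

theorem realize_alls {M : Type*} [L.Structure M] (xs : List ℕ) (φ : InfFormula L) (ρ : ℕ → M) :
    (alls xs φ).Realize ρ ↔ ∀ ρ' : ℕ → M, (∀ x ∉ xs, ρ' x = ρ x) → φ.Realize ρ' := by
  induction xs generalizing ρ with
  | nil =>
    constructor
    · intro h ρ' h'
      rwa [show ρ' = ρ from funext fun x => h' x (by simp)]
    · exact fun h => h ρ fun _ _ => rfl
  | cons y xs ih =>
    change (∀ a, (alls xs φ).Realize (Function.update ρ y a)) ↔ _
    simp only [ih]
    constructor
    · intro h ρ' h'
      refine h (ρ' y) ρ' fun x hx => ?_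
      by_cases hxy : x = y
      · subst hxy; simp
      · rw [Function.update_of_ne hxy, h' x (by simp [hxy, hx])]
    · intro h a ρ' h'
      refine h ρ' fun x hx => ?_
      simp only [List.mem_cons, not_or] at hx
      rw [h' x hx.2, Function.update_of_ne hx.1]

theorem mem_freeVars_exs {xs : List ℕ} {φ : InfFormula L} {x : ℕ} :
    x ∈ (exs xs φ).freeVars ↔ x ∈ φ.freeVars ∧ x ∉ xs := by
  induction xs with
  | nil => simp [exs]
  | cons y xs ih =>
    change x ∈ (exs xs φ).freeVars \ {y} ↔ _
    simp only [Set.mem_sdiff, ih, Set.mem_singleton_iff, List.mem_cons]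
    tauto

theorem mem_freeVars_alls {xs : List ℕ} {φ : InfFormula L} {x : ℕ} :
    x ∈ (alls xs φ).freeVars ↔ x ∈ φ.freeVars ∧ x ∉ xs := by
  induction xs with
  | nil => simp [alls]
  | cons y xs ih =>
    change x ∈ (alls xs φ).freeVars \ {y} ↔ _
    simp only [Set.mem_sdiff, ih, Set.mem_singleton_iff, List.mem_cons]
    tauto

theorem realize_and {M : Type*} [L.Structure M] (φ ψ : InfFormula L) (ρ : ℕ → M) :
    (φ.and ψ).Realize ρ ↔ φ.Realize ρ ∧ ψ.Realize ρ := by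
  simp [InfFormula.and, Realize]

theorem freeVars_and (φ ψ : InfFormula L) : (φ.and ψ).freeVars = φ.freeVars ∪ ψ.freeVars := by
  ext x
  simp [InfFormula.and, freeVars]

end InfFormula

theorem sigmaFormula_zero (e : ℕ) : sigmaFormula 0 e = .fo (qfOfCode e) := by
  rw [sigmaFormula]

theorem piFormula_zero (e : ℕ) : piFormula 0 e = .fo (qfOfCode e) := by
  rw [piFormula]

theorem realize_sigmaFormula_succ {n e : ℕ} {M : Type*} [groupLang.Structure M] {ρ : ℕ → M} :
    (sigmaFormula (n + 1) e).Realize ρ ↔ ∃ t : ℕ × List ℕ × ℕ, Encodable.encode t ∈ ceSet e ∧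
      t.1 < n + 1 ∧ ∃ ρ' : ℕ → M, (∀ x ∉ t.2.1, ρ' x = ρ x) ∧ (piFormula t.1 t.2.2).Realize ρ' := by
  rw [sigmaFormula]
  constructor
  · rintro ⟨i, ⟨hi, hlt⟩, h⟩
    refine ⟨Denumerable.ofNat (ℕ × List ℕ × ℕ) i, by simpa using hi, hlt, ?_⟩
    simpa only [hlt, dif_pos, InfFormula.realize_exs] using h
  · rintro ⟨t, ht, hlt, h⟩
    refine ⟨Encodable.encode t, ⟨ht, by rwa [Denumerable.ofNat_encode]⟩, ?_⟩
    simpa only [Denumerable.ofNat_encode, hlt, dif_pos, InfFormula.realize_exs] using h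

theorem realize_piFormula_succ {n e : ℕ} {M : Type*} [groupLang.Structure M] {ρ : ℕ → M} :
    (piFormula (n + 1) e).Realize ρ ↔ ∀ t : ℕ × List ℕ × ℕ, Encodable.encode t ∈ ceSet e →
      t.1 < n + 1 → ∀ ρ' : ℕ → M, (∀ x ∉ t.2.1, ρ' x = ρ x) →
        (sigmaFormula t.1 t.2.2).Realize ρ' := by
  rw [piFormula]
  constructor
  · intro h t ht hlt
    have := h (Encodable.encode t) ⟨ht, by rwa [Denumerable.ofNat_encode]⟩
    simpa only [Denumerable.ofNat_encode, hlt, dif_pos, InfFormula.realize_alls] using this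
  · rintro h i ⟨hi, hlt⟩
    have := h (Denumerable.ofNat (ℕ × List ℕ × ℕ) i) (by simpa using hi) hlt
    simpa only [hlt, dif_pos, InfFormula.realize_alls] using this

theorem mem_freeVars_sigmaFormula_succ {n e x : ℕ} :
    x ∈ (sigmaFormula (n + 1) e).freeVars ↔ ∃ t : ℕ × List ℕ × ℕ, Encodable.encode t ∈ ceSet e ∧
      t.1 < n + 1 ∧ x ∈ (piFormula t.1 t.2.2).freeVars ∧ x ∉ t.2.1 := by
  rw [sigmaFormula]
  constructor
  · rintro ⟨i, ⟨hi, hlt⟩, h⟩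
    refine ⟨Denumerable.ofNat (ℕ × List ℕ × ℕ) i, by simpa using hi, hlt, ?_⟩
    simpa only [hlt, dif_pos, InfFormula.mem_freeVars_exs] using h
  · rintro ⟨t, ht, hlt, h⟩
    refine ⟨Encodable.encode t, ⟨ht, by rwa [Denumerable.ofNat_encode]⟩, ?_⟩
    simpa only [Denumerable.ofNat_encode, hlt, dif_pos, InfFormula.mem_freeVars_exs] using h

theorem mem_freeVars_piFormula_succ {n e x : ℕ} :
    x ∈ (piFormula (n + 1) e).freeVars ↔ ∃ t : ℕ × List ℕ × ℕ, Encodable.encode t ∈ ceSet e ∧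
      t.1 < n + 1 ∧ x ∈ (sigmaFormula t.1 t.2.2).freeVars ∧ x ∉ t.2.1 := by
  rw [piFormula]
  constructor
  · rintro ⟨i, ⟨hi, hlt⟩, h⟩
    refine ⟨Denumerable.ofNat (ℕ × List ℕ × ℕ) i, by simpa using hi, hlt, ?_⟩
    simpa only [hlt, dif_pos, InfFormula.mem_freeVars_alls] using h
  · rintro ⟨t, ht, hlt, h⟩
    refine ⟨Encodable.encode t, ⟨ht, by rwa [Denumerable.ofNat_encode]⟩, ?_⟩
    simpa only [Denumerable.ofNat_encode, hlt, dif_pos, InfFormula.mem_freeVars_alls] using h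

/-! ### Closure properties of the computable infinitary formulas -/

section Definability

variable {α β : Type} [Primcodable α] [Primcodable β]

theorem ComputablePred.of_eq_comp {f g : α → β} (hf : Computable f) (hg : Computable g) :
    ComputablePred fun a => f a = g a :=
  ComputablePred.comp (p := fun x : β × β => x.1 = x.2)
    (PrimrecPred.computablePred Primrec.eq) (hf.pair hg)

/-- A uniform family `R` of properties of assignments, one for each parameter in `α` and each
structure, is uniformly defined by computable `Σ_n` formulas, the one for `a` having its free
variables in `V a`. -/
def IsSig (n : ℕ) (V : α → Set ℕ)
    (R : α → (M : Type) → [groupLang.Structure M] → (ℕ → M) → Prop) : Prop :=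
  ∃ f : α → ℕ, Computable f ∧ ∀ a, (sigmaFormula n (f a)).freeVars ⊆ V a ∧
    ∀ (M : Type) [groupLang.Structure M] (ρ : ℕ → M), (sigmaFormula n (f a)).Realize ρ ↔ R a M ρ

/-- The counterpart of `IsSig` for computable `Π_n` formulas. -/
def IsPi (n : ℕ) (V : α → Set ℕ)
    (R : α → (M : Type) → [groupLang.Structure M] → (ℕ → M) → Prop) : Prop :=
  ∃ f : α → ℕ, Computable f ∧ ∀ a, (piFormula n (f a)).freeVars ⊆ V a ∧
    ∀ (M : Type) [groupLang.Structure M] (ρ : ℕ → M), (piFormula n (f a)).Realize ρ ↔ R a M ρ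

variable {m n : ℕ} {V V' : α → Set ℕ}
  {R R' : α → (M : Type) → [groupLang.Structure M] → (ℕ → M) → Prop}

theorem IsSig.mono (h : IsSig n V R) (hV : ∀ a, V a ⊆ V' a)
    (hR : ∀ a (M : Type) [groupLang.Structure M] (ρ : ℕ → M), R a M ρ ↔ R' a M ρ) :
    IsSig n V' R' := by
  obtain ⟨f, hf, h⟩ := h
  exact ⟨f, hf, fun a => ⟨(h a).1.trans (hV a), fun M _ ρ => ((h a).2 M ρ).trans (hR a M ρ)⟩⟩

theorem IsPi.mono (h : IsPi n V R) (hV : ∀ a, V a ⊆ V' a)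
    (hR : ∀ a (M : Type) [groupLang.Structure M] (ρ : ℕ → M), R a M ρ ↔ R' a M ρ) :
    IsPi n V' R' := by
  obtain ⟨f, hf, h⟩ := h
  exact ⟨f, hf, fun a => ⟨(h a).1.trans (hV a), fun M _ ρ => ((h a).2 M ρ).trans (hR a M ρ)⟩⟩

theorem IsSig.congr (h : IsSig n V R)
    (hR : ∀ a (M : Type) [groupLang.Structure M] (ρ : ℕ → M), R a M ρ ↔ R' a M ρ) :
    IsSig n V R' :=
  h.mono (fun _ => subset_rfl) hR

theorem IsPi.congr (h : IsPi n V R)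
    (hR : ∀ a (M : Type) [groupLang.Structure M] (ρ : ℕ → M), R a M ρ ↔ R' a M ρ) :
    IsPi n V R' :=
  h.mono (fun _ => subset_rfl) hR

theorem isSig_of_rePred {P : α → ℕ × List ℕ × ℕ → Prop}
    (hP : REPred fun x : α × (ℕ × List ℕ × ℕ) => P x.1 x.2)
    (hV : ∀ a t, P a t → t.1 < n + 1 → ∀ x ∈ (piFormula t.1 t.2.2).freeVars, x ∉ t.2.1 → x ∈ V a)
    (hR : ∀ a (M : Type) [groupLang.Structure M] (ρ : ℕ → M), (∃ t, P a t ∧ t.1 < n + 1 ∧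
      ∃ ρ' : ℕ → M, (∀ x ∉ t.2.1, ρ' x = ρ x) ∧ (piFormula t.1 t.2.2).Realize ρ') ↔ R a M ρ) :
    IsSig (n + 1) V R := by
  obtain ⟨f, hf, hfP⟩ := REPred.exists_ceSet_index
    (p := fun a i => P a (Denumerable.ofNat (ℕ × List ℕ × ℕ) i))
    (hP.comp (Computable.fst.pair ((Computable.ofNat _).comp Computable.snd)))
  have hfP' : ∀ a t, Encodable.encode t ∈ ceSet (f a) ↔ P a t := fun a t => by
    rw [hfP, Denumerable.ofNat_encode]
  refine ⟨f, hf, fun a => ⟨fun x hx => ?_, fun M _ ρ => ?_⟩⟩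
  · obtain ⟨t, ht, hlt, hxt, hxt'⟩ := mem_freeVars_sigmaFormula_succ.1 hx
    exact hV a t ((hfP' a t).1 ht) hlt x hxt hxt'
  · rw [realize_sigmaFormula_succ, ← hR]
    simp only [hfP']

theorem isPi_of_rePred {P : α → ℕ × List ℕ × ℕ → Prop}
    (hP : REPred fun x : α × (ℕ × List ℕ × ℕ) => P x.1 x.2)
    (hV : ∀ a t, P a t → t.1 < n + 1 →
      ∀ x ∈ (sigmaFormula t.1 t.2.2).freeVars, x ∉ t.2.1 → x ∈ V a)
    (hR : ∀ a (M : Type) [groupLang.Structure M] (ρ : ℕ → M), (∀ t, P a t → t.1 < n + 1 →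
      ∀ ρ' : ℕ → M, (∀ x ∉ t.2.1, ρ' x = ρ x) → (sigmaFormula t.1 t.2.2).Realize ρ') ↔ R a M ρ) :
    IsPi (n + 1) V R := by
  obtain ⟨f, hf, hfP⟩ := REPred.exists_ceSet_index
    (p := fun a i => P a (Denumerable.ofNat (ℕ × List ℕ × ℕ) i))
    (hP.comp (Computable.fst.pair ((Computable.ofNat _).comp Computable.snd)))
  have hfP' : ∀ a t, Encodable.encode t ∈ ceSet (f a) ↔ P a t := fun a t => by
    rw [hfP, Denumerable.ofNat_encode]
  refine ⟨f, hf, fun a => ⟨fun x hx => ?_, fun M _ ρ => ?_⟩⟩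
  · obtain ⟨t, ht, hlt, hxt, hxt'⟩ := mem_freeVars_piFormula_succ.1 hx
    exact hV a t ((hfP' a t).1 ht) hlt x hxt hxt'
  · rw [realize_piFormula_succ, ← hR]
    simp only [hfP']

/-- The family of triples `(m, xs, j)` with code in `W_{f a}` is uniformly c.e. -/
theorem rePred_encode_mem_ceSet {γ : Type} [Primcodable γ] {f : α → ℕ} {g : α → γ}
    (hf : Computable f) (hg : Computable g) :
    REPred fun a => Encodable.encode (g a) ∈ ceSet (f a) :=
  rePred_mem_ceSet.comp (hf.pair (Computable.encode.comp hg))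

theorem IsPi.isSig (h : IsPi m V R) (hmn : m < n + 1) : IsSig (n + 1) V R := by
  obtain ⟨f, hf, h⟩ := h
  refine isSig_of_rePred (P := fun a t => t = (m, [], f a)) ?_ ?_ ?_
  · exact (ComputablePred.of_eq_comp Computable.snd ((Computable.const m).pair
      ((Computable.const []).pair (hf.comp Computable.fst)))).to_re
  · rintro a t rfl _ x hx _
    exact (h a).1 hx
  · intro a M _ ρ
    rw [← (h a).2]
    constructor
    · rintro ⟨t, rfl, -, ρ', hρ, h'⟩
      rwa [show ρ = ρ' from funext fun x => (hρ x (by simp)).symm]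
    · exact fun h' => ⟨_, rfl, hmn, ρ, fun _ _ => rfl, h'⟩

theorem IsSig.isPi (h : IsSig m V R) (hmn : m < n + 1) : IsPi (n + 1) V R := by
  obtain ⟨f, hf, h⟩ := h
  refine isPi_of_rePred (P := fun a t => t = (m, [], f a)) ?_ ?_ ?_
  · exact (ComputablePred.of_eq_comp Computable.snd ((Computable.const m).pair
      ((Computable.const []).pair (hf.comp Computable.fst)))).to_re
  · rintro a t rfl _ x hx _
    exact (h a).1 hx
  · intro a M _ ρ
    rw [← (h a).2]
    constructor
    · exact fun h' => h' _ rfl hmn ρ fun _ _ => rfl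
    · rintro h' t rfl - ρ' hρ
      rwa [show ρ' = ρ from funext fun x => hρ x (by simp)]

theorem IsSig.exs (h : IsSig (n + 1) V R) {xs : α → List ℕ} (hxs : Computable xs) :
    IsSig (n + 1) (fun a => V a \ {x | x ∈ xs a}) fun a M _ ρ =>
      ∃ ρ' : ℕ → M, (∀ x ∉ xs a, ρ' x = ρ x) ∧ R a M ρ' := by
  obtain ⟨f, hf, h⟩ := h
  refine isSig_of_rePred (P := fun a t => ∃ t' : ℕ × List ℕ × ℕ,
    t = (t'.1, xs a ++ t'.2.1, t'.2.2) ∧ Encodable.encode t' ∈ ceSet (f a)) ?_ ?_ ?_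
  · refine REPred.exists (p := fun (y : α × (ℕ × List ℕ × ℕ)) (t' : ℕ × List ℕ × ℕ) =>
      y.2 = (t'.1, xs y.1 ++ t'.2.1, t'.2.2) ∧ Encodable.encode t' ∈ ceSet (f y.1)) ?_
    refine ((ComputablePred.of_eq_comp (Computable.snd.comp Computable.fst) ?_).to_re).and
      (rePred_encode_mem_ceSet (hf.comp (Computable.fst.comp Computable.fst)) Computable.snd)
    exact (Computable.fst.comp Computable.snd).pair
      ((Computable.list_append.comp (hxs.comp (Computable.fst.comp Computable.fst))
        (Computable.fst.comp (Computable.snd.comp Computable.snd))).pair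
        (Computable.snd.comp (Computable.snd.comp Computable.snd)))
  · rintro a t ⟨t', rfl, ht'⟩ hlt x hx hx'
    simp only [List.mem_append, not_or] at hx'
    exact ⟨(h a).1 (mem_freeVars_sigmaFormula_succ.2 ⟨t', ht', hlt, hx, hx'.2⟩), hx'.1⟩
  · intro a M _ ρ
    simp only [← (h a).2, realize_sigmaFormula_succ]
    constructor
    · classical
      rintro ⟨t, ⟨t', rfl, ht'⟩, hlt, ρ', hρ, h'⟩
      refine ⟨fun x => if x ∈ xs a then ρ' x else ρ x, fun x hx => by simp [hx], t', ht', hlt, ρ',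
        fun x hx => ?_, h'⟩
      by_cases hxa : x ∈ xs a
      · simp [hxa]
      · simpa [hxa] using hρ x (by simp [hxa, hx])
    · rintro ⟨ρ₁, hρ₁, t', ht', hlt, ρ', hρ, h'⟩
      refine ⟨_, ⟨t', rfl, ht'⟩, hlt, ρ', fun x hx => ?_, h'⟩
      simp only [List.mem_append, not_or] at hx
      rw [hρ x hx.2, hρ₁ x hx.1]

theorem IsPi.alls (h : IsPi (n + 1) V R) {xs : α → List ℕ} (hxs : Computable xs) :
    IsPi (n + 1) (fun a => V a \ {x | x ∈ xs a}) fun a M _ ρ =>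
      ∀ ρ' : ℕ → M, (∀ x ∉ xs a, ρ' x = ρ x) → R a M ρ' := by
  obtain ⟨f, hf, h⟩ := h
  refine isPi_of_rePred (P := fun a t => ∃ t' : ℕ × List ℕ × ℕ,
    t = (t'.1, xs a ++ t'.2.1, t'.2.2) ∧ Encodable.encode t' ∈ ceSet (f a)) ?_ ?_ ?_
  · refine REPred.exists (p := fun (y : α × (ℕ × List ℕ × ℕ)) (t' : ℕ × List ℕ × ℕ) =>
      y.2 = (t'.1, xs y.1 ++ t'.2.1, t'.2.2) ∧ Encodable.encode t' ∈ ceSet (f y.1)) ?_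
    refine ((ComputablePred.of_eq_comp (Computable.snd.comp Computable.fst) ?_).to_re).and
      (rePred_encode_mem_ceSet (hf.comp (Computable.fst.comp Computable.fst)) Computable.snd)
    exact (Computable.fst.comp Computable.snd).pair
      ((Computable.list_append.comp (hxs.comp (Computable.fst.comp Computable.fst))
        (Computable.fst.comp (Computable.snd.comp Computable.snd))).pair
        (Computable.snd.comp (Computable.snd.comp Computable.snd)))
  · rintro a t ⟨t', rfl, ht'⟩ hlt x hx hx'
    simp only [List.mem_append, not_or] at hx'
    exact ⟨(h a).1 (mem_freeVars_piFormula_succ.2 ⟨t', ht', hlt, hx, hx'.2⟩), hx'.1⟩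
  · intro a M _ ρ
    simp only [← (h a).2, realize_piFormula_succ]
    constructor
    · rintro h' ρ₁ hρ₁ t' ht' hlt ρ' hρ
      refine h' _ ⟨t', rfl, ht'⟩ hlt ρ' fun x hx => ?_
      simp only [List.mem_append, not_or] at hx
      rw [hρ x hx.2, hρ₁ x hx.1]
    · classical
      rintro h' t ⟨t', rfl, ht'⟩ hlt ρ' hρ
      refine h' (fun x => if x ∈ xs a then ρ' x else ρ x) (fun x hx => by simp [hx]) t' ht' hlt ρ'
        fun x hx => ?_
      by_cases hxa : x ∈ xs a
      · simp [hxa]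
      · simpa [hxa] using hρ x (by simp [hxa, hx])

theorem IsSig.iSup {S : α × β → (M : Type) → [groupLang.Structure M] → (ℕ → M) → Prop}
    (h : IsSig (n + 1) (fun x : α × β => V x.1) S) {P : α → β → Prop}
    (hP : REPred fun x : α × β => P x.1 x.2) :
    IsSig (n + 1) V fun a M _ ρ => ∃ b, P a b ∧ S (a, b) M ρ := by
  obtain ⟨f, hf, h⟩ := h
  refine isSig_of_rePred (P := fun a t => ∃ b, P a b ∧ Encodable.encode t ∈ ceSet (f (a, b)))
    ?_ ?_ ?_
  · refine REPred.exists (p := fun (y : α × (ℕ × List ℕ × ℕ)) b =>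
      P y.1 b ∧ Encodable.encode y.2 ∈ ceSet (f (y.1, b))) ?_
    have h1 : Computable fun y : (α × (ℕ × List ℕ × ℕ)) × β => (y.1.1, y.2) :=
      (Computable.fst.comp Computable.fst).pair Computable.snd
    exact (hP.comp h1).and
      (rePred_encode_mem_ceSet (hf.comp h1) (Computable.snd.comp Computable.fst))
  · rintro a t ⟨b, -, ht⟩ hlt x hx hx'
    exact (h (a, b)).1 (mem_freeVars_sigmaFormula_succ.2 ⟨t, ht, hlt, hx, hx'⟩)
  · intro a M _ ρ
    simp only [← (h _).2, realize_sigmaFormula_succ]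
    constructor
    · rintro ⟨t, ⟨b, hb, ht⟩, h'⟩
      exact ⟨b, hb, t, ht, h'⟩
    · rintro ⟨b, hb, t, ht, h'⟩
      exact ⟨t, ⟨b, hb, ht⟩, h'⟩

theorem IsPi.iInf {S : α × β → (M : Type) → [groupLang.Structure M] → (ℕ → M) → Prop}
    (h : IsPi (n + 1) (fun x : α × β => V x.1) S) {P : α → β → Prop}
    (hP : REPred fun x : α × β => P x.1 x.2) :
    IsPi (n + 1) V fun a M _ ρ => ∀ b, P a b → S (a, b) M ρ := by
  obtain ⟨f, hf, h⟩ := h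
  refine isPi_of_rePred (P := fun a t => ∃ b, P a b ∧ Encodable.encode t ∈ ceSet (f (a, b)))
    ?_ ?_ ?_
  · refine REPred.exists (p := fun (y : α × (ℕ × List ℕ × ℕ)) b =>
      P y.1 b ∧ Encodable.encode y.2 ∈ ceSet (f (y.1, b))) ?_
    have h1 : Computable fun y : (α × (ℕ × List ℕ × ℕ)) × β => (y.1.1, y.2) :=
      (Computable.fst.comp Computable.fst).pair Computable.snd
    exact (hP.comp h1).and
      (rePred_encode_mem_ceSet (hf.comp h1) (Computable.snd.comp Computable.fst))
  · rintro a t ⟨b, -, ht⟩ hlt x hx hx'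
    exact (h (a, b)).1 (mem_freeVars_piFormula_succ.2 ⟨t, ht, hlt, hx, hx'⟩)
  · intro a M _ ρ
    simp only [← (h _).2, realize_piFormula_succ]
    constructor
    · exact fun h' b hb t ht => h' t ⟨b, hb, ht⟩
    · rintro h' t ⟨b, hb, ht⟩
      exact h' b hb t ht

theorem IsSig.or (h : IsSig (n + 1) V R) (h' : IsSig (n + 1) V R') :
    IsSig (n + 1) V fun a M _ ρ => R a M ρ ∨ R' a M ρ := by
  obtain ⟨f, hf, h⟩ := h
  obtain ⟨g, hg, h'⟩ := h'
  refine isSig_of_rePred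
    (P := fun a t => Encodable.encode t ∈ ceSet (f a) ∨ Encodable.encode t ∈ ceSet (g a)) ?_ ?_ ?_
  · exact (rePred_encode_mem_ceSet (hf.comp Computable.fst) Computable.snd).or
      (rePred_encode_mem_ceSet (hg.comp Computable.fst) Computable.snd)
  · rintro a t (ht | ht) hlt x hx hx'
    · exact (h a).1 (mem_freeVars_sigmaFormula_succ.2 ⟨t, ht, hlt, hx, hx'⟩)
    · exact (h' a).1 (mem_freeVars_sigmaFormula_succ.2 ⟨t, ht, hlt, hx, hx'⟩)
  · intro a M _ ρ
    simp only [← (h _).2, ← (h' _).2, realize_sigmaFormula_succ, or_and_right, exists_or]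

theorem IsPi.and (h : IsPi (n + 1) V R) (h' : IsPi (n + 1) V R') :
    IsPi (n + 1) V fun a M _ ρ => R a M ρ ∧ R' a M ρ := by
  obtain ⟨f, hf, h⟩ := h
  obtain ⟨g, hg, h'⟩ := h'
  refine isPi_of_rePred
    (P := fun a t => Encodable.encode t ∈ ceSet (f a) ∨ Encodable.encode t ∈ ceSet (g a)) ?_ ?_ ?_
  · exact (rePred_encode_mem_ceSet (hf.comp Computable.fst) Computable.snd).or
      (rePred_encode_mem_ceSet (hg.comp Computable.fst) Computable.snd)
  · rintro a t (ht | ht) hlt x hx hx'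
    · exact (h a).1 (mem_freeVars_piFormula_succ.2 ⟨t, ht, hlt, hx, hx'⟩)
    · exact (h' a).1 (mem_freeVars_piFormula_succ.2 ⟨t, ht, hlt, hx, hx'⟩)
  · intro a M _ ρ
    simp only [← (h _).2, ← (h' _).2, realize_piFormula_succ, or_imp, forall_and]

theorem IsSig.ex {k : ℕ} (h : IsSig (n + 1) (fun _ : α => Set.Iio (k + 1)) R) :
    IsSig (n + 1) (fun _ : α => Set.Iio k) fun a M _ ρ => ∃ y, R a M (Function.update ρ k y) := by
  refine (h.exs (Computable.const [k])).mono (fun a x hx => ?_) fun a M _ ρ => ?_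
  · simp only [Set.mem_sdiff, Set.mem_Iio, Set.mem_ofPred_eq, List.mem_singleton] at hx ⊢
    omega
  · constructor
    · rintro ⟨ρ', hρ, h'⟩
      refine ⟨ρ' k, ?_⟩
      rwa [show Function.update ρ k (ρ' k) = ρ' from ?_]
      rw [Function.update_eq_iff]
      exact ⟨rfl, fun x hx => (hρ x (by simpa using hx)).symm⟩
    · rintro ⟨y, h'⟩
      exact ⟨_, fun x hx => Function.update_of_ne (by simpa using hx) _ _, h'⟩

theorem IsPi.all {k : ℕ} (h : IsPi (n + 1) (fun _ : α => Set.Iio (k + 1)) R) :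
    IsPi (n + 1) (fun _ : α => Set.Iio k) fun a M _ ρ => ∀ y, R a M (Function.update ρ k y) := by
  refine (h.alls (Computable.const [k])).mono (fun a x hx => ?_) fun a M _ ρ => ?_
  · simp only [Set.mem_sdiff, Set.mem_Iio, Set.mem_ofPred_eq, List.mem_singleton] at hx ⊢
    omega
  · constructor
    · exact fun h' y => h' _ fun x hx => Function.update_of_ne (by simpa using hx) _ _
    · intro h' ρ' hρ
      have := h' (ρ' k)
      rwa [show Function.update ρ k (ρ' k) = ρ' from ?_] at this
      rw [Function.update_eq_iff]
      exact ⟨rfl, fun x hx => (hρ x (by simpa using hx)).symm⟩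

theorem isSig_sigmaFormula (n e : ℕ) : IsSig n (fun _ : Unit => (sigmaFormula n e).freeVars)
    fun _ _ _ ρ => (sigmaFormula n e).Realize ρ :=
  ⟨fun _ => e, Computable.const e, fun _ => ⟨subset_rfl, fun _ _ _ => Iff.rfl⟩⟩

theorem isPi_piFormula (n e : ℕ) : IsPi n (fun _ : Unit => (piFormula n e).freeVars)
    fun _ _ _ ρ => (piFormula n e).Realize ρ :=
  ⟨fun _ => e, Computable.const e, fun _ => ⟨subset_rfl, fun _ _ _ => Iff.rfl⟩⟩

/-- Every computable `Π_m` formula with `m ≤ n + 1` is equivalent to a computable `Π_{n+1}` formula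
with the same free variables, uniformly. -/
theorem isPi_piFormula_le (n : ℕ) : ∃ f : ℕ × ℕ → ℕ, Computable f ∧ ∀ m j, m ≤ n + 1 →
    (piFormula (n + 1) (f (m, j))).freeVars ⊆ (piFormula m j).freeVars ∧
    ∀ (M : Type) [groupLang.Structure M] (ρ : ℕ → M),
      (piFormula (n + 1) (f (m, j))).Realize ρ ↔ (piFormula m j).Realize ρ := by
  obtain ⟨f, hf, hfP⟩ := REPred.exists_ceSet_index (α := ℕ × ℕ)
    (p := fun a i => (a.1 = 0 ∧ i = Encodable.encode (0, ([] : List ℕ), a.2)) ∨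
      i ∈ ceSet a.2 ∧ (Denumerable.ofNat (ℕ × List ℕ × ℕ) i).1 < a.1) (by
    have h1 : Computable fun x : (ℕ × ℕ) × ℕ => x.1.1 := Computable.fst.comp Computable.fst
    have h2 : Computable fun x : (ℕ × ℕ) × ℕ => x.1.2 := Computable.snd.comp Computable.fst
    refine REPred.or (ComputablePred.and (ComputablePred.of_eq_comp h1 (Computable.const 0))
      (ComputablePred.of_eq_comp Computable.snd (Computable.encode.comp
        ((Computable.const 0).pair ((Computable.const []).pair h2))))).to_re
      ((rePred_mem_ceSet.comp (h2.pair Computable.snd)).and (ComputablePred.to_re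
        (ComputablePred.comp (p := fun y : ℕ × ℕ => y.1 < y.2)
          (PrimrecPred.computablePred Primrec.nat_lt)
          ((Computable.fst.comp ((Computable.ofNat _).comp Computable.snd)).pair h1)))))
  have key : ∀ m j t, Encodable.encode t ∈ ceSet (f (m, j)) ↔
      (m = 0 ∧ t = (0, [], j)) ∨ Encodable.encode t ∈ ceSet j ∧ t.1 < m := fun m j t => by
    rw [hfP, Denumerable.ofNat_encode, Encodable.encode_inj]
  refine ⟨f, hf, fun m j hm => ⟨fun x hx => ?_, fun M _ ρ => ?_⟩⟩
  · obtain ⟨t, ht, hlt, hxt, hxt'⟩ := mem_freeVars_piFormula_succ.1 hx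
    rw [key] at ht
    rcases ht with ⟨rfl, rfl⟩ | ⟨ht, hlt'⟩
    · rwa [sigmaFormula_zero, ← piFormula_zero] at hxt
    · obtain ⟨m, rfl⟩ : ∃ m', m = m' + 1 := ⟨m - 1, by omega⟩
      exact mem_freeVars_piFormula_succ.2 ⟨t, ht, hlt', hxt, hxt'⟩
  · rw [realize_piFormula_succ]
    simp only [key]
    rcases m with - | m
    · constructor
      · intro h
        have := h (0, [], j) (Or.inl ⟨rfl, rfl⟩) (by simp) ρ fun _ _ => rfl
        rwa [sigmaFormula_zero, ← piFormula_zero] at this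
      · rintro h t (⟨-, rfl⟩ | ⟨-, h'⟩) - ρ' hρ
        · rw [show ρ' = ρ from funext fun x => hρ x (by simp), sigmaFormula_zero, ← piFormula_zero]
          exact h
        · omega
    · rw [realize_piFormula_succ]
      constructor
      · exact fun h t ht hlt ρ' hρ => h t (Or.inr ⟨ht, hlt⟩) (by omega) ρ' hρ
      · rintro h t (⟨h0, -⟩ | ⟨ht, hlt⟩) - ρ' hρ
        · omega
        · exact h t ht hlt ρ' hρ

theorem IsPi.succ (h : IsPi (n + 1) V R) : IsPi (n + 2) V R := by
  obtain ⟨f, hf, h⟩ := h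
  obtain ⟨g, hg, hg'⟩ := isPi_piFormula_le (n + 1)
  refine ⟨fun a => g (n + 1, f a), hg.comp ((Computable.const _).pair hf), fun a => ?_⟩
  have := hg' (n + 1) (f a) (by omega)
  exact ⟨this.1.trans (h a).1, fun M _ ρ => (this.2 M ρ).trans ((h a).2 M ρ)⟩

/-- The conjunction of a computable `Σ_{n+1}` sentence and a computable `Π_{n+1}` sentence is
equivalent to a computable `Σ_{n+2}` sentence: the `Π_{n+1}` sentence can be moved into the scope of
the disjunctions and existential quantifiers of the other one. -/
theorem isSig_and_of_isSentence {e e' : ℕ} (he : (sigmaFormula (n + 1) e).IsSentence)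
    (he' : (piFormula (n + 1) e').IsSentence) :
    IsSig (n + 2) (fun _ : Unit => ∅) fun _ _ _ ρ =>
      (sigmaFormula (n + 1) e).Realize ρ ∧ (piFormula (n + 1) e').Realize ρ := by
  obtain ⟨g, hg, hg'⟩ := isPi_piFormula_le n
  have hc : Computable fun t : ℕ × List ℕ × ℕ => g (t.1, t.2.2) := hg.comp
    (Computable.fst.pair (Computable.snd.comp Computable.snd))
  have h1 : IsPi (n + 1) (fun t : ℕ × List ℕ × ℕ => (piFormula (n + 1) (g (t.1, t.2.2))).freeVars)
      fun t _ _ ρ => (piFormula (n + 1) (g (t.1, t.2.2))).Realize ρ :=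
    ⟨_, hc, fun _ => ⟨subset_rfl, fun _ _ _ => Iff.rfl⟩⟩
  have h2 : IsPi (n + 1) (fun t : ℕ × List ℕ × ℕ => (piFormula (n + 1) (g (t.1, t.2.2))).freeVars)
      fun _ _ _ ρ => (piFormula (n + 1) e').Realize ρ :=
    ⟨_, Computable.const e', fun _ =>
      ⟨by rw [show (piFormula (n + 1) e').freeVars = ∅ from he']; simp, fun _ _ _ => Iff.rfl⟩⟩
  have h3 := ((h1.and h2).isSig (n := n + 1) (by omega)).exs (xs := fun t => t.2.1)
    (Computable.fst.comp Computable.snd)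
  -- an index for the family of all disjuncts of the first sentence
  obtain ⟨f, hf, hf'⟩ := h3
  refine isSig_of_rePred (P := fun _ t => ∃ t' : ℕ × List ℕ × ℕ,
    (Encodable.encode t' ∈ ceSet e ∧ t'.1 < n + 1) ∧
      Encodable.encode t ∈ ceSet (f t')) ?_ ?_ ?_
  · refine REPred.exists (p := fun (y : Unit × (ℕ × List ℕ × ℕ)) (t' : ℕ × List ℕ × ℕ) =>
      (Encodable.encode t' ∈ ceSet e ∧ t'.1 < n + 1) ∧ Encodable.encode y.2 ∈ ceSet (f t')) ?_
    refine REPred.and (REPred.and (rePred_encode_mem_ceSet (Computable.const e) Computable.snd) ?_)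
      (rePred_encode_mem_ceSet (hf.comp Computable.snd) (Computable.snd.comp Computable.fst))
    exact (PrimrecPred.computablePred (Primrec.nat_lt.comp (Primrec.fst.comp Primrec.snd)
      (Primrec.const (n + 1)))).to_re
  · rintro a t ⟨t', ⟨ht', hlt'⟩, ht⟩ hlt x hx hx'
    have hx1 := (hf' t').1 (mem_freeVars_sigmaFormula_succ.2 ⟨t, ht, hlt, hx, hx'⟩)
    have hx2 := (hg' t'.1 t'.2.2 (by omega)).1 hx1.1
    have hx3 := mem_freeVars_sigmaFormula_succ.2 ⟨t', ht', hlt', hx2, hx1.2⟩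
    rwa [show (sigmaFormula (n + 1) e).freeVars = ∅ from he] at hx3
  · intro a M _ ρ
    have hindep : ∀ ρ' : ℕ → M, (piFormula (n + 1) e').Realize ρ' ↔
        (piFormula (n + 1) e').Realize ρ := fun ρ' => InfFormula.realize_congr _ fun x hx => by
      rw [show (piFormula (n + 1) e').freeVars = ∅ from he'] at hx
      exact hx.elim
    constructor
    · rintro ⟨t, ⟨t', ⟨ht', hlt'⟩, ht⟩, h⟩
      obtain ⟨ρ', hρ, h1, h2⟩ := ((hf' t').2 M ρ).1 (realize_sigmaFormula_succ.2 ⟨t, ht, h⟩)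
      exact ⟨realize_sigmaFormula_succ.2 ⟨t', ht', hlt', ρ', hρ,
        ((hg' t'.1 t'.2.2 (by omega)).2 M ρ').1 h1⟩, (hindep ρ').1 h2⟩
    · rintro ⟨h1, h2⟩
      obtain ⟨t', ht', hlt', ρ', hρ, h1⟩ := realize_sigmaFormula_succ.1 h1
      obtain ⟨t, ht, h⟩ := realize_sigmaFormula_succ.1 (((hf' t').2 M ρ).2
        ⟨ρ', hρ, ((hg' t'.1 t'.2.2 (by omega)).2 M ρ').2 h1, (hindep ρ').2 h2⟩)
      exact ⟨t, ⟨t', ⟨ht', hlt'⟩, ht⟩, h⟩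

/-! ### Pseudo-Scott sentences -/

theorem IsPseudoScott.congr {φ ψ : InfFormula groupLang} {A : Type*} [groupLang.Structure A]
    (h : IsPseudoScott φ A) (hψ : ψ.IsSentence)
    (hr : ∀ (M : Type) [groupLang.Structure M] (ρ : ℕ → M), ψ.Realize ρ ↔ φ.Realize ρ) :
    IsPseudoScott ψ A :=
  ⟨hψ, fun D _ hD => (forall_congr' fun ρ => hr D ρ).trans (h.2 D hD)⟩

theorem HasDSigmaPseudoScott.sigma_and_pi {A : Type*} [groupLang.Structure A]
    (h : HasDSigmaPseudoScott (n + 1) A) :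
    HasSigmaPseudoScott (n + 2) A ∧ HasPiPseudoScott (n + 2) A := by
  obtain ⟨φ, ⟨σ, π, ⟨e, rfl⟩, ⟨e', rfl⟩, rfl⟩, hφ⟩ := h
  have hs := hφ.1
  rw [InfFormula.IsSentence, InfFormula.freeVars_and, Set.union_empty_iff] at hs
  constructor
  · obtain ⟨f, -, hf⟩ := isSig_and_of_isSentence hs.1 hs.2
    refine ⟨_, ⟨f (), rfl⟩, hφ.congr (Set.subset_empty_iff.1 (hf ()).1) fun M _ ρ => ?_⟩
    rw [(hf ()).2, InfFormula.realize_and]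
  · obtain ⟨f, -, hf⟩ := (((isSig_sigmaFormula (n + 1) e).isPi (n := n + 1) (by omega)).mono
      (V' := fun _ => ∅) (fun _ => hs.1.subset) fun _ _ _ _ => Iff.rfl).and
      ((isPi_piFormula (n + 1) e').succ.mono (fun _ => hs.2.subset) fun _ _ _ _ => Iff.rfl)
    refine ⟨_, ⟨f (), rfl⟩, hφ.congr (Set.subset_empty_iff.1 (hf ()).1) fun M _ ρ => ?_⟩
    rw [(hf ()).2, InfFormula.realize_and]

end Definability

/-! ### Terms and quantifier-free formulas -/

section Terms

theorem termOfCode_zero :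
    termOfCode 0 = Language.Term.func (L := groupLang) GroupFunc.one ![] := by
  rw [termOfCode]

theorem termOfCode_var (k : ℕ) : termOfCode (3 * k + 1) = Language.Term.var k := by
  have h : 3 * k % 3 = 0 := by omega
  have h' : 3 * k / 3 = k := by omega
  rw [termOfCode]
  simp [h, h']

theorem termOfCode_inv (k : ℕ) : termOfCode (3 * k + 1 + 1) =
    Language.Term.func (L := groupLang) GroupFunc.inv ![termOfCode k] := by
  have h : (3 * k + 1) % 3 = 1 := by omega
  have h' : (3 * k + 1) / 3 = k := by omega
  rw [termOfCode]
  simp [h, h']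

theorem termOfCode_mul (a b : ℕ) : termOfCode (3 * Nat.pair a b + 2 + 1) =
    Language.Term.func (L := groupLang) GroupFunc.mul ![termOfCode a, termOfCode b] := by
  have h : (3 * Nat.pair a b + 2) % 3 = 2 := by omega
  have h' : (3 * Nat.pair a b + 2) / 3 = Nat.pair a b := by omega
  rw [termOfCode]
  simp [h, h']

/-- Induction on terms, through their Gödel numbers. -/
theorem termCode_induction {P : ℕ → Prop} (one : P 0) (var : ∀ k, P (3 * k + 1))
    (inv : ∀ k, P k → P (3 * k + 1 + 1))
    (mul : ∀ a b, P a → P b → P (3 * Nat.pair a b + 2 + 1)) (n : ℕ) : P n := by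
  induction n using Nat.strong_induction_on with
  | _ n ih =>
    rcases n with - | n
    · exact one
    · have h := Nat.div_add_mod n 3
      have h3 := Nat.mod_lt n (show 0 < 3 by omega)
      generalize hk : n / 3 = k at h
      interval_cases hr : n % 3
      · rw [← h]; exact var k
      · rw [← h]; exact inv k (ih k (by omega))
      · rw [← h, ← Nat.pair_unpair k]
        exact mul _ _ (ih _ (by have := Nat.unpair_left_le k; omega))
          (ih _ (by have := Nat.unpair_right_le k; omega))

theorem qfOfCode_zero : qfOfCode 0 = ⊥ := by
  rw [qfOfCode]

theorem qfOfCode_equal (a b : ℕ) :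
    qfOfCode (2 * Nat.pair a b + 1) = (termOfCode a).equal (termOfCode b) := by
  have h : 2 * Nat.pair a b % 2 = 0 := by omega
  have h' : 2 * Nat.pair a b / 2 = Nat.pair a b := by omega
  rw [qfOfCode]
  simp [h]

theorem qfOfCode_imp (a b : ℕ) :
    qfOfCode (2 * Nat.pair a b + 1 + 1) = (qfOfCode a).imp (qfOfCode b) := by
  have h : (2 * Nat.pair a b + 1) % 2 = 1 := by omega
  have h' : (2 * Nat.pair a b + 1) / 2 = Nat.pair a b := by omega
  rw [qfOfCode]
  simp [h, h']

/-- Induction on quantifier-free formulas, through their Gödel numbers. -/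
theorem qfCode_induction {P : ℕ → Prop} (bot : P 0) (equal : ∀ a b, P (2 * Nat.pair a b + 1))
    (imp : ∀ a b, P a → P b → P (2 * Nat.pair a b + 1 + 1)) (n : ℕ) : P n := by
  induction n using Nat.strong_induction_on with
  | _ n ih =>
    rcases n with - | n
    · exact bot
    · have h := Nat.div_add_mod n 2
      have h3 := Nat.mod_lt n (show 0 < 2 by omega)
      generalize hk : n / 2 = k at h
      interval_cases hr : n % 2
      · rw [← h, ← Nat.pair_unpair k]; exact equal _ _
      · rw [← h, ← Nat.pair_unpair k]
        exact imp _ _ (ih _ (by have := Nat.unpair_left_le k; omega))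
          (ih _ (by have := Nat.unpair_right_le k; omega))

theorem isQF_qfOfCode (n : ℕ) : (qfOfCode n).IsQF := by
  induction n using qfCode_induction with
  | bot => rw [qfOfCode_zero]; exact Language.BoundedFormula.isQF_bot
  | equal a b =>
    rw [qfOfCode_equal]
    exact (Language.BoundedFormula.IsAtomic.equal _ _).isQF
  | imp a b ha hb => rw [qfOfCode_imp]; exact ha.imp hb

theorem realize_qfOfCode_embedding {M N : Type*} [groupLang.Structure M] [groupLang.Structure N]
    (f : M ↪[groupLang] N) (n : ℕ) (ρ : ℕ → M) :
    (qfOfCode n).Realize (f ∘ ρ) ↔ (qfOfCode n).Realize ρ := by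
  have := (isQF_qfOfCode n).realize_embedding (v := ρ) (xs := (default : Fin 0 → M)) f
  rwa [Subsingleton.elim (f ∘ default : Fin 0 → N) default] at this

theorem varFinsetLeft_relabel_inl {L : FirstOrder.Language.{0, 0}} (t : L.Term ℕ) :
    (t.relabel (Sum.inl : ℕ → ℕ ⊕ Fin 0)).varFinsetLeft = t.varFinset := by
  induction t with
  | var => rfl
  | func f ts ih =>
    simp only [Language.Term.relabel, Language.Term.varFinsetLeft, Language.Term.varFinset, ih]

/-! #### The operations of a structure in the signature of groups -/

section Operations

variable {M : Type*} [groupLang.Structure M]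

/-- The interpretation of `1`. -/
def opOne (M : Type*) [groupLang.Structure M] : M :=
  Language.Structure.funMap (L := groupLang) GroupFunc.one ![]

/-- The interpretation of `⁻¹`. -/
def opInv (x : M) : M := Language.Structure.funMap (L := groupLang) GroupFunc.inv ![x]

/-- The interpretation of `·`. -/
def opMul (x y : M) : M := Language.Structure.funMap (L := groupLang) GroupFunc.mul ![x, y]

/-- The power `x ⋯ x · 1`, bracketed to the right. -/
def opPow (x : M) : ℕ → M
  | 0 => opOne M
  | n + 1 => opMul x (opPow x n)

theorem realize_termOfCode_zero (ρ : ℕ → M) : (termOfCode 0).realize ρ = opOne M := by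
  rw [termOfCode_zero]
  exact congrArg (Language.Structure.funMap (L := groupLang) GroupFunc.one)
    (funext fun i => i.elim0)

theorem realize_termOfCode_var (ρ : ℕ → M) (k : ℕ) : (termOfCode (3 * k + 1)).realize ρ = ρ k := by
  rw [termOfCode_var]
  rfl

theorem realize_termOfCode_inv (ρ : ℕ → M) (k : ℕ) :
    (termOfCode (3 * k + 1 + 1)).realize ρ = opInv ((termOfCode k).realize ρ) := by
  rw [termOfCode_inv]
  exact congrArg _ (funext fun i => by fin_cases i; rfl)

theorem realize_termOfCode_mul (ρ : ℕ → M) (a b : ℕ) :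
    (termOfCode (3 * Nat.pair a b + 2 + 1)).realize ρ =
      opMul ((termOfCode a).realize ρ) ((termOfCode b).realize ρ) := by
  rw [termOfCode_mul]
  exact congrArg _ (funext fun i => by fin_cases i <;> rfl)

theorem realize_qfOfCode_zero (ρ : ℕ → M) : ¬ (qfOfCode 0).Realize ρ := by
  rw [qfOfCode_zero]
  exact id

theorem realize_qfOfCode_equal (ρ : ℕ → M) (a b : ℕ) : (qfOfCode (2 * Nat.pair a b + 1)).Realize ρ ↔
    (termOfCode a).realize ρ = (termOfCode b).realize ρ := by
  rw [qfOfCode_equal, Language.Formula.realize_equal]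

theorem realize_qfOfCode_imp (ρ : ℕ → M) (a b : ℕ) :
    (qfOfCode (2 * Nat.pair a b + 1 + 1)).Realize ρ ↔
      ((qfOfCode a).Realize ρ → (qfOfCode b).Realize ρ) := by
  rw [qfOfCode_imp, Language.Formula.realize_imp]

end Operations

section IsTerm

variable {α : Type} [Primcodable α] {V : α → Set ℕ}
  {T T' : α → (M : Type) → [groupLang.Structure M] → (ℕ → M) → M}

/-- A uniform family of operations on assignments is uniformly given by terms with computable
Gödel numbers. -/
def IsTerm (V : α → Set ℕ)
    (T : α → (M : Type) → [groupLang.Structure M] → (ℕ → M) → M) : Prop :=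
  ∃ f : α → ℕ, Computable f ∧ ∀ a, (↑(termOfCode (f a)).varFinset ⊆ V a) ∧
    ∀ (M : Type) [groupLang.Structure M] (ρ : ℕ → M), (termOfCode (f a)).realize ρ = T a M ρ

theorem IsTerm.one : IsTerm V fun _ M _ _ => opOne M := by
  refine ⟨fun _ => 0, Computable.const 0, fun a => ⟨?_, fun M _ ρ => realize_termOfCode_zero ρ⟩⟩
  rw [termOfCode_zero]
  simp [Language.Term.varFinset]

theorem IsTerm.var {k : α → ℕ} (hk : Computable k) (hkV : ∀ a, k a ∈ V a) :
    IsTerm V fun a _ _ ρ => ρ (k a) := by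
  refine ⟨fun a => 3 * k a + 1, Computable.succ.comp (Primrec.nat_mul.to_comp.comp
    (Computable.const 3) hk), fun a => ⟨?_, fun M _ ρ => realize_termOfCode_var ρ (k a)⟩⟩
  rw [termOfCode_var]
  simpa [Language.Term.varFinset] using hkV a

theorem IsTerm.inv (h : IsTerm V T) : IsTerm V fun a M _ ρ => opInv (T a M ρ) := by
  obtain ⟨f, hf, h⟩ := h
  refine ⟨fun a => 3 * f a + 1 + 1, ?_, fun a => ⟨?_, fun M _ ρ => ?_⟩⟩
  · exact Computable.succ.comp (Computable.succ.comp
      (Primrec.nat_mul.to_comp.comp (Computable.const 3) hf))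
  · rw [termOfCode_inv]
    have := (h a).1
    simpa [Language.Term.varFinset] using this
  · rw [realize_termOfCode_inv, (h a).2]

theorem computable_mulCode {f g : α → ℕ} (hf : Computable f) (hg : Computable g) :
    Computable fun a => 3 * Nat.pair (f a) (g a) + 2 + 1 :=
  Computable.succ.comp (Computable.succ.comp (Computable.succ.comp
      (Primrec.nat_mul.to_comp.comp (Computable.const 3) (Primrec₂.natPair.to_comp.comp hf hg))))

theorem varFinset_termOfCode_mul (a b : ℕ) : (termOfCode (3 * Nat.pair a b + 2 + 1)).varFinset =
    (termOfCode a).varFinset ∪ (termOfCode b).varFinset := by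
  rw [termOfCode_mul]
  ext x
  simp [Language.Term.varFinset, Fin.exists_fin_two]

theorem IsTerm.mul (h : IsTerm V T) (h' : IsTerm V T') :
    IsTerm V fun a M _ ρ => opMul (T a M ρ) (T' a M ρ) := by
  obtain ⟨f, hf, h⟩ := h
  obtain ⟨g, hg, h'⟩ := h'
  refine ⟨_, computable_mulCode hf hg, fun a => ⟨?_, fun M _ ρ => ?_⟩⟩
  · rw [varFinset_termOfCode_mul, Finset.coe_union]
    exact Set.union_subset (h a).1 (h' a).1
  · rw [realize_termOfCode_mul, (h a).2, (h' a).2]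

theorem IsTerm.pow (h : IsTerm V T) {g : α → ℕ} (hg : Computable g) :
    IsTerm V fun a M _ ρ => opPow (T a M ρ) (g a) := by
  obtain ⟨f, hf, h⟩ := h
  refine ⟨fun a => (g a).rec (motive := fun _ => ℕ) 0 fun _ c => 3 * Nat.pair (f a) c + 2 + 1,
    ?_, fun a => ?_⟩
  · have h1 : Computable₂ fun (a : α) (p : ℕ × ℕ) => 3 * Nat.pair (f a) p.2 + 2 + 1 :=
      computable_mulCode (hf.comp Computable.fst) (Computable.snd.comp Computable.snd)
    exact Computable.nat_rec hg (Computable.const 0) h1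
  · simp only
    induction g a with
    | zero =>
      refine ⟨?_, fun M _ ρ => realize_termOfCode_zero ρ⟩
      change (↑(termOfCode 0).varFinset : Set ℕ) ⊆ V a
      rw [termOfCode_zero]
      simp [Language.Term.varFinset]
    | succ n ih =>
      refine ⟨?_, fun M _ ρ => ?_⟩
      · simp only [varFinset_termOfCode_mul, Finset.coe_union]
        exact Set.union_subset (h a).1 ih.1
      · simp only [realize_termOfCode_mul]
        rw [ih.2 M ρ, (h a).2, opPow]

theorem IsTerm.equal (h : IsTerm V T) (h' : IsTerm V T') :
    IsPi 0 V fun a M _ ρ => T a M ρ = T' a M ρ := by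
  obtain ⟨f, hf, h⟩ := h
  obtain ⟨g, hg, h'⟩ := h'
  refine ⟨fun a => 2 * Nat.pair (f a) (g a) + 1, ?_, fun a => ⟨?_, fun M _ ρ => ?_⟩⟩
  · exact Computable.succ.comp
      (Primrec.nat_mul.to_comp.comp (Computable.const 2) (Primrec₂.natPair.to_comp.comp hf hg))
  · rw [piFormula_zero, qfOfCode_equal]
    intro x hx
    have hx' : x ∈ ((termOfCode (f a)).relabel (Sum.inl : ℕ → ℕ ⊕ Fin 0)).varFinsetLeft ∪
      ((termOfCode (g a)).relabel (Sum.inl : ℕ → ℕ ⊕ Fin 0)).varFinsetLeft := hx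
    rw [varFinsetLeft_relabel_inl, varFinsetLeft_relabel_inl, Finset.mem_union] at hx'
    exact hx'.elim (fun hx => (h a).1 hx) fun hx => (h' a).1 hx
  · rw [piFormula_zero]
    refine (realize_qfOfCode_equal ρ _ _).trans ?_
    rw [(h a).2 M ρ, (h' a).2 M ρ]

variable {R R' : α → (M : Type) → [groupLang.Structure M] → (ℕ → M) → Prop}

theorem IsPi.false : IsPi 0 V fun _ _ _ _ => False := by
  refine ⟨fun _ => 0, Computable.const 0, fun a => ⟨?_, fun M _ ρ => ?_⟩⟩
  · rw [piFormula_zero, qfOfCode_zero]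
    intro x hx
    have hx' : x ∈ (∅ : Finset ℕ) := hx
    simp at hx'
  · rw [piFormula_zero]
    exact iff_of_false (realize_qfOfCode_zero ρ) id

theorem IsPi.imp_zero (h : IsPi 0 V R) (h' : IsPi 0 V R') :
    IsPi 0 V fun a M _ ρ => R a M ρ → R' a M ρ := by
  obtain ⟨f, hf, h⟩ := h
  obtain ⟨g, hg, h'⟩ := h'
  simp only [piFormula_zero] at h h'
  refine ⟨fun a => 2 * Nat.pair (f a) (g a) + 1 + 1, ?_, fun a => ⟨?_, fun M _ ρ => ?_⟩⟩
  · exact Computable.succ.comp (Computable.succ.comp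
      (Primrec.nat_mul.to_comp.comp (Computable.const 2) (Primrec₂.natPair.to_comp.comp hf hg)))
  · rw [piFormula_zero, qfOfCode_imp]
    intro x hx
    have hx' : x ∈ (qfOfCode (f a)).freeVarFinset ∪ (qfOfCode (g a)).freeVarFinset := hx
    rw [Finset.mem_union] at hx'
    exact hx'.elim (fun hx => (h a).1 hx) fun hx => (h' a).1 hx
  · rw [piFormula_zero]
    exact (realize_qfOfCode_imp ρ _ _).trans (imp_congr ((h a).2 M ρ) ((h' a).2 M ρ))

theorem IsPi.not_zero (h : IsPi 0 V R) : IsPi 0 V fun a M _ ρ => ¬ R a M ρ :=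
  h.imp_zero IsPi.false

theorem IsPi.true : IsPi 0 V fun _ _ _ _ => True :=
  IsPi.false.not_zero.congr fun _ _ _ _ => by simp

theorem IsPi.isSig_zero (h : IsPi 0 V R) : IsSig 0 V R := by
  obtain ⟨f, hf, h⟩ := h
  refine ⟨f, hf, fun a => ?_⟩
  rw [sigmaFormula_zero, ← piFormula_zero]
  exact h a

theorem IsPi.isPi_of_zero {n : ℕ} (h : IsPi 0 V R) : IsPi (n + 1) V R :=
  h.isSig_zero.isPi (by omega)

theorem isSig_rePred {n : ℕ} {P : α → Prop} (hP : REPred P) :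
    IsSig (n + 1) V fun a _ _ _ => P a :=
  (IsSig.iSup (β := Unit) (P := fun a _ => P a) ((IsPi.true (α := α × Unit)).isSig (by omega))
    (hP.comp Computable.fst)).congr fun a _ _ _ => by simp

end IsTerm

/-! #### Recursion on Gödel numbers -/

/-- Evaluation of the term with a given Gödel number in an algebra with operations `o`, `i`, `m`,
under the assignment `w`. -/
def termFold {σ : Type} (o : σ) (i : σ → σ) (m : σ → σ → σ) (w : ℕ → σ) : ℕ → σ
  | 0 => o
  | n + 1 =>
    have h₀ : n / 3 < n + 1 := by omega
    have h₁ : (n / 3).unpair.1 < n + 1 := (Nat.unpair_left_le _).trans_lt h₀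
    have h₂ : (n / 3).unpair.2 < n + 1 := (Nat.unpair_right_le _).trans_lt h₀
    if n % 3 = 0 then w (n / 3)
    else if n % 3 = 1 then i (termFold o i m w (n / 3))
    else m (termFold o i m w (n / 3).unpair.1) (termFold o i m w (n / 3).unpair.2)

/-- The truth value of the quantifier-free formula with a given Gödel number, where `q` gives the
truth values of the equations. -/
def qfFold (q : ℕ → Bool) : ℕ → Bool
  | 0 => false
  | n + 1 =>
    have h₀ : n / 2 < n + 1 := by omega
    have h₁ : (n / 2).unpair.1 < n + 1 := (Nat.unpair_left_le _).trans_lt h₀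
    have h₂ : (n / 2).unpair.2 < n + 1 := (Nat.unpair_right_le _).trans_lt h₀
    if n % 2 = 0 then q (n / 2)
    else !(qfFold q (n / 2).unpair.1) || qfFold q (n / 2).unpair.2

section Fold

variable {σ : Type} {o : σ} {i : σ → σ} {m : σ → σ → σ} {w : ℕ → σ}

theorem termFold_zero : termFold o i m w 0 = o := by
  rw [termFold]

theorem termFold_var (k : ℕ) : termFold o i m w (3 * k + 1) = w k := by
  have h : 3 * k % 3 = 0 := by omega
  have h' : 3 * k / 3 = k := by omega
  rw [termFold, if_pos h, h']

theorem termFold_inv (k : ℕ) :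
    termFold o i m w (3 * k + 1 + 1) = i (termFold o i m w k) := by
  have h : (3 * k + 1) % 3 = 1 := by omega
  have h' : (3 * k + 1) / 3 = k := by omega
  rw [termFold, if_neg (by omega), if_pos h, h']

theorem termFold_mul (a b : ℕ) : termFold o i m w (3 * Nat.pair a b + 2 + 1) =
    m (termFold o i m w a) (termFold o i m w b) := by
  have h' : (3 * Nat.pair a b + 2) / 3 = Nat.pair a b := by omega
  rw [termFold, if_neg (by omega), if_neg (by omega), h', Nat.unpair_pair]

theorem qfFold_equal (q : ℕ → Bool) (a b : ℕ) :
    qfFold q (2 * Nat.pair a b + 1) = q (Nat.pair a b) := by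
  have h' : (2 * Nat.pair a b) / 2 = Nat.pair a b := by omega
  rw [qfFold, if_pos (by omega), h']

theorem qfFold_imp (q : ℕ → Bool) (a b : ℕ) :
    qfFold q (2 * Nat.pair a b + 1 + 1) = (!(qfFold q a) || qfFold q b) := by
  have h' : (2 * Nat.pair a b + 1) / 2 = Nat.pair a b := by omega
  rw [qfFold, if_neg (by omega), h', Nat.unpair_pair]

variable {α : Type} [Primcodable α] [Primcodable σ] {i : σ → σ} {m : σ → σ → σ}

theorem Computable.ite_eq {β : Type} [Primcodable β] {f g : α → ℕ} {h h' : α → β}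
    (hf : Computable f) (hg : Computable g) (hh : Computable h) (hh' : Computable h') :
    Computable fun a => if f a = g a then h a else h' a :=
  (Computable.cond (ComputablePred.of_eq_comp hf hg).decide hh hh').of_eq fun a => by
    by_cases hfg : f a = g a <;> simp [hfg]

theorem getD_map_range {β : Type} (f : ℕ → β) (d : β) {n k : ℕ} (hk : k < n) :
    ((List.range n).map f).getD k d = f k := by
  simp [List.getD, hk]

theorem computable_termFold {W : α → ℕ → σ} (hi : Computable i)
    (hm : Computable₂ m) (hW : Computable₂ W) :
    Computable₂ fun a n => termFold o i m (W a) n := by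
  refine Computable.nat_strong_rec (g := fun (a : α) (l : List σ) => some
    (if l.length = 0 then o else
      let n := l.length - 1
      if n % 3 = 0 then W a (n / 3)
      else if n % 3 = 1 then i (l.getD (n / 3) o)
      else m (l.getD (n / 3).unpair.1 o) (l.getD (n / 3).unpair.2 o))) _ ?_ ?_
  · have hn : Primrec fun x : α × List σ => x.2.length - 1 :=
      Primrec.nat_sub.comp (Primrec.list_length.comp Primrec.snd) (Primrec.const 1)
    have hd : Primrec fun x : α × List σ => (x.2.length - 1) / 3 :=
      Primrec.nat_div.comp hn (Primrec.const 3)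
    have hr : Primrec fun x : α × List σ => (x.2.length - 1) % 3 :=
      Primrec.nat_mod.comp hn (Primrec.const 3)
    have hu : Primrec fun x : α × List σ => ((x.2.length - 1) / 3).unpair := Primrec.unpair.comp hd
    have hget : ∀ {k : α × List σ → ℕ}, Primrec k →
        Computable fun x : α × List σ => x.2.getD (k x) o := fun hk =>
      ((Primrec.list_getD o).comp Primrec.snd hk).to_comp
    refine Computable.option_some.comp (Computable.ite_eq
      (Primrec.list_length.comp Primrec.snd).to_comp (Computable.const 0) (Computable.const o)
      (Computable.ite_eq hr.to_comp (Computable.const 0) (hW.comp Computable.fst hd.to_comp)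
      (Computable.ite_eq hr.to_comp (Computable.const 1) (hi.comp (hget hd))
      (hm.comp (hget (Primrec.fst.comp hu)) (hget (Primrec.snd.comp hu))))))
  · intro a n
    rcases n with - | n
    · simp [termFold_zero]
    · have h₀ : n / 3 < n + 1 := by omega
      have h₁ : (n / 3).unpair.1 < n + 1 := (Nat.unpair_left_le _).trans_lt h₀
      have h₂ : (n / 3).unpair.2 < n + 1 := (Nat.unpair_right_le _).trans_lt h₀
      rw [termFold]
      simp only [List.length_map, List.length_range, Nat.add_sub_cancel, Nat.succ_ne_zero, if_false]
      rw [getD_map_range _ _ h₀, getD_map_range _ _ h₁, getD_map_range _ _ h₂]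

theorem computable_qfFold {Q : α → ℕ → Bool} (hQ : Computable₂ Q) :
    Computable₂ fun a n => qfFold (Q a) n := by
  refine Computable.nat_strong_rec (g := fun (a : α) (l : List Bool) => some
    (if l.length = 0 then false else
      let n := l.length - 1
      if n % 2 = 0 then Q a (n / 2)
      else !(l.getD (n / 2).unpair.1 false) || l.getD (n / 2).unpair.2 false)) _ ?_ ?_
  · have hn : Primrec fun x : α × List Bool => x.2.length - 1 :=
      Primrec.nat_sub.comp (Primrec.list_length.comp Primrec.snd) (Primrec.const 1)
    have hd : Primrec fun x : α × List Bool => (x.2.length - 1) / 2 :=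
      Primrec.nat_div.comp hn (Primrec.const 2)
    have hr : Primrec fun x : α × List Bool => (x.2.length - 1) % 2 :=
      Primrec.nat_mod.comp hn (Primrec.const 2)
    have hu : Primrec fun x : α × List Bool => ((x.2.length - 1) / 2).unpair :=
      Primrec.unpair.comp hd
    have hget : ∀ {k : α × List Bool → ℕ}, Primrec k →
        Primrec fun x : α × List Bool => x.2.getD (k x) false := fun hk =>
      (Primrec.list_getD false).comp Primrec.snd hk
    refine Computable.option_some.comp (Computable.ite_eq
      (Primrec.list_length.comp Primrec.snd).to_comp (Computable.const 0) (Computable.const false)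
      (Computable.ite_eq hr.to_comp (Computable.const 0) (hQ.comp Computable.fst hd.to_comp)
      (Primrec.or.comp (Primrec.not.comp (hget (Primrec.fst.comp hu)))
        (hget (Primrec.snd.comp hu))).to_comp))
  · intro a n
    rcases n with - | n
    · simp [qfFold]
    · have h₀ : n / 2 < n + 1 := by omega
      have h₁ : (n / 2).unpair.1 < n + 1 := (Nat.unpair_left_le _).trans_lt h₀
      have h₂ : (n / 2).unpair.2 < n + 1 := (Nat.unpair_right_le _).trans_lt h₀
      rw [qfFold]
      simp only [List.length_map, List.length_range, Nat.add_sub_cancel, Nat.succ_ne_zero, if_false]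
      rw [getD_map_range _ _ h₁, getD_map_range _ _ h₂]

end Fold

end Terms

/-! ### Subgroups of the rationals -/

section RatSubgroup

theorem primrecPred_prime : PrimrecPred Nat.Prime := by
  have h : PrimrecPred fun n : ℕ => 2 ≤ n ∧ ∀ m < n, ¬ (2 ≤ m ∧ n % m = 0) := by
    refine PrimrecPred.and (Primrec.nat_le.comp (Primrec.const 2) Primrec.id) ?_
    have h1 : PrimrecRel fun (m n : ℕ) => ¬ (2 ≤ m ∧ n % m = 0) :=
      PrimrecPred.not (PrimrecPred.and
        (Primrec.nat_le.comp (Primrec.const 2) Primrec.fst)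
        (Primrec.eq.comp (Primrec.nat_mod.comp Primrec.snd Primrec.fst) (Primrec.const 0)))
    exact h1.forall_lt_nat.comp Primrec.id Primrec.id
  refine h.of_eq fun n => ?_
  rw [Nat.prime_def_lt']
  refine and_congr_right fun _ => forall_congr' fun m => ?_
  rw [Nat.dvd_iff_mod_eq_zero]
  tauto

theorem computable_nth_prime : Computable fun i => Nat.nth Nat.Prime i := by
  have hP : ComputablePred fun x : ℕ × ℕ => x.1 < x.2 ∧ x.2.Prime :=
    PrimrecPred.computablePred
      (PrimrecPred.and (Primrec.nat_lt.comp Primrec.fst Primrec.snd)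
        (primrecPred_prime.comp Primrec.snd))
  have hex : ∀ x : ℕ, ∃ n, x < n ∧ n.Prime := fun x => by
    obtain ⟨p, hp, hp'⟩ := Nat.exists_infinite_primes (x + 1)
    exact ⟨p, hp, hp'⟩
  have hnext := Computable.find (P := fun x n => x < n ∧ n.Prime) hP hex
  have hrec : Computable fun i : ℕ => i.rec (motive := fun _ => ℕ) 2 fun _ x => Nat.find (hex x) :=
    Computable.nat_rec (h := fun _ (p : ℕ × ℕ) => Nat.find (hex p.2)) Computable.id
      (Computable.const 2) (hnext.comp (Computable.snd.comp Computable.snd))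
  refine hrec.of_eq fun i => ?_
  induction i with
  | zero => simp [Nat.nth_prime_zero_eq_two]
  | succ i ih =>
    simp only at ih ⊢
    simp only [ih]
    refine (Nat.find_eq_iff _).2 ⟨⟨?_, Nat.prime_nth_prime _⟩, fun n hn h => ?_⟩
    · exact Nat.nth_strictMono Nat.infinite_setOfPred_prime (Nat.lt_succ_self i)
    · exact absurd h.1 (not_lt.2 (Nat.le_nth_of_lt_nth_succ hn h.2))

/-- The prime `p_i`. -/
noncomputable abbrev nthPrime (i : ℕ) : ℕ := Nat.nth Nat.Prime i

theorem nthPrime_injective : Function.Injective nthPrime :=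
  Nat.nth_injective Nat.infinite_setOfPred_prime

theorem exists_nthPrime_eq {p : ℕ} (hp : p.Prime) : ∃ i, nthPrime i = p :=
  ⟨_, Nat.nth_count hp⟩

/-- All prime factors of `n` are among the primes `p_i` with `i ∈ X`. -/
def IsSmooth (X : Set ℕ) (n : ℕ) : Prop := ∀ i, nthPrime i ∣ n → i ∈ X

theorem IsSmooth.of_dvd {X : Set ℕ} {m n : ℕ} (h : IsSmooth X n) (hmn : m ∣ n) : IsSmooth X m :=
  fun i hi => h i (hi.trans hmn)

theorem IsSmooth.mul {X : Set ℕ} {m n : ℕ} (hm : IsSmooth X m) (hn : IsSmooth X n) :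
    IsSmooth X (m * n) := fun i hi =>
  ((Nat.prime_nth_prime i).dvd_mul.1 hi).elim (hm i) (hn i)

theorem isSmooth_one (X : Set ℕ) : IsSmooth X 1 := fun i hi =>
  absurd (Nat.dvd_one.1 hi) (Nat.prime_nth_prime i).one_lt.ne'

theorem isSmooth_nthPrime_iff {X : Set ℕ} {i : ℕ} : IsSmooth X (nthPrime i) ↔ i ∈ X := by
  constructor
  · exact fun h => h i dvd_rfl
  · intro h j hj
    rwa [nthPrime_injective ((Nat.prime_dvd_prime_iff_eq (Nat.prime_nth_prime j)
      (Nat.prime_nth_prime i)).1 hj)]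

theorem IsSmooth.pow {X : Set ℕ} {m : ℕ} (hm : IsSmooth X m) (k : ℕ) : IsSmooth X (m ^ k) := by
  induction k with
  | zero => exact isSmooth_one X
  | succ k ih => rw [pow_succ]; exact ih.mul hm

/-- Induction on the prime factorization of a smooth number. -/
theorem isSmooth_induction {X : Set ℕ} {P : ℕ → Prop} (h1 : P 1) (hp : ∀ i ∈ X, P (nthPrime i))
    (hmul : ∀ m n, P m → P n → P (m * n)) {n : ℕ} (hn : n ≠ 0) (h : IsSmooth X n) : P n := by
  induction n using Nat.recOnMul with
  | zero => exact absurd rfl hn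
  | one => exact h1
  | prime p hpp =>
    obtain ⟨i, rfl⟩ := exists_nthPrime_eq hpp
    exact hp i (isSmooth_nthPrime_iff.1 h)
  | mul m n ihm ihn =>
    obtain ⟨hm0, hn0⟩ := mul_ne_zero_iff.1 hn
    exact hmul m n (ihm hm0 (h.of_dvd (Dvd.intro _ rfl)))
        (ihn hn0 (h.of_dvd (Dvd.intro_left _ rfl)))

/-- The group `ℤ[1/p_i : i ∈ X]` of the fractions whose denominators have only prime factors
`p_i` with `i ∈ X`. -/
def ratSubgroup (X : Set ℕ) : AddSubgroup ℚ where
  carrier := {q | IsSmooth X q.den}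
  zero_mem' := isSmooth_one X
  add_mem' {a b} ha hb := (IsSmooth.mul ha hb).of_dvd (Rat.add_den_dvd a b)
  neg_mem' {a} ha := by simpa using ha

theorem mem_ratSubgroup {X : Set ℕ} {q : ℚ} : q ∈ ratSubgroup X ↔ IsSmooth X q.den := Iff.rfl

theorem div_mem_ratSubgroup {X : Set ℕ} {n : ℕ} (h : IsSmooth X n) (z : ℤ) :
    (z / n : ℚ) ∈ ratSubgroup X := by
  rw [mem_ratSubgroup]
  refine h.of_dvd ?_
  have := Rat.den_dvd z n
  rw [Rat.divInt_eq_div] at this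
  exact_mod_cast this

theorem one_mem_ratSubgroup (X : Set ℕ) : (1 : ℚ) ∈ ratSubgroup X := isSmooth_one X

theorem div_nat_mem_ratSubgroup {X : Set ℕ} {n : ℕ} (h : IsSmooth X n) {q : ℚ}
    (hq : q ∈ ratSubgroup X) : q / n ∈ ratSubgroup X := by
  have := div_mem_ratSubgroup (IsSmooth.mul hq h) q.num
  rwa [Nat.cast_mul, ← div_div, Rat.num_div_den] at this

theorem dividesOneIn_ratSubgroup {X : Set ℕ} {n : ℕ} :
    DividesOneIn (ratSubgroup X) n ↔ n ≠ 0 ∧ IsSmooth X n := by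
  constructor
  · rintro ⟨g, hg, hgn⟩
    have hn : n ≠ 0 := by rintro rfl; simp at hgn
    refine ⟨hn, ?_⟩
    rw [nsmul_eq_mul] at hgn
    have : g = 1 / n := by
      have : (n : ℚ) ≠ 0 := by exact_mod_cast hn
      field_simp
      linarith
    rw [mem_ratSubgroup, this] at hg
    have hden : (1 / n : ℚ).den = n := by
      rw [one_div, Rat.inv_natCast_den]
      simp [hn]
    rwa [hden] at hg
  · rintro ⟨hn, h⟩
    refine ⟨1 / n, by simpa using div_mem_ratSubgroup h 1, ?_⟩
    have : (n : ℚ) ≠ 0 := by exact_mod_cast hn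
    rw [nsmul_eq_mul]
    field_simp

theorem pInf_ratSubgroup (X : Set ℕ) : PInf (ratSubgroup X) = nthPrime '' X := by
  ext p
  simp only [PInf, dividesOneIn_ratSubgroup, Set.mem_ofPred_eq, Set.mem_image]
  constructor
  · rintro ⟨hp, h⟩
    obtain ⟨i, rfl⟩ := exists_nthPrime_eq hp
    exact ⟨i, isSmooth_nthPrime_iff.1 (by simpa using (h 1).2), rfl⟩
  · rintro ⟨i, hi, rfl⟩
    have hp := Nat.prime_nth_prime i
    exact ⟨hp, fun k => ⟨(pow_pos hp.pos k).ne', (isSmooth_nthPrime_iff.2 hi).pow k⟩⟩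

theorem pFin_ratSubgroup (X : Set ℕ) : PFin (ratSubgroup X) = ∅ := by
  ext p
  simp only [PFin, dividesOneIn_ratSubgroup, Set.mem_ofPred_eq, Set.mem_empty_iff_false, iff_false]
  rintro ⟨hp, ⟨_, h⟩, k, hk⟩
  exact hk ⟨(pow_pos hp.pos k).ne', h.pow k⟩

theorem ratSubgroup_mono {X Y : Set ℕ} (h : X ⊆ Y) : ratSubgroup X ≤ ratSubgroup Y :=
  fun _ hq i hi => h (hq i hi)

/-! #### Embeddings of groups as embeddings of structures -/

/-- An injective homomorphism of groups is an embedding of structures. -/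
def groupEmbedding {G H : Type*} [Group G] [Group H] (f : G →* H) (hf : Function.Injective f) :
    G ↪[groupLang] H where
  toFun := f
  inj' := hf
  map_fun' {n} φ x := by
    cases φ with
    | one => exact map_one f
    | inv => exact map_inv f _
    | mul => exact map_mul f _ _
  map_rel' {n} r := r.elim

/-- An isomorphism of groups is an isomorphism of structures. -/
def groupEquiv {G H : Type*} [Group G] [Group H] (f : G ≃* H) : G ≃[groupLang] H where
  toEquiv := f.toEquiv
  map_fun' {n} φ x := by
    cases φ with
    | one => exact map_one f
    | inv => exact map_inv f _
    | mul => exact map_mul f _ _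
  map_rel' {n} r := r.elim

/-- The inclusion of a group of rationals into `ℚ`, as an embedding of structures. -/
def ratInclusion (G : AddSubgroup ℚ) : Multiplicative G ↪[groupLang] Multiplicative ℚ :=
  groupEmbedding (AddMonoidHom.toMultiplicative G.subtype) Subtype.val_injective

/-! #### Arithmetic of fractions -/

/-- The fraction `(a - b) / (c + 1)` represented by a triple `(a, b, c)`. -/
def fracVal (x : ℕ × ℕ × ℕ) : ℚ := ((x.1 : ℚ) - x.2.1) / (x.2.2 + 1)

/-- Negation of fractions. -/
def fracNeg (x : ℕ × ℕ × ℕ) : ℕ × ℕ × ℕ := (x.2.1, x.1, x.2.2)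

/-- Addition of fractions. -/
def fracAdd (x y : ℕ × ℕ × ℕ) : ℕ × ℕ × ℕ :=
  (x.1 * (y.2.2 + 1) + y.1 * (x.2.2 + 1), x.2.1 * (y.2.2 + 1) + y.2.1 * (x.2.2 + 1),
    (x.2.2 + 1) * (y.2.2 + 1) - 1)

theorem fracVal_neg (x : ℕ × ℕ × ℕ) : fracVal (fracNeg x) = - fracVal x := by
  simp only [fracVal, fracNeg]
  ring

theorem fracVal_add (x y : ℕ × ℕ × ℕ) : fracVal (fracAdd x y) = fracVal x + fracVal y := by
  simp only [fracVal, fracAdd]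
  have h : (((x.2.2 + 1) * (y.2.2 + 1) - 1 : ℕ) : ℚ) + 1 = (x.2.2 + 1) * (y.2.2 + 1) := by
    have : 1 ≤ (x.2.2 + 1) * (y.2.2 + 1) := Nat.mul_pos (by omega) (by omega)
    push_cast [Nat.cast_sub this]
    ring
  rw [h]
  push_cast
  field_simp
  ring

theorem fracVal_eq_iff (x y : ℕ × ℕ × ℕ) : fracVal x = fracVal y ↔
    x.1 * (y.2.2 + 1) + y.2.1 * (x.2.2 + 1) = y.1 * (x.2.2 + 1) + x.2.1 * (y.2.2 + 1) := by
  simp only [fracVal]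
  rw [div_eq_div_iff (by positivity) (by positivity), ← Nat.cast_inj (R := ℚ)]
  push_cast
  constructor <;> intro h <;> linarith

theorem primrec_fracNeg : Primrec fracNeg :=
  (Primrec.fst.comp Primrec.snd).pair (Primrec.fst.pair (Primrec.snd.comp Primrec.snd))

theorem primrec_fracAdd : Primrec₂ fracAdd := by
  have hc : Primrec fun x : ℕ × ℕ × ℕ => x.2.2 + 1 :=
    Primrec.succ.comp (Primrec.snd.comp Primrec.snd)
  have hb : Primrec fun x : ℕ × ℕ × ℕ => x.2.1 := Primrec.fst.comp Primrec.snd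
  have hcx := hc.comp (Primrec.fst (β := ℕ × ℕ × ℕ))
  have hcy := hc.comp (Primrec.snd (α := ℕ × ℕ × ℕ))
  refine Primrec.pair ?_ (Primrec.pair ?_ ?_)
  · exact Primrec.nat_add.comp (Primrec.nat_mul.comp (Primrec.fst.comp Primrec.fst) hcy)
      (Primrec.nat_mul.comp (Primrec.fst.comp Primrec.snd) hcx)
  · exact Primrec.nat_add.comp (Primrec.nat_mul.comp (hb.comp Primrec.fst) hcy)
      (Primrec.nat_mul.comp (hb.comp Primrec.snd) hcx)
  · exact Primrec.nat_sub.comp (Primrec.nat_mul.comp hcx hcy) (Primrec.const 1)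

theorem primrecRel_fracVal_eq : PrimrecRel fun x y : ℕ × ℕ × ℕ => fracVal x = fracVal y := by
  have hc : Primrec fun x : ℕ × ℕ × ℕ => x.2.2 + 1 :=
    Primrec.succ.comp (Primrec.snd.comp Primrec.snd)
  have hb : Primrec fun x : ℕ × ℕ × ℕ => x.2.1 := Primrec.fst.comp Primrec.snd
  have hcx := hc.comp (Primrec.fst (β := ℕ × ℕ × ℕ))
  have hcy := hc.comp (Primrec.snd (α := ℕ × ℕ × ℕ))
  refine PrimrecRel.of_eq (r := fun x y : ℕ × ℕ × ℕ => x.1 * (y.2.2 + 1) + y.2.1 * (x.2.2 + 1) =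
    y.1 * (x.2.2 + 1) + x.2.1 * (y.2.2 + 1)) ?_ fun x y => (fracVal_eq_iff x y).symm
  refine Primrec.eq.comp (Primrec.nat_add.comp ?_ ?_) (Primrec.nat_add.comp ?_ ?_)
  · exact Primrec.nat_mul.comp (Primrec.fst.comp Primrec.fst) hcy
  · exact Primrec.nat_mul.comp (hb.comp Primrec.snd) hcx
  · exact Primrec.nat_mul.comp (Primrec.fst.comp Primrec.snd) hcx
  · exact Primrec.nat_mul.comp (hb.comp Primrec.fst) hcy

/-- The value of a term under an assignment of fractions. -/
def fracTerm (w : ℕ → ℕ × ℕ × ℕ) (n : ℕ) : ℕ × ℕ × ℕ := termFold (0, 0, 0) fracNeg fracAdd w n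

theorem fracVal_fracTerm (w : ℕ → ℕ × ℕ × ℕ) (n : ℕ) :
    Multiplicative.ofAdd (fracVal (fracTerm w n)) =
      (termOfCode n).realize fun x => Multiplicative.ofAdd (fracVal (w x)) := by
  unfold fracTerm
  induction n using termCode_induction with
  | one =>
    rw [termFold_zero, realize_termOfCode_zero]
    exact congrArg Multiplicative.ofAdd (by simp [fracVal])
  | var k => rw [termFold_var, realize_termOfCode_var]
  | inv k ih =>
    rw [termFold_inv, realize_termOfCode_inv, ← ih, fracVal_neg]
    rfl
  | mul a b iha ihb =>
    rw [termFold_mul, realize_termOfCode_mul, ← iha, ← ihb, fracVal_add]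
    rfl

theorem computable_fracTerm {α : Type} [Primcodable α] {W : α → ℕ → ℕ × ℕ × ℕ}
    (hW : Computable₂ W) : Computable₂ fun a n => fracTerm (W a) n :=
  computable_termFold primrec_fracNeg.to_comp primrec_fracAdd.to_comp hW

/-- The truth of quantifier-free formulas in a group of rationals is decidable, uniformly in
assignments given by fractions. -/
theorem computablePred_realize_qfOfCode {α : Type} [Primcodable α] {W : α → ℕ → ℕ × ℕ × ℕ}
    (hW : Computable₂ W) : ComputablePred fun x : α × ℕ =>
      (qfOfCode x.2).Realize fun k => Multiplicative.ofAdd (fracVal (W x.1 k)) := by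
  classical
  have hQ : Computable₂ fun (a : α) (k : ℕ) =>
      decide (fracVal (fracTerm (W a) k.unpair.1) = fracVal (fracTerm (W a) k.unpair.2)) :=
    (ComputablePred.comp (PrimrecPred.computablePred primrecRel_fracVal_eq)
      (f := fun x : α × ℕ => (fracTerm (W x.1) x.2.unpair.1, fracTerm (W x.1) x.2.unpair.2))
      (Computable.pair
        ((computable_fracTerm hW).comp Computable.fst
          (Computable.fst.comp (Computable.unpair.comp Computable.snd)))
        ((computable_fracTerm hW).comp Computable.fst
          (Computable.snd.comp (Computable.unpair.comp Computable.snd))))).decide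
  refine ComputablePred.computable_iff.2 ⟨_, computable_qfFold hQ, funext fun x => propext ?_⟩
  obtain ⟨a, n⟩ := x
  simp only
  induction n using qfCode_induction with
  | bot => exact iff_of_false (realize_qfOfCode_zero _) (by simp [qfFold])
  | equal s t =>
    rw [realize_qfOfCode_equal, qfFold_equal, ← fracVal_fracTerm, ← fracVal_fracTerm]
    simp
  | imp s t hs ht =>
    rw [realize_qfOfCode_imp, qfFold_imp, hs, ht]
    simp [imp_iff_not_or]

/-! #### Computable copies -/

/-- The groups `ℤ[1/p_i : i ∈ X a]` for a uniformly c.e. family of sets `X a` can be enumerated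
uniformly by fractions. -/
theorem exists_enumeration_ratSubgroup {α : Type} [Primcodable α] {X : α → Set ℕ}
    (hX : REPred fun x : α × ℕ => x.2 ∈ X x.1) :
    ∃ v : α → ℕ → ℕ × ℕ × ℕ, Computable₂ v ∧
      ∀ a q, q ∈ ratSubgroup (X a) ↔ ∃ n, fracVal (v a n) = q := by
  obtain ⟨u, hu, -, huX⟩ := hX.exists_stages
  -- the product of the primes enumerated by stage `s`
  let f : α → ℕ → ℕ := fun a l => if u (a, l.unpair.1) l.unpair.2 = true then
    nthPrime l.unpair.1 else 1
  let N : α → ℕ → ℕ := fun a s => s.rec (motive := fun _ => ℕ) 1 fun l y => y * f a l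
  have hf : Computable₂ f := by
    have h1 : Primrec fun x : α × ℕ => x.2.unpair.1 :=
      Primrec.fst.comp (Primrec.unpair.comp Primrec.snd)
    have h2 : Primrec fun x : α × ℕ => x.2.unpair.2 :=
      Primrec.snd.comp (Primrec.unpair.comp Primrec.snd)
    exact (Computable.cond (hu.comp (Primrec.fst.pair h1) h2).to_comp
      (computable_nth_prime.comp h1.to_comp) (Computable.const 1)).of_eq fun x => by
        cases h : u (x.1, x.2.unpair.1) x.2.unpair.2 <;> simp [f, h]
  have hN : Computable₂ N :=
    Computable.nat_rec (h := fun (x : α × ℕ) (p : ℕ × ℕ) => p.2 * f x.1 p.1)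
      Computable.snd (Computable.const 1)
      (Primrec.nat_mul.to_comp.comp (Computable.snd.comp Computable.snd)
        (hf.comp (Computable.fst.comp Computable.fst) (Computable.fst.comp Computable.snd)))
  have hNsucc : ∀ a s, N a (s + 1) = N a s * f a s := fun _ _ => rfl
  have hfs : ∀ a l, IsSmooth (X a) (f a l) := by
    intro a l
    by_cases h : u (a, l.unpair.1) l.unpair.2 = true
    · simpa [f, h] using isSmooth_nthPrime_iff.2 ((huX (a, l.unpair.1)).2 ⟨_, h⟩)
    · simpa [f, h] using isSmooth_one _
  have hNs : ∀ a s, IsSmooth (X a) (N a s) := fun a s => by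
    induction s with
    | zero => exact isSmooth_one _
    | succ s ih => rw [hNsucc]; exact ih.mul (hfs a s)
  have hpos : ∀ a s, 0 < N a s := fun a s => by
    induction s with
    | zero => exact one_pos
    | succ s ih =>
      rw [hNsucc]
      refine Nat.mul_pos ih ?_
      by_cases h : u (a, s.unpair.1) s.unpair.2 = true
      · simpa [f, h] using (Nat.prime_nth_prime _).pos
      · simp [f, h]
  have hmono : ∀ a s t, s ≤ t → N a s ∣ N a t := fun a s t hst => by
    induction t, hst using Nat.le_induction with
    | base => exact dvd_rfl
    | succ t _ ih => rw [hNsucc]; exact ih.mul_right _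
  have hdvd : ∀ a n, n ≠ 0 → IsSmooth (X a) n → ∃ s, n ∣ N a s ^ s := by
    intro a n hn h
    refine isSmooth_induction (P := fun n => ∃ s, n ∣ N a s ^ s) ⟨0, one_dvd _⟩ ?_ ?_ hn h
    · intro i hi
      obtain ⟨t, ht⟩ := (huX (a, i)).1 hi
      refine ⟨Nat.pair i t + 1, dvd_pow ?_ (by omega)⟩
      rw [hNsucc]
      exact Dvd.dvd.mul_left (by simp [f, ht]) _
    · rintro m n ⟨s, hs⟩ ⟨t, ht⟩
      refine ⟨s + t, ?_⟩
      rw [pow_add]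
      exact mul_dvd_mul (hs.trans (pow_dvd_pow_of_dvd (hmono a s _ (by omega)) s))
        (ht.trans (pow_dvd_pow_of_dvd (hmono a t _ (by omega)) t))
  have hden : ∀ a s, (((N a s ^ s - 1 : ℕ) : ℚ) + 1) = (N a s : ℚ) ^ s := fun a s => by
    have : 1 ≤ N a s ^ s := Nat.pow_pos (hpos a s)
    push_cast [Nat.cast_sub this]
    ring
  refine ⟨fun a n => (n.unpair.1, n.unpair.2.unpair.1,
    N a n.unpair.2.unpair.2 ^ n.unpair.2.unpair.2 - 1), ?_, fun a q => ⟨fun hq => ?_, ?_⟩⟩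
  · have hu2 : Computable fun x : α × ℕ => x.2.unpair.2.unpair :=
      Computable.unpair.comp (Computable.snd.comp (Computable.unpair.comp Computable.snd))
    refine Computable.pair (Computable.fst.comp (Computable.unpair.comp Computable.snd))
      (Computable.pair (Computable.fst.comp hu2) ?_)
    have hpow : Primrec₂ fun a b : ℕ => a ^ b := Primrec₂.unpaired'.1 Nat.Primrec.pow
    exact Primrec.nat_sub.to_comp.comp (hpow.to_comp.comp
      (hN.comp Computable.fst (Computable.snd.comp hu2)) (Computable.snd.comp hu2))
      (Computable.const 1)
  · obtain ⟨s, c, hc⟩ := hdvd a q.den q.den_nz hq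
    have hcp : (c : ℚ) ≠ 0 := by
      rintro h0
      rw [Nat.cast_eq_zero] at h0
      subst h0
      have := Nat.pow_pos (n := s) (hpos a s)
      omega
    refine ⟨Nat.pair (q.num.toNat * c) (Nat.pair ((-q.num).toNat * c) s), ?_⟩
    simp only [fracVal, Nat.unpair_pair, hden]
    have h1 : ((q.num.toNat : ℤ) : ℚ) - (((-q.num).toNat : ℤ) : ℚ) = q.num := by
      rw [← Int.cast_sub]
      congr 1
      omega
    have h2 : ((N a s : ℚ) ^ s) = q.den * c := by exact_mod_cast hc
    rw [h2]
    push_cast at h1 ⊢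
    rw [← sub_mul, h1, mul_div_mul_right _ _ hcp, Rat.num_div_den]
  · rintro ⟨n, rfl⟩
    simp only [fracVal, hden]
    have := div_mem_ratSubgroup ((hNs a n.unpair.2.unpair.2).pow n.unpair.2.unpair.2)
      (n.unpair.1 - n.unpair.2.unpair.1)
    push_cast at this
    exact this

theorem ComputablePred.forall_lt_nat {p : ℕ → ℕ → Prop}
    (hp : ComputablePred fun x : ℕ × ℕ => p x.1 x.2) : ComputablePred fun n => ∀ m < n, p m n := by
  obtain ⟨f, hf, hfp⟩ := ComputablePred.computable_iff.1 hp
  have hfp' : ∀ m n, p m n ↔ f (m, n) = true := fun m n => iff_of_eq (congrFun hfp (m, n))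
  have h : Computable fun x : ℕ × ℕ =>
      x.1.rec (motive := fun _ => Bool) true fun m b => b && f (m, x.2) :=
    Computable.nat_rec (h := fun (x : ℕ × ℕ) (y : ℕ × Bool) => y.2 && f (y.1, x.2)) Computable.fst
      (Computable.const true) (Primrec.and.to_comp.comp (Computable.snd.comp Computable.snd)
        (hf.comp ((Computable.fst.comp Computable.snd).pair (Computable.snd.comp Computable.fst))))
  refine ComputablePred.computable_iff.2 ⟨fun n => _, h.comp (Computable.id.pair Computable.id),
    funext fun n => propext ?_⟩
  have key : ∀ k, (∀ m < k, p m n) ↔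
      (k.rec (motive := fun _ => Bool) true fun m b => b && f (m, n)) = true := by
    intro k
    induction k with
    | zero => simp
    | succ k ih =>
      rw [Nat.forall_lt_succ_right, ih, hfp']
      simp only [Bool.and_eq_true]
  exact key n

/-- Whether all variables of a term with parameters from `ℕ` lie in a set `D`. -/
theorem termFold_and_eq_true_iff {D : Set ℕ} {d : ℕ → Bool} (hd : ∀ x, d x = true ↔ x ∈ D) (n : ℕ) :
    termFold true id (fun a b => a && b) d n = true ↔
      ∃ t : groupLang.Term D, termOfCode n = t.relabel Subtype.val := by
  induction n using termCode_induction with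
  | one =>
    rw [termFold_zero, termOfCode_zero]
    refine iff_of_true rfl ⟨Language.Term.func (L := groupLang) GroupFunc.one ![], ?_⟩
    exact congrArg _ (funext fun i => i.elim0)
  | var k =>
    rw [termFold_var, termOfCode_var, hd]
    constructor
    · exact fun h => ⟨Language.Term.var ⟨k, h⟩, rfl⟩
    · rintro ⟨t, ht⟩
      cases t with
      | var x => injection ht with ht; exact ht ▸ x.2
      | func f ts => simp [Language.Term.relabel] at ht
  | inv k ih =>
    rw [termFold_inv, termOfCode_inv, id, ih]
    constructor
    · rintro ⟨t, ht⟩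
      refine ⟨Language.Term.func (L := groupLang) GroupFunc.inv ![t], ?_⟩
      rw [ht]
      exact congrArg _ (funext fun i => by fin_cases i; rfl)
    · rintro ⟨t, ht⟩
      cases t with
      | var x => simp [Language.Term.relabel] at ht
      | func f ts =>
        injection ht with h1 h2 h3
        subst h1
        exact ⟨ts 0, congrFun (eq_of_heq h3) 0⟩
  | mul a b iha ihb =>
    rw [termFold_mul, termOfCode_mul, Bool.and_eq_true, iha, ihb]
    constructor
    · rintro ⟨⟨t, ht⟩, ⟨s, hs⟩⟩
      refine ⟨Language.Term.func (L := groupLang) GroupFunc.mul ![t, s], ?_⟩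
      rw [ht, hs]
      exact congrArg _ (funext fun i => by fin_cases i <;> rfl)
    · rintro ⟨t, ht⟩
      cases t with
      | var x => simp [Language.Term.relabel] at ht
      | func f ts =>
        injection ht with h1 h2 h3
        subst h1
        exact ⟨⟨ts 0, congrFun (eq_of_heq h3) 0⟩, ⟨ts 1, congrFun (eq_of_heq h3) 1⟩⟩

/-- The universe of the copy consists of the first numbers naming each fraction in an enumeration
of the group. -/
theorem hasComputableCopy_ratSubgroup {X : Set ℕ} (hX : REPred fun n => n ∈ X) :
    HasComputableCopy (Multiplicative (ratSubgroup X)) := by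
  classical
  obtain ⟨v, hv, hvX⟩ := exists_enumeration_ratSubgroup (α := Unit) (X := fun _ => X)
    (hX.comp Computable.snd)
  replace hvX := hvX ()
  let w : ℕ → ℕ × ℕ × ℕ := v ()
  have hw : Computable w := hv.comp (Computable.const ()) Computable.id
  let D : Set ℕ := {n | ∀ m < n, fracVal (w m) ≠ fracVal (w n)}
  have hD : ComputablePred fun n => n ∈ D := by
    refine ComputablePred.forall_lt_nat (p := fun m n => fracVal (w m) ≠ fracVal (w n)) ?_
    exact (ComputablePred.comp (PrimrecPred.computablePred primrecRel_fracVal_eq)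
      (f := fun x : ℕ × ℕ => (w x.1, w x.2))
      ((hw.comp Computable.fst).pair (hw.comp Computable.snd))).not
  let e : D ≃ Multiplicative (ratSubgroup X) := Equiv.ofBijective
    (fun n => Multiplicative.ofAdd ⟨fracVal (w n), (hvX _).2 ⟨n, rfl⟩⟩) (by
      constructor
      · intro m n h
        have h' : fracVal (w m) = fracVal (w n) := congrArg Subtype.val h
        rcases lt_trichotomy (m : ℕ) n with hlt | heq | hlt
        · exact absurd h' (n.2 m hlt)
        · exact Subtype.ext heq
        · exact absurd h'.symm (m.2 n hlt)
      · intro q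
        have hq := (hvX _).1 q.toAdd.2
        refine ⟨⟨Nat.find hq, fun m hm h => Nat.find_min hq hm (h.trans (Nat.find_spec hq))⟩, ?_⟩
        exact Subtype.ext (Nat.find_spec hq))
  let _ : groupLang.Structure D := e.symm.inducedStructure
  let E : D ≃[groupLang] Multiplicative (ratSubgroup X) := e.symm.inducedStructureEquiv.symm
  refine ⟨D, inferInstance, ?_, ⟨E⟩⟩
  have hval : ∀ (t : groupLang.Term D) (n : ℕ), termOfCode n = t.relabel Subtype.val →
      Multiplicative.ofAdd (fracVal (fracTerm w n)) = ratInclusion _ (E (t.realize id)) := by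
    intro t n h
    rw [fracVal_fracTerm, h, Language.Term.realize_relabel, ← Language.HomClass.realize_term E,
      ← Language.HomClass.realize_term (ratInclusion _)]
    rfl
  have hvars : Computable fun n =>
      termFold true id (fun a b => a && b) (fun x => decide (x ∈ D)) n :=
    (computable_termFold (α := Unit) (W := fun _ x => decide (x ∈ D)) Computable.id
      Primrec.and.to_comp (hD.decide.comp Computable.snd)).comp (Computable.const ()) Computable.id
  have hterm : Computable (fracTerm w) :=
    (computable_fracTerm hv).comp (Computable.const ()) Computable.id
  have hc : ∀ {f : ℕ × ℕ → ℕ}, Computable f → ComputablePred fun p : ℕ × ℕ =>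
      termFold true id (fun a b => a && b) (fun x => decide (x ∈ D)) (f p) = true := fun hf =>
    ComputablePred.computable_iff.2 ⟨_, hvars.comp hf, rfl⟩
  refine (((hc Computable.fst).and (hc Computable.snd)).and (ComputablePred.comp
    (PrimrecPred.computablePred primrecRel_fracVal_eq)
    (f := fun p : ℕ × ℕ => (fracTerm w p.1, fracTerm w p.2))
    ((hterm.comp Computable.fst).pair (hterm.comp Computable.snd)))).of_eq fun p => ?_
  simp only [termFold_and_eq_true_iff (D := D) (d := fun x => decide (x ∈ D)) (fun x => by simp)]
  constructor
  · rintro ⟨⟨⟨t, ht⟩, ⟨s, hs⟩⟩, h⟩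
    refine ⟨t, s, ht, hs, E.injective ((ratInclusion _).injective ?_)⟩
    rw [← hval t _ ht, ← hval s _ hs, h]
  · rintro ⟨t, s, ht, hs, h⟩
    refine ⟨⟨⟨t, ht⟩, ⟨s, hs⟩⟩, Multiplicative.ofAdd.injective ?_⟩
    rw [hval t _ ht, hval s _ hs, h]

end RatSubgroup

/-! ### Groups of rank one -/

section RankOne

variable {M : Type} [CommGroup M]

theorem zpow_eq_one_iff_of_torsionFree (htf : ∀ n (x : M), x ^ (n + 1) = 1 → x = 1) {g : M}
    (hg : g ≠ 1) {z : ℤ} (hz : g ^ z = 1) : z = 0 := by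
  by_contra h
  obtain ⟨n, hn⟩ : ∃ n, z.natAbs = n + 1 := ⟨z.natAbs - 1, by omega⟩
  refine hg (htf n g ?_)
  rw [← hn, ← zpow_natCast]
  rcases Int.natAbs_eq z with hz' | hz'
  · rwa [← hz']
  · rw [show ((z.natAbs : ℕ) : ℤ) = -z by omega, zpow_neg, hz, inv_one]

/-- A torsion-free abelian group of rank one embeds into the rationals, so that a given nontrivial
element is sent to `1`. -/
theorem exists_injective_hom_rat (htf : ∀ n (x : M), x ^ (n + 1) = 1 → x = 1)
    (hrank : ∀ x y : M, x = 1 ∨ ∃ k : ℕ × ℕ, y ^ (k.1 + 1) = x ^ k.2 ∨ y ^ (k.1 + 1) * x ^ k.2 = 1)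
    {g : M} (hg : g ≠ 1) :
    ∃ h : M →* Multiplicative ℚ, Function.Injective h ∧ h g = Multiplicative.ofAdd 1 := by
  have hex : ∀ y : M, ∃ n : ℕ, ∃ m : ℤ, y ^ (n + 1) = g ^ m := by
    intro y
    rcases hrank g y with h | ⟨⟨n, m⟩, h | h⟩
    · exact absurd h hg
    · exact ⟨n, m, by simpa using h⟩
    · exact ⟨n, -m, by simpa using eq_inv_of_mul_eq_one_left h⟩
  choose n m hnm using hex
  -- the value of `y` does not depend on the relation between `y` and `g`
  have key : ∀ (y : M) (a : ℕ) (b : ℤ), a ≠ 0 → y ^ a = g ^ b →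
      (m y : ℚ) / ((n y + 1 : ℕ) : ℚ) = b / a := by
    intro y a b ha hab
    have h1 : g ^ (b * (n y + 1 : ℕ) - m y * a) = 1 := by
      rw [zpow_sub, zpow_mul, zpow_mul, ← hab, ← hnm, zpow_natCast, zpow_natCast, ← pow_mul,
        ← pow_mul, mul_comm a (n y + 1), mul_inv_cancel]
    have h2 := zpow_eq_one_iff_of_torsionFree htf hg h1
    have ha' : (a : ℚ) ≠ 0 := by exact_mod_cast ha
    have hn' : ((n y + 1 : ℕ) : ℚ) ≠ 0 := by exact_mod_cast Nat.succ_ne_zero (n y)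
    rw [div_eq_div_iff hn' ha']
    have h3 : m y * (a : ℤ) = b * ((n y + 1 : ℕ) : ℤ) := by omega
    exact_mod_cast h3
  refine ⟨⟨⟨fun y => Multiplicative.ofAdd ((m y : ℚ) / ((n y + 1 : ℕ) : ℚ)), ?_⟩, ?_⟩, ?_, ?_⟩
  · refine congrArg Multiplicative.ofAdd ((key 1 1 0 one_ne_zero (by simp)).trans (by simp))
  · intro x y
    refine congrArg Multiplicative.ofAdd ((key (x * y) ((n x + 1) * (n y + 1))
      (m x * (n y + 1 : ℕ) + m y * (n x + 1 : ℕ)) (by positivity) ?_).trans ?_)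
    · rw [mul_pow, pow_mul, hnm x, mul_comm (n x + 1), pow_mul, hnm y, zpow_add, zpow_mul, zpow_mul,
        zpow_natCast, zpow_natCast]
    · have h1 : ((n x + 1 : ℕ) : ℚ) ≠ 0 := by exact_mod_cast Nat.succ_ne_zero (n x)
      have h2 : ((n y + 1 : ℕ) : ℚ) ≠ 0 := by exact_mod_cast Nat.succ_ne_zero (n y)
      change _ = (m x : ℚ) / ((n x + 1 : ℕ) : ℚ) + (m y : ℚ) / ((n y + 1 : ℕ) : ℚ)
      rw [div_add_div _ _ h1 h2]
      push_cast
      ring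
  · rw [injective_iff_map_eq_one]
    intro y hy
    have hy' : (m y : ℚ) / ((n y + 1 : ℕ) : ℚ) = 0 := hy
    have h2 : ((n y + 1 : ℕ) : ℚ) ≠ 0 := by exact_mod_cast Nat.succ_ne_zero (n y)
    rw [div_eq_zero_iff, or_iff_left h2, Int.cast_eq_zero] at hy'
    refine htf (n y) y ?_
    rw [hnm, hy', zpow_zero]
  · exact congrArg Multiplicative.ofAdd ((key g 1 1 one_ne_zero (by simp)).trans (by simp))

/-- A torsion-free abelian group of rank one in which every element is divisible by all `p_i` with
`i ∈ X`, and some nontrivial element is divisible by no other prime, is isomorphic to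
`ℤ[1/p_i : i ∈ X]`. -/
theorem nonempty_mulEquiv_ratSubgroup {X : Set ℕ}
    (htf : ∀ n (x : M), x ^ (n + 1) = 1 → x = 1)
    (hrank : ∀ x y : M, x = 1 ∨ ∃ k : ℕ × ℕ, y ^ (k.1 + 1) = x ^ k.2 ∨ y ^ (k.1 + 1) * x ^ k.2 = 1)
    (hdiv : ∀ i ∈ X, ∀ x : M, ∃ y, y ^ nthPrime i = x)
    {g : M} (hg : g ≠ 1) (hndiv : ∀ i ∉ X, ∀ y : M, y ^ nthPrime i ≠ g) :
    Nonempty (M ≃* Multiplicative (ratSubgroup X)) := by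
  obtain ⟨h, hinj, hg1⟩ := exists_injective_hom_rat htf hrank hg
  have hpow : ∀ (y : M) (k : ℕ), (h (y ^ k)).toAdd = k * (h y).toAdd := fun y k => by
    rw [map_pow, toAdd_pow, nsmul_eq_mul]
  have hzpow : ∀ (y : M) (k : ℤ), (h (y ^ k)).toAdd = k * (h y).toAdd := fun y k => by
    rw [map_zpow, toAdd_zpow, zsmul_eq_mul]
  have hmem : ∀ y, (h y).toAdd ∈ ratSubgroup X := by
    intro y i hi
    by_contra hiX
    set q := (h y).toAdd with hq
    obtain ⟨c, hc⟩ := hi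
    have hq0 : (q.den : ℚ) ≠ 0 := by exact_mod_cast q.den_nz
    -- by Bézout's identity, `1 / q.den` is in the image of `h`, and so is `1 / p_i`
    have hco : IsCoprime q.num (q.den : ℤ) := by
      rw [Int.isCoprime_iff_nat_coprime]
      simpa using q.reduced
    obtain ⟨a, b, hab⟩ := hco
    refine hndiv i hiX ((y ^ a * g ^ b) ^ c) (hinj (Multiplicative.toAdd.injective ?_))
    rw [← pow_mul, hpow, map_mul, toAdd_mul, hzpow, hzpow, hg1, mul_comm c, ← hc, ← hq]
    have hab' : (a : ℚ) * q.num + b * q.den = 1 := by exact_mod_cast hab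
    have hnd : q * q.den = q.num := Rat.mul_den_eq_num q
    simp only [toAdd_ofAdd]
    linear_combination hab' + a * hnd
  have hroot : ∀ k : ℕ, k ≠ 0 → IsSmooth X k → ∀ x : M, ∃ y, y ^ k = x := by
    intro k hk hks
    refine isSmooth_induction (P := fun k => ∀ x : M, ∃ y, y ^ k = x) (fun x => ⟨x, pow_one x⟩)
      hdiv ?_ hk hks
    intro k l hk hl x
    obtain ⟨y, rfl⟩ := hl x
    obtain ⟨z, rfl⟩ := hk y
    exact ⟨z, pow_mul z k l⟩
  refine ⟨MulEquiv.ofBijective (MonoidHom.mk (OneHom.mk (fun y =>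
    Multiplicative.ofAdd (⟨(h y).toAdd, hmem y⟩ : ratSubgroup X)) ?_) ?_) ⟨?_, ?_⟩⟩
  · exact congrArg Multiplicative.ofAdd (Subtype.ext (by simp))
  · exact fun x y => congrArg Multiplicative.ofAdd (Subtype.ext (by simp))
  · intro x y hxy
    exact hinj (congrArg Subtype.val hxy)
  · intro q
    obtain ⟨y, hy⟩ := hroot q.toAdd.1.den q.toAdd.1.den_nz q.toAdd.2 g
    refine ⟨y ^ q.toAdd.1.num, Subtype.ext ?_⟩
    change (h (y ^ q.toAdd.1.num)).toAdd = q.toAdd.1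
    have hy' : (q.toAdd.1.den : ℚ) * (h y).toAdd = 1 := by rw [← hpow, hy, hg1]; rfl
    have hq0 : (q.toAdd.1.den : ℚ) ≠ 0 := by exact_mod_cast q.toAdd.1.den_nz
    rw [hzpow, eq_div_of_mul_eq hq0 ((mul_comm _ _).trans hy'), mul_one_div, Rat.num_div_den]

/-- If `g` has finite height at all primes `p_i` with `i ∉ X`, and height zero at almost all of
them, then some root of `g` has height zero at all of them. -/
theorem exists_root_not_divisible {X : Set ℕ} {g : M} (hg : g ≠ 1)
    (hfin : ∀ i ∉ X, ∃ k, ∀ y : M, y ^ nthPrime i ^ k ≠ g) {F : Set ℕ} (hF : F.Finite)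
    (hdiv : ∀ i ∉ X, ∀ y : M, y ^ nthPrime i = g → i ∈ F) :
    ∃ g' : M, g' ≠ 1 ∧ ∀ i ∉ X, ∀ y : M, y ^ nthPrime i ≠ g' := by
  induction F, hF using Set.Finite.induction_on generalizing g with
  | empty => exact ⟨g, hg, fun i hi y hy => hdiv i hi y hy⟩
  | @insert i F hi hF ih =>
    by_cases hiX : i ∈ X
    · refine ih hg hfin fun j hj y hy => ?_
      rcases hdiv j hj y hy with rfl | h
      · exact absurd hiX hj
      · exact h
    · classical
      have hex := hfin i hiX
      have hpos : Nat.find hex ≠ 0 := by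
        intro h0
        have := Nat.find_spec hex g
        rw [h0] at this
        simp at this
      obtain ⟨k, hk⟩ := Nat.exists_eq_succ_of_ne_zero hpos
      have hk1 : ∃ y : M, y ^ nthPrime i ^ k = g := by
        have := Nat.find_min hex (m := k) (by omega)
        push Not at this
        exact this
      obtain ⟨y, hy⟩ := hk1
      have hk2 : ∀ z : M, z ^ nthPrime i ≠ y := by
        rintro z rfl
        have := Nat.find_spec hex z
        rw [hk, Nat.succ_eq_add_one, pow_succ', pow_mul] at this
        exact this hy
      refine ih (g := y) ?_ ?_ ?_
      · rintro rfl
        exact hg (by rw [← hy, one_pow])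
      · intro j hj
        obtain ⟨l, hl⟩ := hfin j hj
        refine ⟨l, fun z hz => hl (z ^ nthPrime i ^ k) ?_⟩
        rw [← hy, ← hz, ← pow_mul, ← pow_mul, mul_comm]
      · intro j hj z hz
        have := hdiv j hj (z ^ nthPrime i ^ k) (by
          rw [← hy, ← hz, ← pow_mul, ← pow_mul, mul_comm])
        rcases this with rfl | h
        · exact absurd hz (hk2 z)
        · exact h

end RankOne

/-! ### The axioms of torsion-free abelian groups of rank one -/

section Axioms

/-- The structure `M` is a torsion-free abelian group of rank at most one, in which every element is
divisible by the primes `p_i` with `i ∈ X`. -/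
structure IsRankOneDivisible (X : Set ℕ) (M : Type) [groupLang.Structure M] : Prop where
  assoc : ∀ x y z : M, opMul (opMul x y) z = opMul x (opMul y z)
  one_mul : ∀ x : M, opMul (opOne M) x = x
  inv_mul : ∀ x : M, opMul (opInv x) x = opOne M
  comm : ∀ x y : M, opMul x y = opMul y x
  torsionFree : ∀ n, ∀ x : M, opPow x (n + 1) = opOne M → x = opOne M
  rank : ∀ x y : M, x = opOne M ∨ ∃ k : ℕ × ℕ, opPow y (k.1 + 1) = opPow x k.2 ∨
    opMul (opPow y (k.1 + 1)) (opPow x k.2) = opOne M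
  divisible : ∀ i ∈ X, ∀ x : M, ∃ y, opPow y (nthPrime i) = x

theorem opPow_eq_pow {G : Type} [Group G] (x : G) (n : ℕ) : opPow x n = x ^ n := by
  induction n with
  | zero => exact (pow_zero x).symm
  | succ n ih => rw [opPow, ih, pow_succ']; rfl

theorem IsRankOneDivisible.exists_commGroup {X : Set ℕ} {M : Type} [S : groupLang.Structure M]
    (h : IsRankOneDivisible X M) : ∃ _ : CommGroup M, S = groupStructure M := by
  let : Mul M := ⟨opMul⟩
  let : Inv M := ⟨opInv⟩
  let : One M := ⟨opOne M⟩
  let : Group M := Group.ofLeftAxioms h.assoc h.one_mul h.inv_mul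
  refine ⟨{ (inferInstance : Group M) with mul_comm := h.comm }, ?_⟩
  refine Language.Structure.ext ?_ ?_
  · funext n φ x
    cases φ with
    | one =>
      exact congrArg (S.funMap (n := 0) GroupFunc.one) (funext fun i => i.elim0 : x = ![])
    | inv =>
      exact congrArg (S.funMap (n := 1) GroupFunc.inv)
        (funext fun i => by fin_cases i; rfl : x = ![x 0])
    | mul =>
      exact congrArg (S.funMap (n := 2) GroupFunc.mul)
        (funext fun i => by fin_cases i <;> rfl : x = ![x 0, x 1])
  · funext n r
    exact r.elim

theorem IsRankOneDivisible.nonempty_equiv {X : Set ℕ} {M : Type} [S : groupLang.Structure M]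
    (h : IsRankOneDivisible X M) {g : M} (hg : g ≠ opOne M)
    (hndiv : ∀ i ∉ X, ∀ y : M, opPow y (nthPrime i) ≠ g) :
    Nonempty (M ≃[groupLang] Multiplicative (ratSubgroup X)) := by
  obtain ⟨_, rfl⟩ := h.exists_commGroup
  obtain ⟨e⟩ := nonempty_mulEquiv_ratSubgroup (M := M) (X := X)
    (fun n x => opPow_eq_pow x (n + 1) ▸ h.torsionFree n x)
    (fun x y => by
      have := h.rank x y
      simp only [opPow_eq_pow] at this
      exact this)
    (fun i hi x => by simpa only [opPow_eq_pow] using h.divisible i hi x) hg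
    (fun i hi y => by simpa only [opPow_eq_pow] using hndiv i hi y)
  exact ⟨groupEquiv e⟩

theorem IsRankOneDivisible.nonempty_equiv_of_finite {X : Set ℕ} {M : Type}
    [S : groupLang.Structure M] (h : IsRankOneDivisible X M) {g : M} (hg : g ≠ opOne M)
    (hfin : ∀ i ∉ X, ∃ k, ∀ y : M, opPow y (nthPrime i ^ k) ≠ g)
    (hF : {i | i ∉ X ∧ ∃ y : M, opPow y (nthPrime i) = g}.Finite) :
    Nonempty (M ≃[groupLang] Multiplicative (ratSubgroup X)) := by
  obtain ⟨_, rfl⟩ := h.exists_commGroup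
  obtain ⟨g', hg', hndiv⟩ := exists_root_not_divisible (M := M) hg
    (fun i hi => by simpa only [opPow_eq_pow] using hfin i hi) hF
    (fun i hi y hy => ⟨hi, y, by rwa [opPow_eq_pow]⟩)
  exact h.nonempty_equiv hg' fun i hi y => by simpa only [opPow_eq_pow] using hndiv i hi y

variable {X : Set ℕ}

theorem opPow_ratSubgroup (y : Multiplicative (ratSubgroup X)) (n : ℕ) :
    ((opPow y n).toAdd : ℚ) = n * (y.toAdd : ℚ) := by
  rw [opPow_eq_pow, toAdd_pow, AddSubgroup.coe_nsmul, nsmul_eq_mul]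

theorem isRankOneDivisible_ratSubgroup (X : Set ℕ) :
    IsRankOneDivisible X (Multiplicative (ratSubgroup X)) where
  assoc x y z := mul_assoc x y z
  one_mul x := one_mul x
  inv_mul x := inv_mul_cancel x
  comm x y := mul_comm x y
  torsionFree n x hx := by
    have h := congrArg (fun q : Multiplicative (ratSubgroup X) => (q.toAdd : ℚ)) hx
    simp only [opPow_ratSubgroup] at h
    have h' : ((n + 1 : ℕ) : ℚ) * (x.toAdd : ℚ) = 0 := h
    rw [mul_eq_zero, or_iff_right (by exact_mod_cast Nat.succ_ne_zero n)] at h'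
    exact Subtype.ext h'
  rank x y := by
    by_cases hx : x = 1
    · exact Or.inl hx
    right
    have hx0 : (x.toAdd : ℚ) ≠ 0 := fun h => hx (Subtype.ext h)
    have hq : ((y.toAdd : ℚ) / (x.toAdd : ℚ)).den * (y.toAdd : ℚ) =
        ((y.toAdd : ℚ) / (x.toAdd : ℚ)).num * (x.toAdd : ℚ) := by
      have h1 := Rat.mul_den_eq_num ((y.toAdd : ℚ) / (x.toAdd : ℚ))
      rw [← h1]
      field_simp
    generalize hqq : (y.toAdd : ℚ) / (x.toAdd : ℚ) = q at hq
    obtain ⟨d, hd⟩ := Nat.exists_eq_succ_of_ne_zero q.den_nz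
    refine ⟨(d, q.num.natAbs), ?_⟩
    rcases Int.natAbs_eq q.num with h | h
    · left
      refine Subtype.ext ?_
      change ((opPow y (d + 1)).toAdd : ℚ) = ((opPow x q.num.natAbs).toAdd : ℚ)
      rw [opPow_ratSubgroup, opPow_ratSubgroup, ← Nat.succ_eq_add_one, ← hd, hq]
      exact congrArg (· * _) ((congrArg Int.cast h).trans (Int.cast_natCast _))
    · right
      refine Subtype.ext ?_
      change ((opPow y (d + 1)).toAdd : ℚ) + ((opPow x q.num.natAbs).toAdd : ℚ) = 0
      rw [opPow_ratSubgroup, opPow_ratSubgroup, ← Nat.succ_eq_add_one, ← hd, hq, ← add_mul]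
      have : (q.num : ℚ) + (q.num.natAbs : ℚ) = 0 := by
        rw [congrArg (Int.cast : ℤ → ℚ) h, Int.cast_neg, Int.cast_natCast, neg_add_cancel]
      rw [this, zero_mul]
  divisible i hi x := by
    have hp : (nthPrime i : ℚ) ≠ 0 := by exact_mod_cast (Nat.prime_nth_prime i).ne_zero
    refine ⟨Multiplicative.ofAdd ⟨(x.toAdd : ℚ) / nthPrime i,
      div_nat_mem_ratSubgroup (isSmooth_nthPrime_iff.2 hi) x.toAdd.2⟩, Subtype.ext ?_⟩
    refine (opPow_ratSubgroup _ _).trans ?_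
    simp only [toAdd_ofAdd]
    exact mul_div_cancel₀ _ hp

/-- If a fraction is divisible by `p_i ^ k` in `ℤ[1/p_j : j ∈ X]` and `i ∉ X`, then `p_i ^ k`
divides its numerator. -/
theorem dvd_num_of_opPow_eq {g y : Multiplicative (ratSubgroup X)} {i : ℕ} (hi : i ∉ X) {k : ℕ}
    (h : opPow y (nthPrime i ^ k) = g) : nthPrime i ^ k ∣ (g.toAdd : ℚ).num.natAbs := by
  have h1 : ((nthPrime i ^ k : ℕ) : ℚ) * (y.toAdd : ℚ) = (g.toAdd : ℚ) := by
    rw [← h, opPow_ratSubgroup]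
  have hy := y.toAdd.2
  generalize (y.toAdd : ℚ) = a at h1 hy
  generalize (g.toAdd : ℚ) = b at h1
  have h2 : ((nthPrime i ^ k : ℕ) : ℤ) * a.num * b.den = b.num * a.den := by
    have ha : (a.den : ℚ) ≠ 0 := by exact_mod_cast a.den_nz
    have hb : (b.den : ℚ) ≠ 0 := by exact_mod_cast b.den_nz
    have : ((nthPrime i ^ k : ℕ) : ℚ) * a.num * b.den = b.num * a.den := by
      rw [← Rat.mul_den_eq_num a, ← Rat.mul_den_eq_num b, ← h1]
      ring
    exact_mod_cast this
  have h3 : nthPrime i ^ k ∣ b.num.natAbs * a.den := by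
    have := congrArg Int.natAbs h2
    rw [Int.natAbs_mul, Int.natAbs_mul, Int.natAbs_mul, Int.natAbs_natCast, Int.natAbs_natCast,
      Int.natAbs_natCast, mul_assoc] at this
    exact ⟨_, this.symm⟩
  refine Nat.Coprime.dvd_of_dvd_mul_right (Nat.Coprime.pow_left k ?_) h3
  rw [(Nat.prime_nth_prime i).coprime_iff_not_dvd]
  exact fun hd => hi (hy i hd)

theorem num_natAbs_ne_zero {g : Multiplicative (ratSubgroup X)} (hg : g ≠ opOne _) :
    (g.toAdd : ℚ).num.natAbs ≠ 0 := by
  intro h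
  rw [Int.natAbs_eq_zero, Rat.num_eq_zero] at h
  exact hg (Subtype.ext h)

theorem finite_divisors_ratSubgroup {g : Multiplicative (ratSubgroup X)} (hg : g ≠ opOne _) :
    {i | i ∉ X ∧ ∃ y, opPow y (nthPrime i) = g}.Finite := by
  refine Set.Finite.of_finite_image (f := nthPrime) (Set.Finite.subset
    (Nat.divisors (g.toAdd : ℚ).num.natAbs).finite_toSet ?_) nthPrime_injective.injOn
  rintro _ ⟨i, ⟨hi, y, hy⟩, rfl⟩
  rw [Finset.mem_coe, Nat.mem_divisors]
  exact ⟨by simpa using dvd_num_of_opPow_eq (k := 1) hi (by simpa using hy), num_natAbs_ne_zero hg⟩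

theorem exists_height_ratSubgroup {g : Multiplicative (ratSubgroup X)} (hg : g ≠ opOne _) {i : ℕ}
    (hi : i ∉ X) : ∃ k, ∀ y, opPow y (nthPrime i ^ k) ≠ g := by
  refine ⟨(g.toAdd : ℚ).num.natAbs, fun y hy => ?_⟩
  have h1 := Nat.le_of_dvd (Nat.pos_of_ne_zero (num_natAbs_ne_zero hg)) (dvd_num_of_opPow_eq hi hy)
  exact absurd (Nat.lt_pow_self (Nat.prime_nth_prime i).one_lt) (not_lt.2 h1)

end Axioms

/-! ### Computable infinitary sentences for groups of rank one -/

section Sentences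

variable {α : Type} [Primcodable α] {n : ℕ}

theorem rePred_true : REPred fun _ : α => True :=
  (ComputablePred.of_eq_comp (Computable.const 0) (Computable.const 0)).to_re.of_eq
    fun _ => by simp

/-- A variable as a term, when the free variables are among the first `k`. -/
theorem isTerm_var_lt {k : ℕ} (j : ℕ) (hj : j < k) :
    IsTerm (fun _ : α => Set.Iio k) fun _ _ _ ρ => ρ j :=
  IsTerm.var (Computable.const j) fun _ => hj

theorem isPi_isRankOneDivisible {X : Set ℕ} (hX : REPred fun i => i ∈ X) (k : ℕ) :
    IsPi (n + 2) (fun _ : α => Set.Iio k) fun _ M _ _ => IsRankOneDivisible X M := by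
  have v : ∀ {γ : Type} [Primcodable γ] {l : ℕ} (j : ℕ), j < l →
      IsTerm (fun _ : γ => Set.Iio l) fun _ _ _ ρ => ρ j := fun j hj => isTerm_var_lt j hj
  have hassoc : IsPi (n + 2) (fun _ : α => Set.Iio k) fun _ M _ _ =>
      ∀ x y z : M, opMul (opMul x y) z = opMul x (opMul y z) :=
    ((((((v k (by omega)).mul (v (k + 1) (by omega))).mul (v (k + 2) (by omega))).equal
      ((v k (by omega)).mul ((v (k + 1) (by omega)).mul (v (k + 2) (by omega))))).isPi_of_zero
      (n := n + 1)).all (k := k + 2)).all.all.congr fun _ _ _ _ => by simp [Function.update]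
  have hone : IsPi (n + 2) (fun _ : α => Set.Iio k) fun _ M _ _ =>
      ∀ x : M, opMul (opOne M) x = x :=
    (((IsTerm.one.mul (v k (by omega))).equal (v k (by omega))).isPi_of_zero
      (n := n + 1)).all.congr fun _ _ _ _ => by simp [Function.update]
  have hinv : IsPi (n + 2) (fun _ : α => Set.Iio k) fun _ M _ _ =>
      ∀ x : M, opMul (opInv x) x = opOne M :=
    ((((v k (by omega)).inv.mul (v k (by omega))).equal IsTerm.one).isPi_of_zero
      (n := n + 1)).all.congr fun _ _ _ _ => by simp [Function.update]
  have hcomm : IsPi (n + 2) (fun _ : α => Set.Iio k) fun _ M _ _ =>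
      ∀ x y : M, opMul x y = opMul y x :=
    (((((v k (by omega)).mul (v (k + 1) (by omega))).equal
      ((v (k + 1) (by omega)).mul (v k (by omega)))).isPi_of_zero
      (n := n + 1)).all (k := k + 1)).all.congr fun _ _ _ _ => by simp [Function.update]
  have htf : IsPi (n + 2) (fun _ : α => Set.Iio k) fun _ M _ _ =>
      ∀ n, ∀ x : M, opPow x (n + 1) = opOne M → x = opOne M :=
    (IsPi.iInf (β := ℕ) (P := fun _ _ => True) (((((v k (by omega)).pow
      (Computable.succ.comp (Computable.snd (α := α)))).equal IsTerm.one).imp_zero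
      ((v k (by omega)).equal IsTerm.one)).isPi_of_zero (n := n + 1)).all
      rePred_true).congr fun _ _ _ _ => by simp [Function.update]
  have hrank : IsPi (n + 2) (fun _ : α => Set.Iio k) fun _ M _ _ =>
      ∀ x y : M, x = opOne M ∨ ∃ k : ℕ × ℕ, opPow y (k.1 + 1) = opPow x k.2 ∨
        opMul (opPow y (k.1 + 1)) (opPow x k.2) = opOne M := by
    have h1 : IsTerm (fun _ : α × (ℕ × ℕ) => Set.Iio (k + 2))
        fun a _ _ ρ => opPow (ρ (k + 1)) (a.2.1 + 1) :=
      (v (k + 1) (by omega)).pow (Computable.succ.comp (Computable.fst.comp Computable.snd))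
    have h2 : IsTerm (fun _ : α × (ℕ × ℕ) => Set.Iio (k + 2))
        fun a _ _ ρ => opPow (ρ k) a.2.2 :=
      (v k (by omega)).pow (Computable.snd.comp Computable.snd)
    have h3 : IsSig (n + 1) (fun _ : α × (ℕ × ℕ) => Set.Iio (k + 2)) _ :=
      ((h1.equal h2).isSig (by omega)).or (((h1.mul h2).equal IsTerm.one).isSig (by omega))
    have h4 : IsSig (n + 1) (fun _ : α => Set.Iio (k + 2)) _ :=
      (((v k (by omega)).equal IsTerm.one).isSig (by omega)).or
      (h3.iSup (V := fun _ => Set.Iio (k + 2)) (P := fun _ _ => True)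
      rePred_true)
    exact ((h4.isPi (n := n + 1) (by omega)).all (k := k + 1)).all.congr
      fun _ _ _ _ => by simp [Function.update]
  have hdiv : IsPi (n + 2) (fun _ : α => Set.Iio k) fun _ M _ _ =>
      ∀ i ∈ X, ∀ x : M, ∃ y, opPow y (nthPrime i) = x := by
    have h1 : IsSig (n + 1) (fun _ : α × ℕ => Set.Iio (k + 2))
        fun a _ _ ρ => opPow (ρ (k + 1)) (nthPrime a.2) = ρ k :=
      (((v (k + 1) (by omega)).pow (computable_nth_prime.comp Computable.snd)).equal
        (v k (by omega))).isSig (by omega)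
    exact (IsPi.iInf (P := fun _ i => i ∈ X) ((h1.ex (k := k + 1)).isPi (n := n + 1) (by omega)).all
      (hX.comp Computable.snd)).congr fun _ _ _ _ => by simp [Function.update]
  refine (hassoc.and (hone.and (hinv.and (hcomm.and (htf.and (hrank.and hdiv)))))).congr
    fun _ M _ _ => ⟨?_, fun h => ⟨h.1, h.2, h.3, h.4, h.5, h.6, h.7⟩⟩
  rintro ⟨h1, h2, h3, h4, h5, h6, h7⟩
  exact ⟨h1, h2, h3, h4, h5, h6, h7⟩

/-- To show that a sentence expressing the property `R` of structures is a pseudo-Scott sentence of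
`A`, it suffices that `A` has the property, and that computable structures with the property are
isomorphic to `A`. -/
theorem isPseudoScott_of {φ : InfFormula groupLang}
    {R : (M : Type) → [groupLang.Structure M] → Prop}
    (hφ : φ.freeVars ⊆ Set.Iio 0)
    (hR : ∀ (M : Type) [groupLang.Structure M] (ρ : ℕ → M), φ.Realize ρ ↔ R M)
    {A : Type} [groupLang.Structure A] (hA : R A)
    (hiso : ∀ (D : Set ℕ) [groupLang.Structure D], IsComputableStructure D → R D →
      Nonempty (D ≃[groupLang] A)) : IsPseudoScott φ A := by
  refine ⟨Set.eq_empty_of_forall_notMem fun x hx => by simpa using hφ hx, fun D _ hD => ?_⟩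
  constructor
  · exact fun h => hiso D hD ((hR D _).1 (h fun _ => opOne D))
  · rintro ⟨e⟩
    exact InfFormula.HoldsIn.of_equiv (M := A) e.symm fun ρ => (hR A ρ).2 hA

theorem hasSigmaPseudoScott_ratSubgroup {X : Set ℕ} (hX : REPred fun i => i ∈ X) :
    HasSigmaPseudoScott 3 (Multiplicative (ratSubgroup X)) := by
  have h1 : IsSig 1 (fun _ : Unit × ℕ => Set.Iio 2) fun a _ _ ρ =>
      a.2 ∈ X ∨ ¬ opPow (ρ 1) (nthPrime a.2) = ρ 0 :=
    (isSig_rePred (hX.comp Computable.snd)).or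
      ((((isTerm_var_lt 1 (by omega)).pow (computable_nth_prime.comp Computable.snd)).equal
        (isTerm_var_lt 0 (by omega))).not_zero.isSig (by omega))
  have h2 : IsPi 2 (fun _ : Unit => Set.Iio 1) _ :=
    IsPi.iInf (P := fun _ _ => True) ((h1.isPi (n := 1) (by omega)).all (k := 1))
      rePred_true
  have h3 : IsPi 2 (fun _ : Unit => Set.Iio 1) fun _ M _ ρ => ¬ ρ 0 = opOne M :=
    ((isTerm_var_lt 0 (by omega)).equal IsTerm.one).not_zero.isPi_of_zero
  obtain ⟨f, -, hf⟩ := ((((isPi_isRankOneDivisible hX 1).and (h3.and h2)).isSig (n := 2)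
    (by omega)).ex (k := 0)).congr (R' := fun _ M _ _ => IsRankOneDivisible X M ∧
      ∃ g : M, g ≠ opOne M ∧ ∀ i, ∀ y : M, i ∉ X → opPow y (nthPrime i) ≠ g) fun _ M _ ρ => by
    simp [Function.update, or_iff_not_imp_left]
  refine ⟨_, ⟨f (), rfl⟩, isPseudoScott_of (hf ()).1 (hf ()).2
    ⟨isRankOneDivisible_ratSubgroup X, Multiplicative.ofAdd ⟨1, one_mem_ratSubgroup X⟩, ?_, ?_⟩ ?_⟩
  · exact fun h => one_ne_zero (α := ℚ) (congrArg Subtype.val h)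
  · intro i y hi hy
    have := dvd_num_of_opPow_eq (k := 1) hi (by simpa using hy)
    simp [Nat.dvd_one, (Nat.prime_nth_prime i).ne_one] at this
  · rintro D _ - ⟨hD, g, hg, hdiv⟩
    exact hD.nonempty_equiv hg fun i hi y => hdiv i y hi

/-! #### Divisibility in computable structures -/

theorem exists_relabel_eq {D : Set ℕ} (t : groupLang.Term ℕ) (ht : ↑t.varFinset ⊆ D) :
    ∃ t' : groupLang.Term D, t = t'.relabel Subtype.val :=
  ⟨t.restrictVar (Set.inclusion ht), by
    induction t with
    | var k => rfl
    | func f ts ih =>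
      refine congrArg (Language.Term.func f) (funext fun i => ?_)
      exact ih i fun x hx =>
        ht (Finset.mem_coe.2 (Finset.mem_biUnion.2 ⟨i, Finset.mem_univ i, hx⟩))⟩

theorem realize_eq_of_mem_atomicDiagram {D : Set ℕ} [groupLang.Structure D] {p : ℕ × ℕ}
    (hp : p ∈ atomicDiagram D) {ρ : ℕ → D} (hρ : ∀ d : D, ρ d = d) :
    (termOfCode p.1).realize ρ = (termOfCode p.2).realize ρ := by
  obtain ⟨t, s, ht, hs, h⟩ := hp
  have hid : ρ ∘ Subtype.val = id := funext hρ
  rw [ht, hs, Language.Term.realize_relabel, Language.Term.realize_relabel, hid, h]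

theorem mem_atomicDiagram_of_realize_eq {D : Set ℕ} [groupLang.Structure D] {p : ℕ × ℕ}
    (h1 : ↑(termOfCode p.1).varFinset ⊆ D) (h2 : ↑(termOfCode p.2).varFinset ⊆ D)
    {ρ : ℕ → D} (hρ : ∀ d : D, ρ d = d)
    (h : (termOfCode p.1).realize ρ = (termOfCode p.2).realize ρ) : p ∈ atomicDiagram D := by
  obtain ⟨t, ht⟩ := exists_relabel_eq _ h1
  obtain ⟨s, hs⟩ := exists_relabel_eq _ h2
  have hid : ρ ∘ Subtype.val = id := funext hρ
  rw [ht, hs, Language.Term.realize_relabel, Language.Term.realize_relabel, hid] at h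
  exact ⟨t, s, ht, hs, h⟩

/-- The indices of the primes dividing a given element of a computable structure form a c.e. set. -/
theorem IsComputableStructure.rePred_divides {D : Set ℕ} [groupLang.Structure D]
    (hD : IsComputableStructure D) (g : D) : REPred fun i => ∃ y : D, opPow y (nthPrime i) = g := by
  classical
  obtain ⟨f, hf, hfp⟩ : IsTerm (fun a : ℕ × ℕ => {a.1}) fun a _ _ ρ => opPow (ρ a.1) a.2 :=
    (IsTerm.var Computable.fst fun _ => Set.mem_singleton _).pow Computable.snd
  obtain ⟨f', hf', hfp'⟩ : IsTerm (fun a : ℕ => {a}) fun a _ _ ρ => ρ a :=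
    IsTerm.var Computable.id fun _ => Set.mem_singleton _
  let ρ : ℕ → D := fun x => if h : x ∈ D then ⟨x, h⟩ else g
  have hρ : ∀ d : D, ρ d = d := fun d => by simp [ρ]
  refine (REPred.exists (p := fun i d => (f' d, f' d) ∈ atomicDiagram D ∧
    (f (d, nthPrime i), f' g) ∈ atomicDiagram D) (ComputablePred.to_re
      ((ComputablePred.comp hD ?_).and (ComputablePred.comp hD ?_)))).of_eq fun i => ?_
  · exact (hf'.comp Computable.snd).pair (hf'.comp Computable.snd)
  · exact (hf.comp (Computable.snd.pair (computable_nth_prime.comp Computable.fst))).pair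
      (Computable.const _)
  constructor
  · rintro ⟨d, -, h⟩
    have := realize_eq_of_mem_atomicDiagram h hρ
    simp only [(hfp _).2, (hfp' _).2, hρ] at this
    exact ⟨_, this⟩
  · rintro ⟨d, hd⟩
    have hdD : ∀ d : D, ({(d : ℕ)} : Set ℕ) ⊆ D := fun d => Set.singleton_subset_iff.2 d.2
    refine ⟨d, mem_atomicDiagram_of_realize_eq ((hfp' _).1.trans (hdD d))
      ((hfp' _).1.trans (hdD d)) hρ rfl, mem_atomicDiagram_of_realize_eq
        ((hfp _).1.trans (hdD d)) ((hfp' _).1.trans (hdD g)) hρ ?_⟩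
    simp only [(hfp _).2, (hfp' _).2, hρ]
    exact hd

theorem isSig_eq_one : IsSig (n + 1) (fun _ : α => Set.Iio 1) fun _ M _ ρ => ρ 0 = opOne M :=
  ((isTerm_var_lt 0 (by omega)).equal IsTerm.one).isSig (by omega)

/-- Every nontrivial element has finite height at all primes `p_i` with `i ∉ X`. -/
theorem isPi_finite_height {X : Set ℕ} (hX : REPred fun i => i ∈ X) :
    IsPi 3 (fun _ : Unit => Set.Iio 0) fun _ M _ _ => ∀ g : M, ∀ i, g = opOne M ∨ i ∈ X ∨
    ∃ k, ∀ y : M, opPow y (nthPrime i ^ k) ≠ g := by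
  have hpow : Computable fun a : (Unit × ℕ) × ℕ => nthPrime a.1.2 ^ a.2 :=
    (Primrec₂.unpaired'.1 Nat.Primrec.pow).to_comp.comp
      (computable_nth_prime.comp (Computable.snd.comp Computable.fst)) Computable.snd
  have h : IsPi 1 (fun _ : (Unit × ℕ) × ℕ => Set.Iio 2) fun a _ _ ρ =>
      ¬ opPow (ρ 1) (nthPrime a.1.2 ^ a.2) = ρ 0 :=
    (((isTerm_var_lt 1 (by omega)).pow hpow).equal
      (isTerm_var_lt 0 (by omega))).not_zero.isPi_of_zero
  have h' : IsSig 2 (fun _ : Unit × ℕ => Set.Iio 1) _ := isSig_eq_one.or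
    ((isSig_rePred (hX.comp Computable.snd)).or (IsSig.iSup (P := fun _ _ => True)
      ((h.all (k := 1)).isSig (n := 1) (by omega)) rePred_true))
  exact ((IsPi.iInf (P := fun _ _ => True) (V := fun _ => Set.Iio 1)
    (h'.isPi (n := 2) (by omega)) rePred_true).all (k := 0)).congr
      fun _ _ _ _ => by simp [Function.update]

/-- No infinite `S n` consists of indices of primes dividing a nontrivial element. -/
theorem isPi_not_divisible_of_infinite {S : ℕ → Set ℕ}
    (hS : REPred fun p : ℕ × ℕ => p.2 ∈ S p.1) :
    IsPi 3 (fun _ : Unit => Set.Iio 0) fun _ M _ _ => ∀ g : M, ∀ n, g = opOne M ∨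
    (∃ m, ∀ s, (s ∈ S n ∧ m ≤ s) → False) ∨
    ∃ s, s ∈ S n ∧ ∀ y : M, opPow y (nthPrime s) ≠ g := by
  have h : IsPi 1 (fun _ : (Unit × ℕ) × ℕ => Set.Iio 2) fun a _ _ ρ =>
      ¬ opPow (ρ 1) (nthPrime a.2) = ρ 0 :=
    (((isTerm_var_lt 1 (by omega)).pow (computable_nth_prime.comp Computable.snd)).equal
      (isTerm_var_lt 0 (by omega))).not_zero.isPi_of_zero
  have hmem : REPred fun x : ((Unit × ℕ) × ℕ) × ℕ => x.2 ∈ S x.1.1.2 :=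
    hS.comp (f := fun x : ((Unit × ℕ) × ℕ) × ℕ => (x.1.1.2, x.2))
      ((Computable.snd.comp (Computable.fst.comp Computable.fst)).pair Computable.snd)
  have hle : REPred fun x : ((Unit × ℕ) × ℕ) × ℕ => x.1.2 ≤ x.2 :=
    (PrimrecPred.computablePred
      (Primrec.nat_le.comp (Primrec.snd.comp Primrec.fst) Primrec.snd)).to_re
  have hfin : IsPi 1 (fun _ : (Unit × ℕ) × ℕ => Set.Iio 1) fun a _ _ _ =>
      ∀ s, (s ∈ S a.1.2 ∧ a.2 ≤ s) → False :=
    IsPi.iInf (P := fun (a : (Unit × ℕ) × ℕ) s => s ∈ S a.1.2 ∧ a.2 ≤ s)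
      IsPi.false.isPi_of_zero (hmem.and hle)
  have h' : IsSig 2 (fun _ : Unit × ℕ => Set.Iio 1) _ := isSig_eq_one.or
    ((IsSig.iSup (P := fun _ _ => True) (hfin.isSig (n := 1) (by omega)) rePred_true).or
      (IsSig.iSup (P := fun a s => s ∈ S a.2) ((h.all (k := 1)).isSig (n := 1) (by omega))
        (hS.comp ((Computable.snd.comp Computable.fst).pair Computable.snd))))
  exact ((IsPi.iInf (P := fun _ _ => True) (V := fun _ => Set.Iio 1)
    (h'.isPi (n := 2) (by omega)) rePred_true).all (k := 0)).congr
      fun _ _ _ _ => by simp [Function.update]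

/-- The sentence says that all nontrivial elements `g` have finite height at all primes `p_i` with
`i ∉ X`, and that no infinite set `S n` consists of indices of primes dividing `g`. In a computable
structure, the latter means that almost all primes dividing `g` have index in `X`: otherwise the
indices of all primes dividing `g` form some `W_n ⊇ X` with `W_n \ X` infinite, and
`S n ⊆ W_n \ X`. -/
theorem hasPiPseudoScott_ratSubgroup {X : Set ℕ} (hX : REPred fun i => i ∈ X) {S : ℕ → Set ℕ}
    (hS : REPred fun p : ℕ × ℕ => p.2 ∈ S p.1) (hSX : ∀ n, S n ⊆ ceSet n \ X)
    (hSinf : ∀ n, (ceSet n \ X).Infinite → (S n).Infinite) :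
    HasPiPseudoScott 3 (Multiplicative (ratSubgroup X)) := by
  have h3 : IsPi 3 (fun _ : Unit => Set.Iio 0) fun _ M _ _ => ∃ g : M, g ≠ opOne M :=
    (((((isTerm_var_lt 0 (by omega)).equal IsTerm.one).not_zero.isSig (n := 0) (by omega)).ex
      (k := 0)).isPi (n := 2) (by omega)).congr fun _ _ _ _ => by simp [Function.update]
  obtain ⟨f, -, hf⟩ := (isPi_isRankOneDivisible hX 0).and (h3.and
    ((isPi_finite_height hX).and (isPi_not_divisible_of_infinite hS)))
  refine ⟨_, ⟨f (), rfl⟩, isPseudoScott_of (hf ()).1 (hf ()).2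
    ⟨isRankOneDivisible_ratSubgroup X,
      ⟨Multiplicative.ofAdd ⟨1, one_mem_ratSubgroup X⟩, ?_⟩, ?_, ?_⟩ ?_⟩
  · exact fun h => one_ne_zero (α := ℚ) (congrArg Subtype.val h)
  · intro g i
    by_cases hg : g = opOne _
    · exact Or.inl hg
    by_cases hi : i ∈ X
    · exact Or.inr (Or.inl hi)
    · exact Or.inr (Or.inr (exists_height_ratSubgroup hg hi))
  · intro g n
    by_cases hg : g = opOne _
    · exact Or.inl hg
    right
    by_contra! h
    obtain ⟨b, hb⟩ := (finite_divisors_ratSubgroup hg).bddAbove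
    obtain ⟨s, ⟨hs, hbs⟩, -⟩ := h.1 (b + 1)
    have := hb ⟨(hSX n hs).2, h.2 s hs⟩
    omega
  · rintro D _ hD ⟨hbase, ⟨g, hg⟩, hfin, hall⟩
    refine hbase.nonempty_equiv_of_finite hg (fun i hi => ?_) ?_
    · rcases hfin g i with h | h | h
      · exact absurd h hg
      · exact absurd h hi
      · exact h
    · obtain ⟨n, hn⟩ := (hD.rePred_divides g).exists_ceSet_eq
      by_contra hinf
      have hset : {i | i ∉ X ∧ ∃ y : D, opPow y (nthPrime i) = g} = ceSet n \ X := by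
        ext i
        rw [Set.mem_sdiff, hn, Set.mem_ofPred_eq, and_comm]
      rw [hset] at hinf
      rcases hall g n with h | ⟨m, hm⟩ | ⟨s, hs, h⟩
      · exact hg h
      · refine hSinf n hinf ((Set.finite_Iio m).subset fun s hs => ?_)
        by_contra hms
        exact hm s ⟨hs, not_lt.1 hms⟩
      · obtain ⟨y, hy⟩ := (hn s).1 (hSX n hs).1
        exact h y hy

end Sentences

/-! ### No computable d-`Σ₂` pseudo-Scott sentence -/

section NoDSigma

/-- Computable `Σ_0` and `Σ_1` formulas are preserved by embeddings. -/
theorem realize_sigmaFormula_embedding {M N : Type} [groupLang.Structure M]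
    [groupLang.Structure N] (f : M ↪[groupLang] N) {m e : ℕ} (hm : m < 2) {ρ : ℕ → M}
    (h : (sigmaFormula m e).Realize ρ) : (sigmaFormula m e).Realize (f ∘ ρ) := by
  have h0 : ∀ (e : ℕ) (ρ : ℕ → M), (qfOfCode e).Realize (f ∘ ρ) ↔ (qfOfCode e).Realize ρ :=
    realize_qfOfCode_embedding f
  obtain rfl | rfl : m = 0 ∨ m = 1 := by omega
  · rw [sigmaFormula_zero] at h ⊢
    exact (h0 e ρ).2 h
  · obtain ⟨⟨m, xs, j⟩, ht, hlt, ρ', hρ', h⟩ := realize_sigmaFormula_succ.1 h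
    refine realize_sigmaFormula_succ.2 ⟨(m, xs, j), ht, hlt, f ∘ ρ', fun x hx => ?_, ?_⟩
    · exact congrArg f (hρ' x hx)
    · obtain rfl : m = 0 := by simpa using hlt
      simp only [piFormula_zero] at h ⊢
      exact (h0 j ρ').2 h

theorem List.exists_forall_mem_lt (l : List ℕ) : ∃ b, ∀ x ∈ l, x < b :=
  ⟨l.sum + 1, fun _ hx => Nat.lt_succ_of_le (List.le_sum_of_mem hx)⟩

/-- Finitely many values of a sequence can be read off a list. -/
theorem exists_list_getD_eq {β : Type*} (c : ℕ → β) (d : β) (b : ℕ) :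
    ∃ l : List β, ∀ x, l.getD x d = if x < b then c x else d := by
  refine ⟨(List.range b).map c, fun x => ?_⟩
  split_ifs with h
  · simp [List.getD, h]
  · simp [List.getD, h]

theorem fracVal_surjective : Function.Surjective fracVal := by
  intro q
  refine ⟨(q.num.toNat, (-q.num).toNat, q.den - 1), ?_⟩
  have h1 : ((q.num.toNat : ℕ) : ℚ) - ((-q.num).toNat : ℕ) = q.num := by
    have : ((q.num.toNat : ℕ) : ℤ) - ((-q.num).toNat : ℕ) = q.num := by omega
    exact_mod_cast this
  have h2 : ((q.den - 1 : ℕ) : ℚ) + 1 = q.den := by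
    have : q.den - 1 + 1 = q.den := Nat.sub_add_cancel q.den_pos
    exact_mod_cast this
  rw [fracVal, h1, h2, Rat.num_div_den]

/-- The failure of a fixed computable `Π_1` formula at fixed rationals is a c.e. property of the
group, in a uniformly c.e. family of subgroups of `ℚ`. -/
theorem rePred_not_realize_piFormula_one {Y : ℕ → Set ℕ}
    (hY : REPred fun x : ℕ × ℕ => x.2 ∈ Y x.1) {a : ℕ → ℕ × ℕ × ℕ} (ha : Computable a)
    {ρ : ∀ i, ℕ → Multiplicative (ratSubgroup (Y i))}
    (hρ : ∀ i x, ((ρ i x).toAdd : ℚ) = fracVal (a x)) (j : ℕ) :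
    REPred fun i => ¬ (piFormula 1 j).Realize (ρ i) := by
  classical
  obtain ⟨v, hv, hvY⟩ := exists_enumeration_ratSubgroup hY
  let W : ℕ × List ℕ × List ℕ → ℕ → ℕ × ℕ × ℕ := fun z k =>
    bif decide (k ∈ z.2.2) then v z.1 (z.2.1.getD k 0) else a k
  have hW : Computable₂ W := by
    have hmem : Computable fun x : (ℕ × List ℕ × List ℕ) × ℕ => decide (x.2 ∈ x.1.2.2) := by
      have : Primrec fun x : (ℕ × List ℕ × List ℕ) × ℕ =>
          decide (x.1.2.2.idxOf x.2 < x.1.2.2.length) :=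
        (Primrec.nat_lt.comp (Primrec.list_idxOf.comp Primrec.snd
          (Primrec.snd.comp (Primrec.snd.comp Primrec.fst)))
          (Primrec.list_length.comp (Primrec.snd.comp (Primrec.snd.comp Primrec.fst)))).decide
      exact this.to_comp.of_eq fun x => by simp only [List.idxOf_lt_length_iff]
    refine Computable.cond hmem ?_ (ha.comp Computable.snd)
    exact hv.comp (Computable.fst.comp Computable.fst) ((Primrec.list_getD 0).to_comp.comp
      (Computable.fst.comp (Computable.snd.comp Computable.fst)) Computable.snd)
  have hre : REPred fun i => ∃ (z : List ℕ × List ℕ × ℕ),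
      Encodable.encode ((0, z.2) : ℕ × List ℕ × ℕ) ∈ ceSet j ∧
      ¬ (qfOfCode z.2.2).Realize fun k =>
        Multiplicative.ofAdd (fracVal (W (i, z.1, z.2.1) k)) := by
    refine REPred.exists (REPred.and ?_ ?_)
    · refine rePred_mem_ceSet.comp (f := fun x : ℕ × List ℕ × List ℕ × ℕ =>
        (j, Encodable.encode ((0, x.2.2) : ℕ × List ℕ × ℕ))) ?_
      exact (Computable.const j).pair (Computable.encode.comp ((Computable.const 0).pair
        (Computable.snd.comp Computable.snd)))
    · have hc : Computable fun x : ℕ × List ℕ × List ℕ × ℕ =>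
          ((x.1, x.2.1, x.2.2.1), x.2.2.2) :=
        (Computable.fst.pair ((Computable.fst.comp Computable.snd).pair
          (Computable.fst.comp (Computable.snd.comp Computable.snd)))).pair
          (Computable.snd.comp (Computable.snd.comp Computable.snd))
      exact ((computablePred_realize_qfOfCode hW).not.comp hc).to_re
  refine hre.of_eq fun i => ?_
  have hval : ∀ (e : ℕ) (ρ' : ℕ → Multiplicative (ratSubgroup (Y i))),
      (qfOfCode e).Realize ρ' ↔
        (qfOfCode e).Realize fun k => Multiplicative.ofAdd ((ρ' k).toAdd : ℚ) :=
    fun e ρ' => (realize_qfOfCode_embedding (ratInclusion _) e ρ').symm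
  rw [realize_piFormula_succ]
  push Not
  constructor
  · rintro ⟨⟨l, ys, e⟩, ht, h⟩
    let ρ' : ℕ → Multiplicative (ratSubgroup (Y i)) := fun x =>
      if x ∈ ys then .ofAdd ⟨fracVal (v i (l.getD x 0)), (hvY _ _).2 ⟨_, rfl⟩⟩ else ρ i x
    refine ⟨(0, ys, e), ht, Nat.zero_lt_one, ρ', fun x hx => if_neg hx, ?_⟩
    rw [sigmaFormula_zero]
    intro h'
    refine h ?_
    convert (hval e ρ').1 h' using 2 with k
    by_cases hk : k ∈ ys <;> simp [W, ρ', hk, hρ]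
  · rintro ⟨⟨m, ys, e⟩, ht, hlt, ρ', hρ', h⟩
    obtain rfl : m = 0 := by simpa using hlt
    have hn : ∀ k, ∃ n, fracVal (v i n) = ((ρ' k).toAdd : ℚ) := fun k =>
      (hvY _ _).1 (ρ' k).toAdd.2
    choose n hn using hn
    obtain ⟨b, hb⟩ := ys.exists_forall_mem_lt
    obtain ⟨l, hl⟩ := exists_list_getD_eq n 0 b
    refine ⟨(l, ys, e), ht, fun h' => h ?_⟩
    simp only [sigmaFormula_zero]
    refine (hval e ρ').2 ?_
    convert h' using 2 with k
    by_cases hk : k ∈ ys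
    · simp only [W, hk, decide_true, cond_true, hl, hb k hk, if_true, hn]
    · simp only [W, hk, decide_false, cond_false, hρ' k hk, hρ]

/-- The inclusion of subgroups of `ℚ` as an embedding of structures. -/
def ratSubgroupInclusion {X Y : Set ℕ} (h : X ⊆ Y) :
    Multiplicative (ratSubgroup X) ↪[groupLang] Multiplicative (ratSubgroup Y) :=
  groupEmbedding (AddMonoidHom.toMultiplicative (AddSubgroup.inclusion (ratSubgroup_mono h)))
    (AddSubgroup.inclusion_injective (ratSubgroup_mono h))

theorem realize_ratSubgroupInclusion_iff {X Y : Set ℕ} (h : X ⊆ Y) (hYX : Y = X)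
    (φ : InfFormula groupLang) (ρ : ℕ → Multiplicative (ratSubgroup X)) :
    φ.Realize (ratSubgroupInclusion h ∘ ρ) ↔ φ.Realize ρ := by
  subst hYX
  exact Iff.rfl

/-- Finitely many elements of the group obtained by making one more prime `p` invertible lie in
`p⁻ᵏ G` for some `k`, and `x ↦ x / pᵏ` is an isomorphism from `G` to this subgroup. -/
theorem exists_embedding_ratSubgroup_insert (X : Set ℕ) (i : ℕ) (xs : List ℕ)
    (ρ : ℕ → Multiplicative (ratSubgroup (insert i X))) :
    ∃ f : Multiplicative (ratSubgroup X) ↪[groupLang] Multiplicative (ratSubgroup (insert i X)),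
      ∃ ρ' : ℕ → Multiplicative (ratSubgroup X), ∀ x ∈ xs, f (ρ' x) = ρ x := by
  have hp0 : ∀ k, ((nthPrime i ^ k : ℕ) : ℚ) ≠ 0 := fun k => by
    exact_mod_cast (pow_pos (Nat.prime_nth_prime i).pos k).ne'
  have hex : ∀ x, ∃ k, ((ρ x).toAdd : ℚ) * (nthPrime i ^ k : ℕ) ∈ ratSubgroup X := by
    intro x
    have hq := (ρ x).toAdd.2
    generalize ((ρ x).toAdd : ℚ) = q at hq
    obtain ⟨k, d, hd, hqd⟩ := Nat.exists_eq_pow_mul_and_not_dvd q.den_pos.ne' (nthPrime i)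
      (Nat.prime_nth_prime i).ne_one
    refine ⟨k, ?_⟩
    have hd' : IsSmooth X d := by
      intro l hl
      rcases hq l (hqd ▸ hl.mul_left _) with rfl | h
      · exact absurd hl hd
      · exact h
    have hd0 : (d : ℚ) ≠ 0 := by
      rintro h
      have : d = 0 := by exact_mod_cast h
      exact hd (this ▸ dvd_zero _)
    convert div_mem_ratSubgroup hd' q.num using 1
    rw [eq_div_iff hd0, mul_assoc, ← Nat.cast_mul, ← hqd, Rat.mul_den_eq_num]
  choose k hk using hex
  let K := (xs.map k).sum
  have hK : ∀ x ∈ xs, ((ρ x).toAdd : ℚ) * (nthPrime i ^ K : ℕ) ∈ ratSubgroup X := by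
    intro x hx
    have hle : k x ≤ K := List.le_sum_of_mem (List.mem_map_of_mem hx)
    have := (ratSubgroup X).nsmul_mem (hk x) (nthPrime i ^ (K - k x))
    rw [nsmul_eq_mul, mul_left_comm, ← Nat.cast_mul, ← pow_add, Nat.sub_add_cancel hle] at this
    exact this
  have hsm : IsSmooth (insert i X) (nthPrime i ^ K) :=
    (isSmooth_nthPrime_iff.2 (Set.mem_insert i X)).pow K
  let f : ratSubgroup X →+ ratSubgroup (insert i X) :=
    { toFun := fun x => ⟨x / (nthPrime i ^ K : ℕ),
        div_nat_mem_ratSubgroup hsm (ratSubgroup_mono (Set.subset_insert i X) x.2)⟩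
      map_zero' := Subtype.ext (by simp)
      map_add' := fun x y => Subtype.ext (by simp [add_div]) }
  refine ⟨groupEmbedding (AddMonoidHom.toMultiplicative f) ?_, ?_⟩
  · exact fun (x y : ratSubgroup X) hxy =>
      Subtype.ext ((div_left_inj' (hp0 K)).1 (congrArg Subtype.val hxy))
  · classical
    refine ⟨fun x => if hx : x ∈ xs then .ofAdd ⟨_, hK x hx⟩ else 1, fun x hx => ?_⟩
    beta_reduce
    rw [dif_pos hx]
    exact Subtype.ext (mul_div_cancel_right₀ _ (hp0 K))

/-- Making one more prime invertible preserves all computable `Π_2` sentences, because every finite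
tuple of the larger group lies in an isomorphic copy of the smaller one. -/
theorem realize_piFormula_two_insert {X : Set ℕ} {e : ℕ} (he : (piFormula 2 e).IsSentence)
    (h : (piFormula 2 e).HoldsIn (Multiplicative (ratSubgroup X))) (i : ℕ) :
    (piFormula 2 e).HoldsIn (Multiplicative (ratSubgroup (insert i X))) := by
  intro ρ
  refine realize_piFormula_succ.2 fun t ht hlt ρ' _ => ?_
  obtain ⟨f, ρ'', hρ''⟩ := exists_embedding_ratSubgroup_insert X i t.2.1 ρ'
  have hfree : ∀ x ∈ (sigmaFormula t.1 t.2.2).freeVars, x ∈ t.2.1 := fun x hx => by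
    by_contra hxs
    have : x ∈ (piFormula 2 e).freeVars := mem_freeVars_piFormula_succ.2 ⟨t, ht, hlt, hx, hxs⟩
    rw [show (piFormula 2 e).freeVars = ∅ from he] at this
    exact this
  rw [← InfFormula.realize_congr (ρ := f ∘ ρ'') _ fun x hx => hρ'' x (hfree x hx)]
  exact realize_sigmaFormula_embedding f hlt
    (realize_piFormula_succ.1 (h ρ'') t ht hlt ρ'' fun _ _ => rfl)

/-- Making one more prime invertible changes the isomorphism type of the group. -/
theorem not_nonempty_equiv_ratSubgroup_insert {X : Set ℕ} {i : ℕ} (hi : i ∉ X) :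
    ¬ Nonempty (Multiplicative (ratSubgroup (insert i X)) ≃[groupLang]
      Multiplicative (ratSubgroup X)) := by
  rintro ⟨f⟩
  let g : Multiplicative (ratSubgroup X) := .ofAdd ⟨1, one_mem_ratSubgroup X⟩
  obtain ⟨y, hy⟩ := (isRankOneDivisible_ratSubgroup (insert i X)).divisible i
    (Set.mem_insert i X) (f.symm g)
  have hpow : ∀ n, f (opPow y n) = opPow (f y) n := fun n => by
    induction n with
    | zero => exact (f.map_fun' _ _).trans (congrArg _ (Subsingleton.elim _ _))
    | succ n ih =>
      rw [opPow, opPow, ← ih]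
      refine (f.map_fun' _ _).trans (congrArg _ (funext fun j => ?_))
      fin_cases j <;> rfl
  have hdvd := dvd_num_of_opPow_eq (k := 1) hi (g := g) (y := f y) (by
    rw [pow_one, ← hpow, hy, Language.Equiv.apply_symm_apply])
  simp [g, Nat.dvd_one, (Nat.prime_nth_prime i).ne_one] at hdvd

/-- If the prime `p_i` is made invertible, then a `Π_2` sentence remains true. Thus a `Σ_2` conjunct
has to exclude this for all `i ∉ X`. But its failure is witnessed by the failure of a single
computable `Π_1` formula at a fixed tuple, which is c.e. in `i`; so `X` would be computable. -/
theorem not_hasDSigmaPseudoScott_ratSubgroup {X : Set ℕ} (hX : REPred fun i => i ∈ X)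
    (hnc : ¬ ComputablePred fun i => i ∈ X) :
    ¬ HasDSigmaPseudoScott 2 (Multiplicative (ratSubgroup X)) := by
  classical
  rintro ⟨_, ⟨_, _, ⟨e, rfl⟩, ⟨e', rfl⟩, rfl⟩, hsent, hφ⟩
  have hfv : (sigmaFormula 2 e).freeVars ∪ (piFormula 2 e').freeVars = ∅ := by
    rw [← InfFormula.freeVars_and]
    exact hsent
  obtain ⟨hσs, hπs⟩ := Set.union_empty_iff.1 hfv
  obtain ⟨D, _, hD, ⟨f⟩⟩ := hasComputableCopy_ratSubgroup hX
  have hG := ((hφ D hD).2 ⟨f⟩).of_equiv f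
  have hσ := ((InfFormula.realize_and _ _ _).1 (hG fun _ => 1)).1
  have hπ : (piFormula 2 e').HoldsIn (Multiplicative (ratSubgroup X)) := fun ρ =>
    ((InfFormula.realize_and _ _ _).1 (hG ρ)).2
  obtain ⟨⟨m, xs, j⟩, ht, hm, ρ₀, -, hψ⟩ := realize_sigmaFormula_succ.1 hσ
  obtain ⟨r, -, hr⟩ := isPi_piFormula_le 0
  obtain ⟨-, hr⟩ := hr m j (by omega)
  have hfree : ∀ x ∈ (piFormula m j).freeVars, x ∈ xs := fun x hx => by
    by_contra hxs
    have : x ∈ (sigmaFormula 2 e).freeVars :=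
      mem_freeVars_sigmaFormula_succ.2 ⟨_, ht, hm, hx, hxs⟩
    rw [hσs] at this
    exact this
  -- a computable assignment satisfying the same `Π_1` formula
  obtain ⟨b, hb⟩ := xs.exists_forall_mem_lt
  choose c hc using fun x => fracVal_surjective ((ρ₀ x).toAdd : ℚ)
  obtain ⟨l, hl⟩ := exists_list_getD_eq c (0, 0, 0) b
  let ρ₁ : ℕ → Multiplicative (ratSubgroup X) := fun x => if x < b then ρ₀ x else 1
  have hψ₁ : (piFormula m j).Realize ρ₁ :=
    (InfFormula.realize_congr _ fun x hx => (if_pos (hb x (hfree x hx))).symm).1 hψ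
  let ρ : ∀ i, ℕ → Multiplicative (ratSubgroup (insert i X)) := fun i =>
    ratSubgroupInclusion (Set.subset_insert i X) ∘ ρ₁
  have hρ : ∀ i x, ((ρ i x).toAdd : ℚ) = fracVal (l.getD x (0, 0, 0)) := fun i x => by
    rw [hl]
    change ((ρ₁ x).toAdd : ℚ) = _
    by_cases hx : x < b
    · simp [ρ₁, hx, hc]
    · simp [ρ₁, hx, fracVal]
  have hY : REPred fun x : ℕ × ℕ => x.2 ∈ insert x.1 X :=
    (ComputablePred.of_eq_comp Computable.snd Computable.fst).to_re.or (hX.comp Computable.snd)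
  have hre := rePred_not_realize_piFormula_one hY
    ((Primrec.list_getD (0, 0, 0)).to_comp.comp (Computable.const l) Computable.id) hρ (r (m, j))
  refine hnc (ComputablePred.computable_iff_re_compl_re'.2 ⟨hX, hre.of_eq fun i => ?_⟩)
  rw [hr, not_iff_not]
  constructor
  · intro h
    by_contra hi
    obtain ⟨D', _, hD', ⟨f'⟩⟩ := hasComputableCopy_ratSubgroup (X := insert i X)
      (hY.comp ((Computable.const i).pair Computable.id))
    refine not_nonempty_equiv_ratSubgroup_insert hi
      (Nonempty.map (fun g => g.comp f'.symm) ((hφ D' hD').1 ?_))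
    refine InfFormula.HoldsIn.of_equiv f'.symm fun ρ' =>
      (InfFormula.realize_and _ _ _).2 ⟨?_, realize_piFormula_two_insert hπs hπ i ρ'⟩
    refine (InfFormula.realize_congr _ fun x hx => ?_).1
      (realize_sigmaFormula_succ.2 ⟨_, ht, hm, ρ i, fun _ _ => rfl, h⟩)
    rw [hσs] at hx
    exact hx.elim
  · exact fun hi => (realize_ratSubgroupInclusion_iff _ (Set.insert_eq_of_mem hi) _ _).2 hψ₁

end NoDSigma

/-- The halting set can be decided by asking boundedly many questions to the coding set. -/
theorem not_computablePred_codingSet {w : ℕ × ℕ → ℕ → Bool}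
    (hwW : ∀ x : ℕ × ℕ, x.2 ∈ ceSet x.1 ↔ ∃ s, w x s = true) :
    ¬ ComputablePred fun x => x ∈ codingSet w := by
  intro h
  refine not_computablePred_haltingSet ?_
  have h1 : ComputablePred fun x : ℕ × ℕ => Nat.pair (x.2 - 2) x.1 ∉ codingSet w :=
    h.not.comp (Primrec₂.natPair.comp (Primrec.nat_sub.comp Primrec.snd (Primrec.const 2))
      Primrec.fst).to_comp
  have h2 := ((h1.forall_lt_nat (p := fun i n => Nat.pair (n - 2) i ∉ codingSet w)).not).comp
    (f := fun e => e + 2) (Primrec.nat_add.comp Primrec.id (Primrec.const 2)).to_comp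
  convert h2 using 2 with e
  rw [show (e ∈ haltingSet) ↔ ∃ s, w (e, e) s = true from hwW (e, e), ← exists_mem_codingSet_iff]
  push Not
  simp only [Nat.add_sub_cancel, Nat.lt_succ_iff]

theorem mainTheorem1 :
    -- the example
    (∃ X : Set ℕ,
      -- `X` is a Turing complete c.e. set, and there is a uniformly c.e. sequence `S` such that
      -- `S n` is an infinite subset of `W_n \ X` whenever `W_n ⊇ X` and `W_n ≠* X`
      REPred (fun n => n ∈ X) ∧
      TuringEquivalent (charFun X) (charFun haltingSet) ∧
      (∃ S : ℕ → Set ℕ, REPred (fun p : ℕ × ℕ => p.2 ∈ S p.1) ∧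
        ∀ n, X ⊆ ceSet n → (ceSet n \ X).Infinite →
          (S n).Infinite ∧ S n ⊆ ceSet n \ X) ∧
      ∃ G : AddSubgroup ℚ,
        (1 : ℚ) ∈ G ∧
        PFin G = ∅ ∧
        PInf G = (fun i => Nat.nth Nat.Prime i) '' X ∧
        HasComputableCopy (Multiplicative G) ∧
        HasSigmaPseudoScott 3 (Multiplicative G) ∧
        HasPiPseudoScott 3 (Multiplicative G) ∧
        ¬ HasDSigmaPseudoScott 2 (Multiplicative G)) ∧
    -- d-`Σ₂` is contained in `Δ₃`; by the example, the containment is strict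
    (∀ (A : Type) [groupLang.Structure A], HasDSigmaPseudoScott 2 A →
      HasSigmaPseudoScott 3 A ∧ HasPiPseudoScott 3 A) := by
  refine ⟨?_, fun A _ h => h.sigma_and_pi⟩
  obtain ⟨w, hw, hmono, hwW⟩ := rePred_mem_ceSet.exists_stages
  have hX := rePred_codingSet hw hmono
  have hS := rePred_frozenPart hw
  exact ⟨codingSet w, hX, ⟨hX.turingReducible_haltingSet, haltingSet_turingReducible hwW⟩,
    ⟨frozenPart w, hS, fun n _ h => ⟨frozenPart_infinite hwW h, frozenPart_subset n⟩⟩,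
    ratSubgroup (codingSet w), one_mem_ratSubgroup _, pFin_ratSubgroup _, pInf_ratSubgroup _,
    hasComputableCopy_ratSubgroup hX, hasSigmaPseudoScott_ratSubgroup hX,
    hasPiPseudoScott_ratSubgroup hX hS frozenPart_subset fun _ h => frozenPart_infinite hwW h,
    not_hasDSigmaPseudoScott_ratSubgroup hX (not_computablePred_codingSet hwW)⟩
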